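/- **Setting.** Let $A=[a_1,\dots,a_m]\in\mathbb R^{n\times m}$, let $W=\mathrm{diag}(w_1,\dots,w_m)$ with all $w_i\neq 0$, and let $1\le k\le \mathrm{rank}(A)$. Put $p_i=w_i^{-2}/\|W^{-1}\|_F^2$, where $\|W^{-1}\|_F^2=\sum_j w_j^{-2}$. For $(s_1,\dots,s_k)\in[m]^k$ (repetitions allowed) let $$f_{s_1,\dots,s_k}(x)=\Big(\prod_{i=1}^k p_{s_i}\Big)\det\Big[xI-\sum_{i=1}^k w_{s_i}^2a_{s_i}a_{s_i}^T\Big],$$ and for $0\le j<k$ let $f_{s_1,\dots,s_j}=\sum_{s_{j+1},\dots,s_k\in[m]}f_{s_1,\dots,s_k}$; for $j=0$ this is the expected characteristic polynomial $f_\emptyset$. For a real-rooted polynomial $p$ let $\lambda_k(p)$ be its $k$-th largest root, counted with multiplicity. For a matrix $M$ let $\sigma_{\min}(M)=\min_{\|x\|_2=1}\|Mx\|_2$. For $S\subseteq[m]$ let $A_S$ be the matrix of the columns of $A$ indexed by $S$, and $W_S=\mathrm{diag}(w_i)_{i\in S}$. **Greedy algorithm.** For $j=1,\dots,k$ choose $$s_j\in\operatorname*{argmax}_{s\in[m]\setminus\{s_1,\dots,s_{j-1}\}}\lambda_k\big(f_{s_1,\dots,s_{j-1},s}\big),$$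 with ties broken arbitrarily, and output $S=\{s_1,\dots,s_k\}$. **Cost model.** A program is a fixed finite text for a random access machine working with natural numbers (indices, addresses) and exact real numbers. Each arithmetic operation, comparison, memory access and assignment costs one step. In addition the machine can compute the $k$-th largest root of a real-rooted polynomial of degree $d$, given by its coefficients, at a price of $d^3$ steps (the price charged for the QR algorithm applied to a companion matrix). **Theorem.** (1) For all $A$, $W$, $k$ as above, every $f_{s_1,\dots,s_j}$ with $0\le j\le k$ is real-rooted of degree $n$, and every possible output $S$ of the greedy algorithm has exactly $k$ elements and satisfies $$\sigma_{\min}(A_SW_S)^2\ \ge\ \lambda_k(f_\emptyset).$$ (2) Let $\theta>2$ be an exponent of matrix multiplication, i.e. some program multiplies any two real $n\times n$ matrices in $O(n^\theta)$ steps. Then there are a single program and a constant $c$ such that, for all $n,m,k$ and all $A$, $W$ as above, the program on input $(A,w_1,\dots,w_m,k)$ outputs a sequence $s_1,\dots,s_k$ chosen according to the rule of the greedy algorithm, after at most $$c\,k\Big(m-\frac k2\Big)n^{\theta+1}$$ steps. -/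

import Mathlib

open Polynomial

noncomputable section

/-! ### Matrices, polynomials and the greedy selection rule -/

namespace WeightedRI

/-- `λ_k(p)`: the `k`-th largest root (`k = 1, 2, …`) of a real-rooted polynomial `p`, roots being
counted with multiplicity. It is only meaningful if `p` is real-rooted and `1 ≤ k ≤ deg p`. -/
def kthLargestRoot (k : ℕ) (p : ℝ[X]) : ℝ :=
  (p.roots.sort (· ≥ ·)).getD (k - 1) 0

/-- The least singular value `σ_min(M) = min_{‖x‖₂ = 1} ‖M x‖₂`. -/
def sigmaMin {n : ℕ} {ι : Type} [Fintype ι] [DecidableEq ι] (M : Matrix (Fin n) ι ℝ) : ℝ :=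
  ⨅ x : {x : EuclideanSpace ℝ ι // ‖x‖ = 1}, ‖Matrix.toEuclideanLin M x.1‖

/-- `A_S`: the columns of `A` with index in `S`. -/
def colsOf {n m : ℕ} (A : Matrix (Fin n) (Fin m) ℝ) (S : Finset (Fin m)) :
    Matrix (Fin n) S ℝ :=
  A.submatrix id Subtype.val

/-- `W_S`: the diagonal matrix `W = diag(w_1, …, w_m)` restricted to rows and columns in `S`. -/
def weightsOf {m : ℕ} (w : Fin m → ℝ) (S : Finset (Fin m)) : Matrix S S ℝ :=
  (Matrix.diagonal w).submatrix Subtype.val Subtype.val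

/-- The probability `p_i = w_i⁻² / ‖W⁻¹‖_F²` of picking the `i`-th column. -/
def colProb {m : ℕ} (w : Fin m → ℝ) (i : Fin m) : ℝ :=
  (w i ^ 2)⁻¹ / ∑ j, (w j ^ 2)⁻¹

/-- The polynomial of a full assignment `s_1, …, s_k`:
`(∏ p_{s_i}) · det [x I - ∑ w_{s_i}² a_{s_i} a_{s_i}ᵀ]`, where `a_s` is column `s` of `A`. -/
def fullPoly {n m : ℕ} (A : Matrix (Fin n) (Fin m) ℝ) (w : Fin m → ℝ) (l : List (Fin m)) : ℝ[X] :=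
  C (l.map (colProb w)).prod *
    ((l.map fun s => w s ^ 2 • Matrix.vecMulVec (A.col s) (A.col s)).sum).charpoly

/-- The polynomial of a partial assignment `l = (s_1, …, s_j)`, `j ≤ k`: the sum of the polynomials
of all its completions `(s_1, …, s_j, s_{j+1}, …, s_k) ∈ [m]^k` (repetitions are allowed).
For `l = []` this is the expected characteristic polynomial `f_∅`. -/
def partialPoly {n m : ℕ} (A : Matrix (Fin n) (Fin m) ℝ) (w : Fin m → ℝ) (k : ℕ)
    (l : List (Fin m)) : ℝ[X] :=
  ∑ t : Fin (k - l.length) → Fin m, fullPoly A w (l ++ List.ofFn t)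

/-- `GreedyRun A w k l`: the greedy algorithm with sampling parameter `k` can have chosen the
indices `l = (s_1, …, s_j)`, in this order, in its first `j` rounds. In each round it appends an
index, not chosen before, at which `λ_k (f_{s_1, …, s_{j-1}, s})` is maximal; ties are broken
arbitrarily. The algorithm stops after `k` rounds. -/
inductive GreedyRun {n m : ℕ} (A : Matrix (Fin n) (Fin m) ℝ) (w : Fin m → ℝ) (k : ℕ) :
    List (Fin m) → Prop
  | nil : GreedyRun A w k []
  | snoc (l : List (Fin m)) (s : Fin m) (hl : GreedyRun A w k l) (hs : s ∉ l)
      (hmax : ∀ t : Fin m, t ∉ l →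
        kthLargestRoot k (partialPoly A w k (l ++ [t])) ≤
          kthLargestRoot k (partialPoly A w k (l ++ [s]))) :
      GreedyRun A w k (l ++ [s])

end WeightedRI

/-! ### A real random access machine with a step count

Programs are finite texts in a small imperative language; one program serves inputs of all sizes.
The memory holds natural-number variables, natural-number arrays (indices and addresses) and
two-dimensional arrays of exact real numbers. -/

namespace RealRAM

structure State where
  /-- natural-number variables -/
  nvar : ℕ → ℕ
  /-- natural-number arrays: `narr a i` is cell `i` of array `a` -/
  narr : ℕ → ℕ → ℕ
  /-- real arrays: `rarr a i j` is cell `(i, j)` of array `a` -/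
  rarr : ℕ → ℕ → ℕ → ℝ

/-- Expressions over the natural numbers (subtraction is truncated). -/
inductive NExp
  | const (c : ℕ)
  | var (x : ℕ)
  | get (a : ℕ) (i : NExp)
  | add (e f : NExp)
  | sub (e f : NExp)

/-- Expressions over the real numbers (division by zero gives zero). -/
inductive RExp
  | ofNat (e : NExp)
  | get (a : ℕ) (i j : NExp)
  | add (e f : RExp)
  | sub (e f : RExp)
  | mul (e f : RExp)
  | div (e f : RExp)

/-- Tests. -/
inductive BExp
  | natLt (e f : NExp)
  | realLe (e f : RExp)
  | not (b : BExp)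
  | and (b c : BExp)

def NExp.eval (σ : State) : NExp → ℕ
  | const c => c
  | var x => σ.nvar x
  | get a i => σ.narr a (i.eval σ)
  | add e f => e.eval σ + f.eval σ
  | sub e f => e.eval σ - f.eval σ

def RExp.eval (σ : State) : RExp → ℝ
  | ofNat e => (e.eval σ : ℝ)
  | get a i j => σ.rarr a (i.eval σ) (j.eval σ)
  | add e f => e.eval σ + f.eval σ
  | sub e f => e.eval σ - f.eval σ
  | mul e f => e.eval σ * f.eval σ
  | div e f => e.eval σ / f.eval σ

def BExp.eval (σ : State) : BExp → Prop
  | natLt e f => e.eval σ < f.eval σ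
  | realLe e f => e.eval σ ≤ f.eval σ
  | not b => ¬ b.eval σ
  | and b c => b.eval σ ∧ c.eval σ

/-- The cost of evaluating an expression: one step per constant, memory access and operation. -/
def NExp.cost : NExp → ℕ
  | const _ => 1
  | var _ => 1
  | get _ i => i.cost + 1
  | add e f => e.cost + f.cost + 1
  | sub e f => e.cost + f.cost + 1

def RExp.cost : RExp → ℕ
  | ofNat e => e.cost + 1
  | get _ i j => i.cost + j.cost + 1
  | add e f => e.cost + f.cost + 1
  | sub e f => e.cost + f.cost + 1
  | mul e f => e.cost + f.cost + 1
  | div e f => e.cost + f.cost + 1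

def BExp.cost : BExp → ℕ
  | natLt e f => e.cost + f.cost + 1
  | realLe e f => e.cost + f.cost + 1
  | not b => b.cost + 1
  | and b c => b.cost + c.cost + 1

/-- Programs. -/
inductive Cmd
  | skip
  /-- `nvar x := e` -/
  | setVar (x : ℕ) (e : NExp)
  /-- `narr a i := e` -/
  | setNat (a : ℕ) (i e : NExp)
  /-- `rarr a i j := e` -/
  | setReal (a : ℕ) (i j : NExp) (e : RExp)
  /-- `rarr a i j :=` the `k`-th largest root of the real-rooted polynomial of degree `d` whose
  coefficients are `rarr b r 0, …, rarr b r d` -/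
  | root (a : ℕ) (i j : NExp) (b : ℕ) (r d k : NExp)
  | seq (c c' : Cmd)
  | ite (b : BExp) (c c' : Cmd)
  | while (b : BExp) (c : Cmd)

def State.setVar (σ : State) (x v : ℕ) : State :=
  { σ with nvar := Function.update σ.nvar x v }

def State.setNat (σ : State) (a i v : ℕ) : State :=
  { σ with narr := Function.update σ.narr a (Function.update (σ.narr a) i v) }

def State.setReal (σ : State) (a i j : ℕ) (v : ℝ) : State :=
  let row := Function.update (σ.rarr a i) j v
  { σ with rarr := Function.update σ.rarr a (Function.update (σ.rarr a) i row) }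

/-- The polynomial of degree at most `d` whose coefficients are stored in row `r` of the real
array `b`. -/
def State.rowPoly (σ : State) (b r d : ℕ) : ℝ[X] :=
  ∑ t ∈ Finset.range (d + 1), C (σ.rarr b r t) * X ^ t

/-- `Exec c σ τ t`: started in state `σ`, the program `c` halts in state `τ` after `t` steps.
Arithmetic operations, comparisons, memory accesses and assignments cost one step each. Computing
the `k`-th largest root of a polynomial of degree `d` is charged `d ^ 3` steps (the price of the
QR algorithm for its companion matrix); it is possible only for real-rooted polynomials. -/
inductive Exec : Cmd → State → State → ℕ → Prop
  | skip (σ : State) : Exec .skip σ σ 1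
  | setVar (σ : State) (x : ℕ) (e : NExp) :
      Exec (.setVar x e) σ (σ.setVar x (e.eval σ)) (e.cost + 1)
  | setNat (σ : State) (a : ℕ) (i e : NExp) :
      Exec (.setNat a i e) σ (σ.setNat a (i.eval σ) (e.eval σ)) (i.cost + e.cost + 1)
  | setReal (σ : State) (a : ℕ) (i j : NExp) (e : RExp) :
      Exec (.setReal a i j e) σ (σ.setReal a (i.eval σ) (j.eval σ) (e.eval σ))
        (i.cost + j.cost + e.cost + 1)
  | root (σ : State) (a : ℕ) (i j : NExp) (b : ℕ) (r d k : NExp)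
      (hlead : σ.rarr b (r.eval σ) (d.eval σ) ≠ 0)
      (hreal : (σ.rowPoly b (r.eval σ) (d.eval σ)).Splits)
      (hk : 1 ≤ k.eval σ) (hkd : k.eval σ ≤ d.eval σ) :
      Exec (.root a i j b r d k) σ
        (σ.setReal a (i.eval σ) (j.eval σ)
          (WeightedRI.kthLargestRoot (k.eval σ) (σ.rowPoly b (r.eval σ) (d.eval σ))))
        (i.cost + j.cost + r.cost + d.cost + k.cost + d.eval σ ^ 3 + 1)
  | seq {c c' : Cmd} {σ τ ρ : State} {t t' : ℕ} (h : Exec c σ τ t) (h' : Exec c' τ ρ t') :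
      Exec (.seq c c') σ ρ (t + t')
  | iteTrue {b : BExp} {c c' : Cmd} {σ τ : State} {t : ℕ} (hb : b.eval σ) (h : Exec c σ τ t) :
      Exec (.ite b c c') σ τ (b.cost + t + 1)
  | iteFalse {b : BExp} {c c' : Cmd} {σ τ : State} {t : ℕ} (hb : ¬ b.eval σ)
      (h : Exec c' σ τ t) :
      Exec (.ite b c c') σ τ (b.cost + t + 1)
  | whileTrue {b : BExp} {c : Cmd} {σ τ ρ : State} {t t' : ℕ} (hb : b.eval σ)
      (h : Exec c σ τ t) (h' : Exec (.while b c) τ ρ t') :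
      Exec (.while b c) σ ρ (b.cost + t + t' + 1)
  | whileFalse {b : BExp} {c : Cmd} {σ : State} (hb : ¬ b.eval σ) :
      Exec (.while b c) σ σ (b.cost + 1)

/-- The value in cell `(i, j)` of a matrix, and `0` outside the matrix. -/
def cell {n m : ℕ} (M : Matrix (Fin n) (Fin m) ℝ) (i j : ℕ) : ℝ :=
  if h : i < n ∧ j < m then M ⟨i, h.1⟩ ⟨j, h.2⟩ else 0

/-- Input of the matrix multiplication problem: variable `0` holds `n`, the real arrays `0` and `1`
hold the two `n × n` matrices; the rest of the memory is zero. -/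
def matMulInput {n : ℕ} (M N : Matrix (Fin n) (Fin n) ℝ) : State where
  nvar x := if x = 0 then n else 0
  narr _ _ := 0
  rarr a := if a = 0 then cell M else if a = 1 then cell N else fun _ _ => 0

/-- `θ` is an admissible exponent of matrix multiplication: some program multiplies any two real
`n × n` matrices within `O(n ^ θ)` steps, leaving the product in the real array `2`. -/
def IsMatMulExponent (θ : ℝ) : Prop :=
  ∃ (P : Cmd) (c : ℝ), ∀ (n : ℕ), 1 ≤ n → ∀ M N : Matrix (Fin n) (Fin n) ℝ,
    ∃ (τ : State) (t : ℕ), Exec P (matMulInput M N) τ t ∧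
      (∀ i j : Fin n, τ.rarr 2 i j = (M * N) i j) ∧ (t : ℝ) ≤ c * (n : ℝ) ^ θ

/-- Input of the column selection problem: the variables `0`, `1`, `2` hold `n`, `m`, `k`, the real
array `0` holds the `n × m` matrix `A`, row `0` of the real array `1` holds the weights
`w_1, …, w_m`; the rest of the memory is zero. -/
def selectInput {n m : ℕ} (A : Matrix (Fin n) (Fin m) ℝ) (w : Fin m → ℝ) (k : ℕ) : State where
  nvar x := if x = 0 then n else if x = 1 then m else if x = 2 then k else 0
  narr _ _ := 0
  rarr a := if a = 0 then cell A
    else if a = 1 then cell (Matrix.of fun (_ : Fin 1) (j : Fin m) => w j)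
    else fun _ _ => 0

/-- The sequence of the first `k` entries of the natural-number array `0`. -/
def State.output (σ : State) (k : ℕ) : List ℕ :=
  (List.range k).map (σ.narr 0)

end RealRAM

end

/-!
Since `p_s w_s²` does not depend on `s`, averaging `det (x I - M + y A Aᵀ)` over a random rank-one
step of `M` amounts to applying an operator `1 - c ∂/∂y`, which preserves the absence of zeros in
the upper half plane. Hence the expected characteristic polynomials, obtained at `y = 0`, are
real-rooted. Adding a rank-one matrix increases the argument of such a polynomial above the real
axis, by at most `π`; so the polynomials of all one-step continuations interlace, and one of them
has a `k`-th largest root that is not below the one of their mean. A repeated index makes that root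
nonpositive, as all completions then have rank less than `k`, so the greedy choice never lowers the
`k`-th largest root. At the end it is the least eigenvalue of the Gram matrix of `A_S W_S`.

For the algorithm, the expected characteristic polynomial is recovered by interpolation from the
determinants of `1 + i M + r A Aᵀ` at the points `0 ≤ r, i ≤ n` of a grid, where `M` is the sum of
the matrices `w_s² a_s a_sᵀ` already chosen. For each grid point the program stores the determinant
and the solutions `x_s` of `(1 + i M + r A Aᵀ) x_s = a_s`. The scalar products `a_sᵀ x_s` yield the
determinants for all candidates `s`, and by the Sherman-Morrison formula choosing a column costs
`O(m n)` per grid point, hence `O(k m n³)` steps in all.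
-/

noncomputable section

namespace WeightedRI

open Matrix

/-! ### Determinants of rank-one perturbations -/

section RankOneUpdates

variable {n : Type*} [Fintype n] [DecidableEq n]

theorem det_add_vecMulVec_of_det_ne_zero {F : Type*} [Field F] {N : Matrix n n F}
    (h : N.det ≠ 0) (u v : n → F) : (N + vecMulVec u v).det = N.det * (1 + v ⬝ᵥ N⁻¹ *ᵥ u) := by
  rw [vecMulVec_eq Unit, det_add_replicateCol_mul_replicateRow h.isUnit, det_unique (n := Unit),
    Matrix.add_apply, one_apply_eq, Matrix.mul_assoc, mul_apply]
  simp [dotProduct, mulVec, mul_apply]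

/-- The lemma holds for `N + X` in place of `N`, whose determinant is not zero; put `X = 0`. -/
theorem det_add_vecMulVec {R : Type*} [CommRing R] [IsDomain R] (N : Matrix n n R) (u v : n → R) :
    (N + vecMulVec u v).det = N.det + v ⬝ᵥ N.adjugate *ᵥ u := by
  let g : R[X] →+* FractionRing R[X] := algebraMap _ _
  have hg : Function.Injective g := IsFractionRing.injective _ _
  let N' : Matrix n n R[X] := charmatrix (-N)
  have hN' : (g.mapMatrix N').det ≠ 0 := by
    rw [← RingHom.map_det]
    exact (map_ne_zero_iff g hg).2 (charpoly_monic (-N)).ne_zero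
  have hX : (N' + vecMulVec (C ∘ u) (C ∘ v)).det =
      N'.det + (C ∘ v) ⬝ᵥ N'.adjugate *ᵥ (C ∘ u) := by
    apply hg
    have h := det_add_vecMulVec_of_det_ne_zero hN' (g ∘ C ∘ u) (g ∘ C ∘ v)
    rw [inv_def, Ring.inverse_eq_inv', smul_mulVec, dotProduct_smul, smul_eq_mul, mul_add,
      mul_one, mul_inv_cancel_left₀ hN'] at h
    have hvec : g.mapMatrix (vecMulVec (C ∘ u) (C ∘ v)) = vecMulVec (g ∘ C ∘ u) (g ∘ C ∘ v) := by
      ext i j; exact map_mul g _ _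
    have hdot : g ((C ∘ v) ⬝ᵥ N'.adjugate *ᵥ (C ∘ u)) =
        (g ∘ C ∘ v) ⬝ᵥ (g.mapMatrix N').adjugate *ᵥ (g ∘ C ∘ u) := by
      rw [RingHom.map_dotProduct, ← RingHom.map_adjugate]
      congr 1; ext i; exact RingHom.map_mulVec _ _ _ _
    rw [RingHom.map_det, map_add, map_add, RingHom.map_det, hvec, hdot, h]
  have hN : (evalRingHom (0 : R)).mapMatrix N' = N := by
    ext i j; by_cases h : i = j <;> simp [N', h]
  have h0 := congrArg (evalRingHom (0 : R)) hX
  rw [map_add, RingHom.map_det, RingHom.map_det, map_add, hN] at h0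
  convert h0 using 2
  · congr 1; ext i j; simp [vecMulVec_apply]
  · rw [← hN, ← RingHom.map_adjugate]; simp [dotProduct, mulVec, eval_finsetSum]

end RankOneUpdates

/-! ### Determinants along a line of matrices -/

section DetPencil

variable {n R : Type*} [Fintype n] [DecidableEq n] [CommRing R]

/-- The polynomial `det (N + X B)`. -/
def detPencil (N B : Matrix n n R) : R[X] := (N.map C + (X : R[X]) • B.map C).det

theorem eval_detPencil (N B : Matrix n n R) (y : R) :
    (detPencil N B).eval y = (N + y • B).det := by
  rw [detPencil, ← coe_evalRingHom, RingHom.map_det]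
  congr 1; ext i j; simp [mul_comm y]

theorem natDegree_detPencil_le (N B : Matrix n n R) :
    (detPencil N B).natDegree ≤ Fintype.card n := by
  rw [detPencil, add_comm]
  exact natDegree_det_X_add_C_le B N

theorem derivative_detPencil (N B : Matrix n n R) :
    derivative (detPencil N B) =
      ((N.map C + (X : R[X]) • B.map C).adjugate * B.map C).trace := by
  set Q := N.map C + (X : R[X]) • B.map C with hQ
  have hentry (i j) : derivative (Q i j) = C (B i j) := by simp [hQ]
  have hcols : derivative (detPencil N B) = ∑ i, (Q.updateCol i ((B.map C).col i)).det := by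
    simp_rw [detPencil, ← hQ, det_apply, Polynomial.derivative_sum]
    rw [Finset.sum_comm]
    refine Finset.sum_congr rfl fun σ _ => ?_
    rw [derivative_smul, derivative_prod_finset, Finset.smul_sum]
    refine Finset.sum_congr rfl fun i _ => ?_
    rw [hentry, ← Finset.prod_erase_mul _ _ (Finset.mem_univ i)]
    congr 2
    · exact Finset.prod_congr rfl fun j hj => by rw [updateCol_ne (Finset.ne_of_mem_erase hj)]
    · simp
  rw [hcols, trace]
  refine Finset.sum_congr rfl fun i _ => ?_
  rw [← cramer_apply, cramer_eq_adjugate_mulVec, diag_apply, mul_apply_eq_vecMul]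
  simp [mulVec, vecMul, dotProduct]

variable {ι : Type*} [Fintype ι]

theorem derivative_detPencil_sum_vecMulVec (N : Matrix n n R) (a : ι → n → R) :
    derivative (detPencil N (∑ s, vecMulVec (a s) (a s))) =
      ∑ s, (C ∘ a s) ⬝ᵥ (N.map C + (X : R[X]) •
        (∑ s, vecMulVec (a s) (a s)).map C).adjugate *ᵥ (C ∘ a s) := by
  rw [derivative_detPencil]
  set Q := (N.map C + (X : R[X]) • (∑ s, vecMulVec (a s) (a s)).map C).adjugate
  have hmap : (∑ s, vecMulVec (a s) (a s)).map C = ∑ s, vecMulVec (C ∘ a s) (C ∘ a s) := by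
    ext i j : 2; simp [Matrix.sum_apply, vecMulVec_apply]
  rw [hmap, Finset.mul_sum, trace_sum]
  refine Finset.sum_congr rfl fun s _ => ?_
  rw [mul_vecMulVec, trace_vecMulVec, dotProduct_comm]

theorem detPencil_add_smul_vecMulVec [IsDomain R] (N B : Matrix n n R) (t : R) (u : n → R) :
    detPencil (N + t • vecMulVec u u) B = detPencil N B +
      C t * ((C ∘ u) ⬝ᵥ (N.map C + (X : R[X]) • B.map C).adjugate *ᵥ (C ∘ u)) := by
  have h := det_add_vecMulVec (N.map C + (X : R[X]) • B.map C) (C t • (C ∘ u)) (C ∘ u)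
  rw [mulVec_smul, dotProduct_smul, smul_eq_mul] at h
  rw [detPencil, detPencil, ← h]
  congr 1
  ext i j : 2; simp [vecMulVec_apply]; ring

end DetPencil

/-! ### The operator `F ↦ F + κ F'` -/

section OneAddDeriv

/-- The differential operator `F ↦ F + κ F'`. -/
def oneAddDeriv {R : Type*} [CommRing R] (κ : R) : R[X] →ₗ[R] R[X] := 1 + κ • derivative

theorem oneAddDeriv_apply {R : Type*} [CommRing R] (κ : R) (F : R[X]) :
    oneAddDeriv κ F = F + κ • derivative F := rfl

theorem eval_zero_oneAddDeriv_pow {R : Type*} [CommRing R] (κ : R) (q : ℕ) {N : ℕ} {F : R[X]}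
    (hF : F.natDegree < N) :
    ((oneAddDeriv κ ^ q) F).eval 0 =
      ∑ d ∈ Finset.range N, (q.descFactorial d : R) * κ ^ d * F.coeff d := by
  have hbinom : oneAddDeriv κ ^ q = ∑ d ∈ Finset.range (q + 1),
      (q.choose d : ℕ) • ((κ • derivative : R[X] →ₗ[R] R[X]) ^ d) := by
    rw [oneAddDeriv, add_comm, Commute.add_pow (Commute.one_right _)]
    exact Finset.sum_congr rfl fun d _ => by rw [one_pow, mul_one, nsmul_eq_mul, Nat.cast_comm]
  have hterm (d : ℕ) : (((q.choose d : ℕ) • ((κ • derivative : R[X] →ₗ[R] R[X]) ^ d)) F).eval 0 =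
      (q.descFactorial d : R) * κ ^ d * F.coeff d := by
    rw [_root_.smul_pow, LinearMap.smul_apply, LinearMap.smul_apply, Module.End.pow_apply,
      eval_smul, eval_smul, ← coeff_zero_eq_eval_zero, coeff_iterate_derivative,
      Nat.descFactorial_eq_factorial_mul_choose q]
    simp [Nat.descFactorial_self]; ring
  rw [hbinom, LinearMap.sum_apply, eval_finsetSum]
  simp_rw [hterm]
  rcases le_total (q + 1) N with h | h
  · refine Finset.sum_subset (Finset.range_subset_range.2 h) fun d _ hd => ?_
    rw [Nat.descFactorial_of_lt (by simpa using hd)]; simp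
  · refine (Finset.sum_subset (Finset.range_subset_range.2 h) fun d _ hd => ?_).symm
    rw [coeff_eq_zero_of_natDegree_lt (hF.trans_le (by simpa using hd)), mul_zero]

theorem im_eval_derivative_div_eval_neg {F : ℂ[X]} (hF : ∀ z : ℂ, 0 ≤ z.im → F.eval z ≠ 0)
    (hroots : F.roots ≠ 0) {y : ℂ} (hy : 0 ≤ y.im) :
    (F.derivative.eval y / F.eval y).im < 0 := by
  have hneg : ∀ z ∈ F.roots, (1 / (y - z)).im < 0 := by
    intro z hz
    have hz0 : z.im < 0 := by
      by_contra! h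
      exact hF z h (isRoot_of_mem_roots hz)
    have hne : y - z ≠ 0 := fun h => by
      rw [sub_eq_zero.1 h] at hy; exact hy.not_gt hz0
    rw [one_div, Complex.inv_im]
    exact div_neg_of_neg_of_pos (by rw [Complex.sub_im]; linarith) (Complex.normSq_pos.2 hne)
  rw [(IsAlgClosed.splits F).eval_derivative_div_eval_of_ne_zero (hF y hy),
    ← Complex.coe_imAddGroupHom, map_multiset_sum, Multiset.map_map]
  simpa using Multiset.sum_lt_sum_of_nonempty hroots hneg

/-- `F - c F'` vanishes only where `F' / F = 1 / c`, but `F' / F = ∑ 1 / (y - z)`, the sum being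
over the roots `z` of `F`, has negative imaginary part for `y` in the upper half plane. -/
theorem eval_oneAddDeriv_ne_zero {F : ℂ[X]} (hF : ∀ y : ℂ, 0 ≤ y.im → F.eval y ≠ 0) {c : ℝ}
    {y : ℂ} (hy : 0 ≤ y.im) : (oneAddDeriv (-c : ℂ) F).eval y ≠ 0 := by
  intro h0
  have hFy := hF y hy
  have heq : F.eval y = c * F.derivative.eval y := by
    rw [oneAddDeriv_apply, eval_add, eval_smul, smul_eq_mul] at h0
    linear_combination h0
  obtain ⟨hc, hF'⟩ := mul_ne_zero_iff.1 (heq ▸ hFy)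
  have hreal : F.derivative.eval y / F.eval y = ((c⁻¹ : ℝ) : ℂ) := by
    rw [heq]; push_cast; field_simp
  have hroots : F.roots ≠ 0 := by
    intro h
    have hd := (IsAlgClosed.splits F).eval_derivative_div_eval_of_ne_zero hFy
    rw [h, Multiset.map_zero, Multiset.sum_zero] at hd
    exact (div_ne_zero hF' hFy) hd
  have hlt := im_eval_derivative_div_eval_neg hF hroots hy
  rw [hreal, Complex.ofReal_im] at hlt
  exact lt_irrefl _ hlt

theorem eval_oneAddDeriv_pow_ne_zero {F : ℂ[X]} (hF : ∀ y : ℂ, 0 ≤ y.im → F.eval y ≠ 0) (c : ℝ)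
    (q : ℕ) {y : ℂ} (hy : 0 ≤ y.im) : ((oneAddDeriv (-c : ℂ) ^ q) F).eval y ≠ 0 := by
  induction q generalizing y with
  | zero => exact hF y hy
  | succ q ih =>
    rw [pow_succ', Module.End.mul_apply]
    exact eval_oneAddDeriv_ne_zero (fun _ => ih) hy

end OneAddDeriv

/-! ### Means over random walks -/

section WalkMean

variable {ι E V V' : Type*} [Fintype ι] [AddCommMonoid E]
  [AddCommMonoid V] [Module ℝ V] [AddCommMonoid V'] [Module ℝ V']

/-- The mean of `F` at the end of a walk of `q` independent steps that starts at `M`; a step adds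
`U s` with probability `p s`. -/
def walkMean (p : ι → ℝ) (U : ι → E) : ℕ → (E → V) → E → V
  | 0, F, M => F M
  | q + 1, F, M => ∑ s, p s • walkMean p U q F (M + U s)

variable (p : ι → ℝ) (U : ι → E) (q : ℕ)

theorem map_walkMean (φ : V →ₗ[ℝ] V') (F : E → V) (M : E) :
    φ (walkMean p U q F M) = walkMean p U q (fun M => φ (F M)) M := by
  induction q generalizing M with
  | zero => rfl
  | succ q ih => simp [walkMean, ih]

theorem walkMean_add_right (F : E → V) (M L : E) :
    walkMean p U q F (M + L) = walkMean p U q (fun M => F (M + L)) M := by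
  induction q generalizing M with
  | zero => rfl
  | succ q ih => simp only [walkMean, ← ih, add_right_comm]

theorem walkMean_add (F G : E → V) (M : E) :
    walkMean p U q (fun M => F M + G M) M = walkMean p U q F M + walkMean p U q G M := by
  induction q generalizing M with
  | zero => rfl
  | succ q ih => simp only [walkMean, ih, smul_add, Finset.sum_add_distrib]

theorem walkMean_mul_left {K : Type*} [CommRing K] [Algebra ℝ K] (z : K) (F : E → K) (M : E) :
    walkMean p U q (fun M => z * F M) M = z * walkMean p U q F M :=
  (map_walkMean p U q (LinearMap.mulLeft ℝ z) F M).symm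

variable {p U q}

theorem walkMean_const (hp : ∑ s, p s = 1) (v : V) (M : E) :
    walkMean p U q (fun _ => v) M = v := by
  induction q generalizing M with
  | zero => rfl
  | succ q ih => simp only [walkMean, ih, ← Finset.sum_smul, hp, one_smul]

theorem walkMean_pos (hp : ∑ s, p s = 1) (hp0 : ∀ s, 0 ≤ p s) {T : E → Prop}
    (hT : ∀ M, T M → ∀ s, T (M + U s)) {F : E → ℝ} (hF : ∀ M, T M → 0 < F M) {M : E} (hM : T M) :
    0 < walkMean p U q F M := by
  obtain ⟨s, -, hs⟩ : ∃ s ∈ Finset.univ, 0 < p s :=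
    Finset.exists_lt_of_sum_lt (by simp [hp])
  induction q generalizing M with
  | zero => exact hF M hM
  | succ q ih =>
    exact Finset.sum_pos' (fun s _ => mul_nonneg (hp0 s) (ih (hT M hM s)).le)
      ⟨s, Finset.mem_univ s, mul_pos hs (ih (hT M hM s))⟩

end WalkMean

/-! ### Mean determinants of rank-one random walks -/

section WalkMeanDet

variable {n K ι E : Type*} [Fintype n] [DecidableEq n] [CommRing K] [IsDomain K] [Algebra ℝ K]
  [Fintype ι] [AddCommMonoid E] {p : ι → ℝ} {U : ι → E} {φ : E → Matrix n n K}
  {a : ι → n → K} {τ : ι → K} {κ : K}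

theorem sum_smul_detPencil_add_smul_vecMulVec (hp : ∑ s, p s = 1) (hκ : ∀ s, p s • τ s = κ)
    (N : Matrix n n K) :
    ∑ s, p s • detPencil (N + τ s • vecMulVec (a s) (a s)) (∑ s, vecMulVec (a s) (a s)) =
      oneAddDeriv κ (detPencil N (∑ s, vecMulVec (a s) (a s))) := by
  simp_rw [detPencil_add_smul_vecMulVec, smul_add, Finset.sum_add_distrib, ← Finset.sum_smul, hp,
    one_smul, oneAddDeriv_apply, derivative_detPencil_sum_vecMulVec, Finset.smul_sum]
  congr 1
  refine Finset.sum_congr rfl fun s _ => ?_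
  rw [← smul_mul_assoc, smul_C, hκ, smul_eq_C_mul]

theorem walkMean_detPencil (hp : ∑ s, p s = 1) (hκ : ∀ s, p s • τ s = κ)
    (hφ : ∀ M s, φ (M + U s) = φ M + τ s • vecMulVec (a s) (a s)) (q : ℕ) (M : E) :
    walkMean p U q (fun M => detPencil (φ M) (∑ s, vecMulVec (a s) (a s))) M =
      (oneAddDeriv κ ^ q) (detPencil (φ M) (∑ s, vecMulVec (a s) (a s))) := by
  induction q generalizing M with
  | zero => rfl
  | succ q ih =>
    simp only [walkMean, ih, hφ]
    rw [pow_succ, Module.End.mul_apply, ← sum_smul_detPencil_add_smul_vecMulVec hp hκ, map_sum]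
    exact Finset.sum_congr rfl fun s _ => (LinearMap.map_smul_of_tower _ _ _).symm

theorem walkMean_det (hp : ∑ s, p s = 1) (hκ : ∀ s, p s • τ s = κ)
    (hφ : ∀ M s, φ (M + U s) = φ M + τ s • vecMulVec (a s) (a s)) (q : ℕ) (M : E) :
    walkMean p U q (fun M => (φ M).det) M =
      ((oneAddDeriv κ ^ q) (detPencil (φ M) (∑ s, vecMulVec (a s) (a s)))).eval 0 := by
  rw [← walkMean_detPencil hp hκ hφ]
  refine Eq.trans ?_ (map_walkMean p U q ((leval (0 : K)).restrictScalars ℝ) _ M).symm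
  congr 1; ext M
  simp [eval_detPencil]

theorem exists_walkMean_det_add_smul_vecMulVec (p : ι → ℝ) (U : ι → E) (q : ℕ)
    (φ : E → Matrix n n K) (b : n → K) (M : E) :
    ∃ h : K, ∀ z : K, walkMean p U q (fun M => (φ M + z • vecMulVec b b).det) M =
      walkMean p U q (fun M => (φ M).det) M + z * h := by
  refine ⟨walkMean p U q (fun M => b ⬝ᵥ (φ M).adjugate *ᵥ b) M, fun z => ?_⟩
  rw [← walkMean_mul_left, ← walkMean_add]
  congr 1; ext M
  rw [← smul_vecMulVec, det_add_vecMulVec, mulVec_smul, dotProduct_smul, smul_eq_mul]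

end WalkMeanDet

/-! ### Stability -/

theorem map_add_smul_vecMulVec {n R K : Type*} [CommRing R] [CommRing K] (f : R →+* K)
    (M : Matrix n n R) (t : R) (u : n → R) :
    (M + t • vecMulVec u u).map f = M.map f + f t • vecMulVec (f ∘ u) (f ∘ u) := by
  ext i j; simp [vecMulVec_apply]

section Stability

variable {n : Type*} [Fintype n]

theorem det_ne_zero_of_im_star_dotProduct_mulVec_pos [DecidableEq n] {Q : Matrix n n ℂ}
    (hQ : ∀ v ≠ 0, 0 < (star v ⬝ᵥ Q *ᵥ v).im) : Q.det ≠ 0 := by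
  intro h0
  obtain ⟨v, hv, hv0⟩ := exists_mulVec_eq_zero_iff.2 h0
  simpa [hv0] using hQ v hv

theorem star_dotProduct_vecMulVec_mulVec (a : n → ℝ) (v : n → ℂ) :
    star v ⬝ᵥ vecMulVec (algebraMap ℝ ℂ ∘ a) (algebraMap ℝ ℂ ∘ a) *ᵥ v =
      (Complex.normSq (∑ i, (a i : ℂ) * v i) : ℂ) := by
  rw [Complex.normSq_eq_conj_mul_self, map_sum, Finset.sum_mul_sum, dotProduct]
  refine Finset.sum_congr rfl fun i _ => ?_
  rw [mulVec, dotProduct, Finset.mul_sum]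
  refine Finset.sum_congr rfl fun j _ => ?_
  simp [vecMulVec_apply]; ring

theorem im_star_dotProduct_smul_vecMulVec_nonneg (a : n → ℝ) (v : n → ℂ) {z : ℂ}
    (hz : 0 ≤ z.im) :
    0 ≤ (star v ⬝ᵥ (z • vecMulVec (algebraMap ℝ ℂ ∘ a) (algebraMap ℝ ℂ ∘ a)) *ᵥ v).im := by
  rw [smul_mulVec, dotProduct_smul, star_dotProduct_vecMulVec_mulVec, smul_eq_mul,
    Complex.im_mul_ofReal]
  exact mul_nonneg hz (Complex.normSq_nonneg _)

theorem im_star_dotProduct_map_mulVec {M : Matrix n n ℝ} (hM : M.IsHermitian) (v : n → ℂ) :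
    (star v ⬝ᵥ M.map (algebraMap ℝ ℂ) *ᵥ v).im = 0 :=
  (hM.map (algebraMap ℝ ℂ) fun x => (Complex.conj_ofReal x).symm).im_star_dotProduct_mulVec_self v

theorem im_star_dotProduct_smul_one_mulVec_pos [DecidableEq n] {x : ℂ} (hx : 0 < x.im) {v : n → ℂ}
    (hv : v ≠ 0) : 0 < (star v ⬝ᵥ (x • (1 : Matrix n n ℂ)) *ᵥ v).im := by
  have hnorm : star v ⬝ᵥ v = (∑ i, Complex.normSq (v i) : ℝ) := by
    simp [dotProduct, Complex.normSq_eq_conj_mul_self]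
  obtain ⟨i, hi⟩ := Function.ne_iff.1 hv
  rw [smul_mulVec, one_mulVec, dotProduct_smul, hnorm, smul_eq_mul, Complex.im_mul_ofReal]
  exact mul_pos hx (Finset.sum_pos' (fun i _ => Complex.normSq_nonneg _)
    ⟨i, Finset.mem_univ _, Complex.normSq_pos.2 hi⟩)

variable [DecidableEq n] {ι : Type*} [Fintype ι]

theorem det_upperHalfPlane_ne_zero {M : Matrix n n ℝ} (hM : M.IsHermitian) (a : ι → n → ℝ)
    (b : n → ℝ) {x y z : ℂ} (hx : 0 < x.im) (hy : 0 ≤ y.im) (hz : 0 ≤ z.im) :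
    (x • (1 : Matrix n n ℂ) - M.map (algebraMap ℝ ℂ) +
      z • vecMulVec (algebraMap ℝ ℂ ∘ b) (algebraMap ℝ ℂ ∘ b) +
      y • ∑ s, vecMulVec (algebraMap ℝ ℂ ∘ a s) (algebraMap ℝ ℂ ∘ a s)).det ≠ 0 := by
  refine det_ne_zero_of_im_star_dotProduct_mulVec_pos fun v hv => ?_
  rw [Finset.smul_sum]
  simp only [add_mulVec, sub_mulVec, sum_mulVec, dotProduct_add, dotProduct_sub, dotProduct_sum,
    Complex.add_im, Complex.sub_im, Complex.im_sum, im_star_dotProduct_map_mulVec hM, sub_zero]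
  exact add_pos_of_pos_of_nonneg (add_pos_of_pos_of_nonneg
    (im_star_dotProduct_smul_one_mulVec_pos hx hv)
    (im_star_dotProduct_smul_vecMulVec_nonneg b v hz))
    (Finset.sum_nonneg fun s _ => im_star_dotProduct_smul_vecMulVec_nonneg (a s) v hy)

variable {p ω : ι → ℝ} {a : ι → n → ℝ} {c : ℝ}

theorem walkMean_det_ne_zero (hp : ∑ s, p s = 1) (hc : ∀ s, p s * ω s = c) (q : ℕ)
    {M : Matrix n n ℝ} (hM : M.IsHermitian) (b : n → ℝ) {x z : ℂ} (hx : 0 < x.im)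
    (hz : 0 ≤ z.im) :
    walkMean p (fun s => ω s • vecMulVec (a s) (a s)) q
      (fun M => (x • (1 : Matrix n n ℂ) - M.map (algebraMap ℝ ℂ) +
        z • vecMulVec (algebraMap ℝ ℂ ∘ b) (algebraMap ℝ ℂ ∘ b)).det) M ≠ 0 := by
  rw [walkMean_det (a := fun s => algebraMap ℝ ℂ ∘ a s) (τ := fun s => -(ω s : ℂ))
    (κ := (-c : ℂ)) hp (fun s => by rw [← hc s]; simp) fun M s => ?_]
  · refine eval_oneAddDeriv_pow_ne_zero (fun y hy => ?_) c q (by simp)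
    rw [eval_detPencil]
    exact det_upperHalfPlane_ne_zero hM a b hx hy hz
  · rw [map_add_smul_vecMulVec, neg_smul, Complex.coe_algebraMap]; abel

end Stability

/-! ### Mean characteristic polynomials -/

theorem splits_of_aeval_ne_zero {P : ℝ[X]} (hP : ∀ x : ℂ, 0 < x.im → aeval x P ≠ 0) :
    P.Splits := by
  refine Splits.of_splits_map (algebraMap ℝ ℂ) (IsAlgClosed.splits _) fun x hx => ?_
  have hx0 : aeval x P = 0 := by rw [aeval_def, ← eval_map]; exact isRoot_of_mem_roots hx
  rcases lt_trichotomy x.im 0 with h | h | h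
  · refine absurd ?_ (hP (starRingEnd ℂ x) (by simpa using h))
    rw [aeval_conj, hx0, map_zero]
  · exact ⟨x.re, Complex.ext rfl (by simp [h])⟩
  · exact absurd hx0 (hP x h)

theorem im_sub_mul_div_nonneg {g h : ℂ} (hgh : ∀ z : ℂ, 0 ≤ z.im → g + z * h ≠ 0) {t : ℝ}
    (ht : 0 ≤ t) : 0 ≤ ((g - t * h) / g).im := by
  have hg : g ≠ 0 := by simpa using hgh 0 le_rfl
  have hquot : (h / g).im ≤ 0 := by
    by_contra! him
    have hh : h ≠ 0 := by rintro rfl; simp at him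
    refine hgh (-(h / g)⁻¹) ?_ (by field_simp; ring)
    rw [Complex.neg_im, Complex.inv_im, neg_div, neg_neg]
    exact div_nonneg him.le (Complex.normSq_nonneg _)
  rw [sub_div, div_self hg, mul_div_assoc, Complex.sub_im, Complex.one_im, Complex.im_ofReal_mul]
  linarith [mul_nonneg ht (neg_nonneg.2 hquot)]

section MeanCharpoly

variable {n ι : Type*} [Fintype n] [DecidableEq n] [Fintype ι] {p : ι → ℝ}
  {U : ι → Matrix n n ℝ} {q : ℕ} {M : Matrix n n ℝ}

/-- The expected characteristic polynomial at the end of a random walk in the space of matrices. -/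
def meanCharpoly (p : ι → ℝ) (U : ι → Matrix n n ℝ) (q : ℕ) (M : Matrix n n ℝ) : ℝ[X] :=
  walkMean p U q charpoly M

theorem coeff_meanCharpoly (i : ℕ) :
    (meanCharpoly p U q M).coeff i = walkMean p U q (fun M => M.charpoly.coeff i) M :=
  map_walkMean p U q (lcoeff ℝ i) charpoly M

theorem coeff_meanCharpoly_card (hp : ∑ s, p s = 1) :
    (meanCharpoly p U q M).coeff (Fintype.card n) = 1 := by
  have htop (M : Matrix n n ℝ) : M.charpoly.coeff (Fintype.card n) = 1 := by
    rw [← charpoly_natDegree_eq_dim M]; exact M.charpoly_monic.coeff_natDegree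
  simp_rw [coeff_meanCharpoly, htop]
  exact walkMean_const hp 1 M

theorem natDegree_meanCharpoly (hp : ∑ s, p s = 1) :
    (meanCharpoly p U q M).natDegree = Fintype.card n := by
  refine natDegree_eq_of_le_of_coeff_ne_zero (natDegree_le_iff_coeff_eq_zero.2 fun i hi => ?_)
    (by rw [coeff_meanCharpoly_card hp]; exact one_ne_zero)
  have hzero (M : Matrix n n ℝ) : M.charpoly.coeff i = 0 :=
    coeff_eq_zero_of_natDegree_lt (by rwa [charpoly_natDegree_eq_dim])
  simp_rw [coeff_meanCharpoly, hzero]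
  exact walkMean_const hp 0 M

theorem monic_meanCharpoly (hp : ∑ s, p s = 1) : (meanCharpoly p U q M).Monic := by
  rw [Monic, leadingCoeff, natDegree_meanCharpoly hp, coeff_meanCharpoly_card hp]

theorem aeval_charpoly {K : Type*} [CommRing K] [Algebra ℝ K] (M : Matrix n n ℝ) (x : K) :
    aeval x M.charpoly = (x • (1 : Matrix n n K) - M.map (algebraMap ℝ K)).det := by
  rw [aeval_def, ← eval_map, ← charpoly_map, eval_charpoly, smul_one_eq_diagonal, scalar_apply]

theorem aeval_meanCharpoly {K : Type*} [CommRing K] [Algebra ℝ K] (x : K) :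
    aeval x (meanCharpoly p U q M) =
      walkMean p U q (fun M => (x • (1 : Matrix n n K) - M.map (algebraMap ℝ K)).det) M := by
  simp_rw [← aeval_charpoly]
  exact map_walkMean p U q (aeval x).toLinearMap charpoly M

variable {ω : ι → ℝ} {a : ι → n → ℝ} {c : ℝ}

theorem splits_meanCharpoly (hp : ∑ s, p s = 1) (hc : ∀ s, p s * ω s = c) (hM : M.IsHermitian) :
    (meanCharpoly p (fun s => ω s • vecMulVec (a s) (a s)) q M).Splits := by
  refine splits_of_aeval_ne_zero fun x hx => ?_
  rw [aeval_meanCharpoly]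
  simpa using walkMean_det_ne_zero (a := a) hp hc q hM 0 hx (z := 0) le_rfl

theorem im_aeval_meanCharpoly_div_nonneg (hp : ∑ s, p s = 1) (hc : ∀ s, p s * ω s = c)
    (hM : M.IsHermitian) {t : ℝ} (ht : 0 ≤ t) (b : n → ℝ) {x : ℂ} (hx : 0 < x.im) :
    0 ≤ (aeval x (meanCharpoly p (fun s => ω s • vecMulVec (a s) (a s)) q
        (M + t • vecMulVec b b)) /
      aeval x (meanCharpoly p (fun s => ω s • vecMulVec (a s) (a s)) q M)).im := by
  obtain ⟨h, hh⟩ := exists_walkMean_det_add_smul_vecMulVec p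
    (fun s => ω s • vecMulVec (a s) (a s)) q
    (fun M => x • (1 : Matrix n n ℂ) - M.map (algebraMap ℝ ℂ)) (algebraMap ℝ ℂ ∘ b) M
  rw [aeval_meanCharpoly, aeval_meanCharpoly, walkMean_add_right]
  convert im_sub_mul_div_nonneg (h := h) (fun z hz => ?_) ht using 3
  · rw [sub_eq_add_neg, ← neg_mul, ← hh]
    congr 1; ext M
    rw [map_add_smul_vecMulVec, neg_smul, Complex.coe_algebraMap]; congr 1; abel
  · rw [← hh]
    exact walkMean_det_ne_zero hp hc q hM b hx hz

end MeanCharpoly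

/-! ### Counting roots by their arguments -/

section RootCount

open Filter Topology

/-- The argument of the complex number `t + i ε - a`. -/
def rootArg (ε t a : ℝ) : ℝ := Real.pi / 2 - Real.arctan ((t - a) / ε)

/-- The sum of the arguments of `t + i ε - a` over the elements `a` of a multiset; if these are the
roots of a monic polynomial, an argument of its value at `t + i ε`. -/
def rootArgSum (ε t : ℝ) (S : Multiset ℝ) : ℝ := (S.map (rootArg ε t)).sum

theorem rootArgSum_cons (ε t a : ℝ) (S : Multiset ℝ) :
    rootArgSum ε t (a ::ₘ S) = rootArg ε t a + rootArgSum ε t S := by simp [rootArgSum]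

theorem exists_sub_eq_mul_exp_rootArg {ε : ℝ} (hε : 0 < ε) (t a : ℝ) :
    ∃ r : ℝ, 0 < r ∧ (⟨t, ε⟩ : ℂ) - a = r * Complex.exp (rootArg ε t a * Complex.I) := by
  set u := (t - a) / ε with hu
  have : 0 < √(1 + u ^ 2) := Real.sqrt_pos.2 (by positivity)
  have htu : t - a = ε * u := by rw [hu]; field_simp
  refine ⟨ε * √(1 + u ^ 2), by positivity, ?_⟩
  rw [Complex.exp_mul_I, ← Complex.ofReal_cos, ← Complex.ofReal_sin, rootArg,
    Real.cos_pi_div_two_sub, Real.sin_pi_div_two_sub, ← hu, Real.sin_arctan, Real.cos_arctan]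
  apply Complex.ext
  · simp [htu]; field_simp
  · simp; field_simp

theorem exists_prod_sub_eq_mul_exp_rootArgSum {ε : ℝ} (hε : 0 < ε) (t : ℝ) (S : Multiset ℝ) :
    ∃ r : ℝ, 0 < r ∧ (S.map fun a : ℝ => (⟨t, ε⟩ : ℂ) - a).prod =
      r * Complex.exp (rootArgSum ε t S * Complex.I) := by
  induction S using Multiset.induction_on with
  | empty => exact ⟨1, one_pos, by simp [rootArgSum]⟩
  | cons a S ih =>
    obtain ⟨r, hr, h⟩ := ih
    obtain ⟨r', hr', h'⟩ := exists_sub_eq_mul_exp_rootArg hε t a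
    refine ⟨r' * r, by positivity, ?_⟩
    rw [Multiset.map_cons, Multiset.prod_cons, h, h', rootArgSum_cons]
    push_cast
    rw [add_mul, Complex.exp_add]; ring

theorem exists_aeval_eq_mul_exp_rootArgSum {f : ℝ[X]} (hf : f.Splits) (hm : f.Monic) {ε : ℝ}
    (hε : 0 < ε) (t : ℝ) :
    ∃ r : ℝ, 0 < r ∧ aeval (⟨t, ε⟩ : ℂ) f =
      r * Complex.exp (rootArgSum ε t f.roots * Complex.I) := by
  obtain ⟨r, hr, h⟩ := exists_prod_sub_eq_mul_exp_rootArgSum hε t f.roots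
  refine ⟨r, hr, h ▸ ?_⟩
  conv_lhs => rw [hf.eq_prod_roots_of_monic hm]
  rw [map_multiset_prod, Multiset.map_map]
  exact congrArg _ (Multiset.map_congr rfl fun a _ => by simp)

theorem continuous_rootArgSum (ε : ℝ) (S : Multiset ℝ) :
    Continuous fun t => rootArgSum ε t S := by
  induction S using Multiset.induction_on with
  | empty => simpa [rootArgSum] using continuous_const
  | cons a S ih =>
    simp only [rootArgSum_cons]
    exact (continuous_const.sub (Real.continuous_arctan.comp (by fun_prop))).add ih

theorem tendsto_rootArg_of_atTop {α : Type*} {l : Filter α} {ε t : α → ℝ} {a : ℝ}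
    (h : Tendsto (fun x => (t x - a) / ε x) l atTop) :
    Tendsto (fun x => rootArg (ε x) (t x) a) l (𝓝 0) := by
  simpa [rootArg] using
    ((tendsto_nhds_of_tendsto_nhdsWithin Real.tendsto_arctan_atTop).comp h).const_sub (Real.pi / 2)

theorem tendsto_rootArg_of_atBot {α : Type*} {l : Filter α} {ε t : α → ℝ} {a : ℝ}
    (h : Tendsto (fun x => (t x - a) / ε x) l atBot) :
    Tendsto (fun x => rootArg (ε x) (t x) a) l (𝓝 Real.pi) := by
  simpa [rootArg] using
    ((tendsto_nhds_of_tendsto_nhdsWithin Real.tendsto_arctan_atBot).comp h).const_sub (Real.pi / 2)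

theorem tendsto_rootArgSum_atTop {ε : ℝ} (hε : 0 < ε) (S : Multiset ℝ) :
    Tendsto (fun t => rootArgSum ε t S) atTop (𝓝 0) := by
  induction S using Multiset.induction_on with
  | empty => simp [rootArgSum]
  | cons a S ih =>
    simp only [rootArgSum_cons]
    rw [← add_zero (0 : ℝ)]
    refine Tendsto.add (tendsto_rootArg_of_atTop ?_) ih
    exact (tendsto_atTop_add_const_right _ (-a) tendsto_id).atTop_div_const hε

theorem tendsto_rootArgSum_nhdsGT_zero {r : ℝ} {S : Multiset ℝ} (hS : r ∉ S) :
    Tendsto (fun ε => rootArgSum ε r S) (𝓝[>] 0) (𝓝 (S.countP (r < ·) * Real.pi)) := by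
  induction S using Multiset.induction_on with
  | empty => simp [rootArgSum]
  | cons a S ih =>
    rw [Multiset.mem_cons, not_or] at hS
    simp only [rootArgSum_cons, Multiset.countP_cons]
    push_cast
    rw [add_mul, add_comm]
    refine Tendsto.add ?_ (ih hS.2)
    rcases lt_or_gt_of_ne hS.1 with h | h
    · simpa [h] using tendsto_rootArg_of_atBot
        (tendsto_inv_nhdsGT_zero.const_mul_atTop_of_neg (sub_neg.2 h))
    · simpa [h.not_gt] using tendsto_rootArg_of_atTop
        (tendsto_inv_nhdsGT_zero.const_mul_atTop (sub_pos.2 h))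

theorem mem_Icc_zero_pi_of_sin_nonneg {φ : ℝ → ℝ} (hφ : Continuous φ)
    (h0 : Tendsto φ atTop (𝓝 0)) (hsin : ∀ t, 0 ≤ Real.sin (φ t)) (t : ℝ) :
    φ t ∈ Set.Icc 0 Real.pi := by
  have hpi := Real.pi_gt_three
  have hpi4 := Real.pi_lt_four
  obtain ⟨T, hT, hT'⟩ := ((h0.eventually_lt_const one_pos).and
    (h0.eventually_const_lt (neg_one_lt_zero (R := ℝ)))).exists
  constructor
  · by_contra! hneg
    have hle : φ t ≤ -Real.pi :=
      not_lt.1 fun h => (Real.sin_neg_of_neg_of_neg_pi_lt hneg h).not_ge (hsin t)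
    obtain ⟨u, hu⟩ := mem_range_of_exists_le_of_exists_ge (c := -2) hφ ⟨t, by linarith⟩
      ⟨T, by linarith⟩
    exact (Real.sin_neg_of_neg_of_neg_pi_lt (by norm_num) (by linarith)).not_ge (hu ▸ hsin u)
  · by_contra! hlt
    have hsin_pos {x : ℝ} (hx : Real.pi < x) (hx' : x < 2 * Real.pi) : Real.sin x < 0 := by
      have := Real.sin_pos_of_pos_of_lt_pi (sub_pos.2 hx) (by linarith)
      rwa [Real.sin_sub_pi, Left.neg_pos_iff] at this
    have hge : 2 * Real.pi ≤ φ t := not_lt.1 fun h => (hsin_pos hlt h).not_ge (hsin t)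
    obtain ⟨u, hu⟩ := mem_range_of_exists_le_of_exists_ge (c := 4) hφ ⟨T, by linarith⟩
      ⟨t, by linarith⟩
    exact (hsin_pos hpi4 (by linarith)).not_ge (hu ▸ hsin u)

theorem rootArgSum_sub_mem_Icc {f g : ℝ[X]} (hf : f.Splits) (hfm : f.Monic)
    (hg : g.Splits) (hgm : g.Monic)
    (h : ∀ x : ℂ, 0 < x.im → 0 ≤ (aeval x f / aeval x g).im) {ε : ℝ} (hε : 0 < ε) (t : ℝ) :
    rootArgSum ε t f.roots - rootArgSum ε t g.roots ∈ Set.Icc 0 Real.pi := by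
  refine mem_Icc_zero_pi_of_sin_nonneg
    (φ := fun t => rootArgSum ε t f.roots - rootArgSum ε t g.roots)
    ((continuous_rootArgSum ε _).sub (continuous_rootArgSum ε _))
    (by simpa using (tendsto_rootArgSum_atTop hε _).sub (tendsto_rootArgSum_atTop hε _))
    (fun t => ?_) t
  obtain ⟨r₁, hr₁, h₁⟩ := exists_aeval_eq_mul_exp_rootArgSum hf hfm hε t
  obtain ⟨r₂, hr₂, h₂⟩ := exists_aeval_eq_mul_exp_rootArgSum hg hgm hε t
  have him := h ⟨t, ε⟩ hε
  rw [h₁, h₂, mul_div_mul_comm, ← Complex.exp_sub, ← sub_mul, ← Complex.ofReal_sub,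
    ← Complex.ofReal_div, Complex.im_ofReal_mul, Complex.exp_ofReal_mul_I_im] at him
  exact nonneg_of_mul_nonneg_right him (div_pos hr₁ hr₂)

theorem countP_roots_of_im_div_nonneg {f g : ℝ[X]} (hf : f.Splits) (hfm : f.Monic)
    (hg : g.Splits) (hgm : g.Monic)
    (h : ∀ x : ℂ, 0 < x.im → 0 ≤ (aeval x f / aeval x g).im) {r : ℝ} (hrf : r ∉ f.roots)
    (hrg : r ∉ g.roots) :
    g.roots.countP (r < ·) ≤ f.roots.countP (r < ·) ∧
      f.roots.countP (r < ·) ≤ g.roots.countP (r < ·) + 1 := by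
  have hlim := (tendsto_rootArgSum_nhdsGT_zero hrf).sub (tendsto_rootArgSum_nhdsGT_zero hrg)
  rw [← sub_mul] at hlim
  obtain ⟨h0, hpi⟩ := isClosed_Icc.mem_of_tendsto hlim
    (eventually_nhdsWithin_of_forall fun ε hε => rootArgSum_sub_mem_Icc hf hfm hg hgm h hε r)
  have h1 := le_of_mul_le_mul_right (hpi.trans_eq (one_mul _).symm) Real.pi_pos
  constructor
  · exact_mod_cast sub_nonneg.1 (nonneg_of_mul_nonneg_left h0 Real.pi_pos)
  · rw [sub_le_iff_le_add'] at h1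
    exact_mod_cast h1

theorem neg_one_pow_countP_mul_prod_sub_pos {r : ℝ} {S : Multiset ℝ} (hS : r ∉ S) :
    0 < (-1) ^ S.countP (r < ·) * (S.map fun a => r - a).prod := by
  induction S using Multiset.induction_on with
  | empty => simp
  | cons a S ih =>
    rw [Multiset.mem_cons, not_or] at hS
    have ih := ih hS.2
    rw [Multiset.countP_cons, Multiset.map_cons, Multiset.prod_cons]
    rcases lt_or_gt_of_ne hS.1 with h | h
    · rw [if_pos h, pow_succ]
      linarith [mul_pos ih (sub_pos.2 h)]
    · rw [if_neg h.not_gt, add_zero]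
      linarith [mul_pos ih (sub_pos.2 h)]

theorem neg_one_pow_countP_mul_eval_pos {f : ℝ[X]} (hf : f.Splits) (hm : f.Monic) {r : ℝ}
    (hr : r ∉ f.roots) : 0 < (-1) ^ f.roots.countP (r < ·) * f.eval r := by
  rw [hf.eval_eq_prod_roots_of_monic hm]
  exact neg_one_pow_countP_mul_prod_sub_pos hr

end RootCount

/-! ### The `k`-th largest root of a mean -/

theorem lt_getD_iff_le_countP (x : ℝ) {L : List ℝ} (hL : L.Pairwise (· ≥ ·)) {k : ℕ}
    (hk : k < L.length) : x < L.getD k 0 ↔ k + 1 ≤ L.countP (x < ·) := by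
  induction L generalizing k with
  | nil => simp at hk
  | cons a L ih =>
    rw [List.pairwise_cons] at hL
    by_cases h : x < a
    · cases k with
      | zero => simp [h]
      | succ k =>
        rw [List.getD_cons_succ, ih hL.2 (Nat.lt_of_succ_lt_succ hk), List.countP_cons]
        simp [h]
    · have hle : ∀ b ∈ a :: L, b ≤ x :=
        List.forall_mem_cons.2 ⟨not_lt.1 h, fun b hb => (hL.1 b hb).trans (not_lt.1 h)⟩
      have hcount : (a :: L).countP (x < ·) = 0 :=
        List.countP_eq_zero.2 fun b hb => by simpa using hle b hb
      rw [hcount, List.getD_eq_getElem _ _ hk]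
      simpa using hle _ (List.getElem_mem hk)

theorem lt_kthLargestRoot_iff {p : ℝ[X]} {k : ℕ} (hk : 1 ≤ k) (hkp : k ≤ p.roots.card) (x : ℝ) :
    x < kthLargestRoot k p ↔ k ≤ p.roots.countP (x < ·) := by
  rw [kthLargestRoot, lt_getD_iff_le_countP x (Multiset.pairwise_sort _ _)
    (by rw [Multiset.length_sort]; omega), Nat.sub_add_cancel hk]
  conv_rhs => rw [← Multiset.sort_eq p.roots (· ≥ ·), Multiset.coe_countP]

theorem kthLargestRoot_C_mul {c : ℝ} (hc : c ≠ 0) (k : ℕ) (p : ℝ[X]) :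
    kthLargestRoot k (C c * p) = kthLargestRoot k p := by
  rw [kthLargestRoot, kthLargestRoot, roots_C_mul _ hc]

theorem exists_mem_Ioo_eval_ne_zero {p : ℝ[X]} (hp : p ≠ 0) {x y : ℝ} (hxy : x < y) :
    ∃ r ∈ Set.Ioo x y, p.eval r ≠ 0 := by
  obtain ⟨r, hr, hr0⟩ := ((Set.Ioo_infinite hxy).sdiff p.roots.toFinset.finite_toSet).nonempty
  exact ⟨r, hr, by simpa [hp] using hr0⟩

section KthLargestRootSum

variable {ι : Type*} [Fintype ι] {p : ι → ℝ} {f : ι → ℝ[X]} {g : ℝ[X]}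

theorem im_aeval_sum_smul_div_nonneg (hp : ∀ s, 0 ≤ p s)
    (h : ∀ s, ∀ x : ℂ, 0 < x.im → 0 ≤ (aeval x (f s) / aeval x g).im) {x : ℂ} (hx : 0 < x.im) :
    0 ≤ (aeval x (∑ s, p s • f s) / aeval x g).im := by
  rw [map_sum, Finset.sum_div, Complex.im_sum]
  refine Finset.sum_nonneg fun s _ => ?_
  rw [map_smul, smul_div_assoc, Complex.smul_im]
  exact mul_nonneg (hp s) (h s x hx)

/-- By interlacing with `g`, if the mean had one more root above `r` than every `f s`, then
all the `f s` would have the same sign at `r`, opposite to the sign of their mean. -/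
theorem exists_le_countP_roots_of_le_countP_roots_sum [Nonempty ι] (hp : ∀ s, 0 ≤ p s)
    (hf : ∀ s, (f s).Splits) (hfm : ∀ s, (f s).Monic) (hF : (∑ s, p s • f s).Splits)
    (hFm : (∑ s, p s • f s).Monic) (hg : g.Splits) (hgm : g.Monic)
    (h : ∀ s, ∀ x : ℂ, 0 < x.im → 0 ≤ (aeval x (f s) / aeval x g).im) {r : ℝ}
    (hrf : ∀ s, r ∉ (f s).roots) (hrF : r ∉ (∑ s, p s • f s).roots) (hrg : r ∉ g.roots) {k : ℕ}
    (hk : k ≤ (∑ s, p s • f s).roots.countP (r < ·)) :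
    ∃ s, k ≤ (f s).roots.countP (r < ·) := by
  by_contra! hlt
  have hcountF := countP_roots_of_im_div_nonneg hF hFm hg hgm
    (fun _ => im_aeval_sum_smul_div_nonneg hp h) hrF hrg
  have hcountf (s) := countP_roots_of_im_div_nonneg (hf s) (hfm s) hg hgm (h s) (hrf s) hrg
  set c := g.roots.countP (r < ·)
  have hF_eq : (∑ s, p s • f s).roots.countP (r < ·) = c + 1 := by
    have s := Classical.arbitrary ι
    have := hlt s; have := hcountf s; omega
  have hf_eq (s) : (f s).roots.countP (r < ·) = c := by
    have := hlt s; have := hcountf s; omega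
  have hsignF := neg_one_pow_countP_mul_eval_pos hF hFm hrF
  have hsignf (s) := neg_one_pow_countP_mul_eval_pos (hf s) (hfm s) (hrf s)
  simp only [hf_eq] at hsignf
  have hnonneg : 0 ≤ (-1) ^ c * (∑ s, p s • f s).eval r := by
    rw [eval_finsetSum, Finset.mul_sum]
    refine Finset.sum_nonneg fun s _ => ?_
    rw [eval_smul, smul_eq_mul, mul_left_comm]
    exact mul_nonneg (hp s) (hsignf s).le
  rw [hF_eq, pow_succ] at hsignF
  linarith

theorem exists_kthLargestRoot_sum_le [Nonempty ι] (hp : ∀ s, 0 ≤ p s)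
    (hf : ∀ s, (f s).Splits) (hfm : ∀ s, (f s).Monic) (hF : (∑ s, p s • f s).Splits)
    (hFm : (∑ s, p s • f s).Monic) (hg : g.Splits) (hgm : g.Monic)
    (h : ∀ s, ∀ x : ℂ, 0 < x.im → 0 ≤ (aeval x (f s) / aeval x g).im) {k : ℕ} (hk : 1 ≤ k)
    (hkf : ∀ s, k ≤ (f s).natDegree) (hkF : k ≤ (∑ s, p s • f s).natDegree) :
    ∃ s, kthLargestRoot k (∑ s, p s • f s) ≤ kthLargestRoot k (f s) := by
  by_contra! hlt
  obtain ⟨s₀, -, hs₀⟩ := Finset.exists_max_image Finset.univ (fun s => kthLargestRoot k (f s))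
    Finset.univ_nonempty
  obtain ⟨r, ⟨hr₀, hrF⟩, hr⟩ := exists_mem_Ioo_eval_ne_zero
    (mul_ne_zero (mul_ne_zero hFm.ne_zero hgm.ne_zero)
      (Finset.prod_ne_zero_iff.2 fun s (_ : s ∈ Finset.univ) => (hfm s).ne_zero)) (hlt s₀)
  simp only [eval_mul, eval_prod, mul_ne_zero_iff, Finset.prod_ne_zero_iff] at hr
  rw [lt_kthLargestRoot_iff hk (hF.natDegree_eq_card_roots ▸ hkF)] at hrF
  obtain ⟨s, hs⟩ := exists_le_countP_roots_of_le_countP_roots_sum hp hf hfm hF hFm hg hgm h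
    (fun s hs => hr.2 s (Finset.mem_univ s) (isRoot_of_mem_roots hs))
    (fun hs => hr.1.1 (isRoot_of_mem_roots hs)) (fun hs => hr.1.2 (isRoot_of_mem_roots hs)) hrF
  rw [← lt_kthLargestRoot_iff hk ((hf s).natDegree_eq_card_roots ▸ hkf s)] at hs
  exact (hs₀ s (Finset.mem_univ s)).not_gt (hr₀.trans hs)

end KthLargestRootSum

/-! ### The greedy bound -/

section Roots

variable {p : ℝ[X]} {k : ℕ}

theorem kthLargestRoot_mem_roots (hk : 1 ≤ k) (hkp : k ≤ p.roots.card) :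
    kthLargestRoot k p ∈ p.roots := by
  have hlt : k - 1 < (p.roots.sort (· ≥ ·)).length := by rw [Multiset.length_sort]; omega
  rw [kthLargestRoot, List.getD_eq_getElem _ _ hlt, ← Multiset.mem_sort (r := (· ≥ ·))]
  exact List.getElem_mem hlt

theorem kthLargestRoot_nonpos_of_X_pow_dvd (hk : 1 ≤ k) (hkp : k ≤ p.roots.card)
    (hdvd : X ^ (p.roots.card + 1 - k) ∣ p) : kthLargestRoot k p ≤ 0 := by
  have hp : p ≠ 0 := by rintro rfl; simp at hkp; omega
  have hcount : p.roots.card + 1 - k ≤ p.roots.count 0 := by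
    rw [count_roots, le_rootMultiplicity_iff hp]
    simpa using hdvd
  have hle : p.roots.countP (0 < ·) + p.roots.count 0 ≤ p.roots.card := by
    rw [Multiset.card_eq_countP_add_countP (0 < ·), Multiset.count]
    refine Nat.add_le_add_left ?_ _
    rw [Multiset.countP_eq_card_filter, Multiset.countP_eq_card_filter]
    exact Multiset.card_le_card (Multiset.monotone_filter_right _ fun x hx => by simp [← hx])
  by_contra! hlt
  have := (lt_kthLargestRoot_iff hk hkp 0).1 hlt
  omega

theorem kthLargestRoot_X_pow_mul_le {μ : ℝ} (hμ : μ ∈ p.roots) (h0 : 0 ≤ μ) (e : ℕ) :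
    kthLargestRoot p.roots.card (X ^ e * p) ≤ μ := by
  have hroots : (X ^ e * p).roots = e • {0} + p.roots := by
    rw [roots_mul (mul_ne_zero (pow_ne_zero _ X_ne_zero) (ne_zero_of_mem_roots hμ)), roots_X_pow]
  by_contra! hlt
  have hzero : Multiset.countP (μ < ·) {0} = 0 :=
    Multiset.countP_eq_zero.2 fun y hy => by rw [Multiset.mem_singleton.1 hy]; exact h0.not_gt
  rw [lt_kthLargestRoot_iff (Multiset.card_pos_iff_exists_mem.2 ⟨μ, hμ⟩)
    (by rw [hroots, Multiset.card_add]; omega), hroots, Multiset.countP_add, Multiset.countP_nsmul,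
    hzero, mul_zero, zero_add] at hlt
  exact lt_irrefl μ (Multiset.countP_eq_card.1 (hlt.antisymm' (Multiset.countP_le_card _ _)) μ hμ)

end Roots

section SigmaMin

variable {n ι : Type*} [Fintype n] [Fintype ι] [DecidableEq ι]

theorem mul_norm_sq_le_norm_toEuclideanLin_sq (B : Matrix n ι ℝ) {r : ℝ}
    (hr : ∀ μ ∈ spectrum ℝ (Bᵀ * B), r ≤ μ) (x : EuclideanSpace ℝ ι) :
    r * ‖x‖ ^ 2 ≤ ‖toEuclideanLin B x‖ ^ 2 := by
  have hpos : (Bᵀ * B - r • 1).PosSemidef := by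
    refine posSemidef_iff_isHermitian_and_spectrum_nonneg.2 ⟨.sub ?_ ?_, fun μ hμ => ?_⟩
    · simpa using isHermitian_conjTranspose_mul_self B
    · exact isHermitian_one.smul (IsSelfAdjoint.all r)
    · rw [← Algebra.algebraMap_eq_smul_one, ← spectrum.sub_singleton_eq] at hμ
      obtain ⟨ν, hν, _, rfl, rfl⟩ := hμ
      exact sub_nonneg.2 (hr ν hν)
  have h := hpos.dotProduct_mulVec_nonneg x.ofLp
  rw [sub_mulVec, dotProduct_sub, smul_mulVec, one_mulVec, dotProduct_smul, sub_nonneg,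
    ← mulVec_mulVec, dotProduct_mulVec, vecMul_transpose] at h
  simpa [EuclideanSpace.real_norm_sq_eq, dotProduct, ← pow_two] using h

end SigmaMin

theorem kthLargestRoot_le_sigmaMin_sq {n : ℕ} {ι : Type} [Fintype ι] [DecidableEq ι] [Nonempty ι]
    (B : Matrix (Fin n) ι ℝ) (hn : Fintype.card ι ≤ n) :
    kthLargestRoot (Fintype.card ι) (B * Bᵀ).charpoly ≤ sigmaMin B ^ 2 := by
  have hpos : (Bᵀ * B).PosSemidef := by simpa using posSemidef_conjTranspose_mul_self B
  have hcard : (Bᵀ * B).charpoly.roots.card = Fintype.card ι := by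
    rw [← hpos.isHermitian.splits_charpoly.natDegree_eq_card_roots, charpoly_natDegree_eq_dim]
  set r := kthLargestRoot (Fintype.card ι) (B * Bᵀ).charpoly with hr
  have hspec : ∀ μ ∈ spectrum ℝ (Bᵀ * B), r ≤ μ := fun μ hμ => by
    rw [hr, charpoly_mul_comm_of_le _ _ (by simpa using hn), ← hcard]
    refine kthLargestRoot_X_pow_mul_le ?_
      ((posSemidef_iff_isHermitian_and_spectrum_nonneg.1 hpos).2 hμ) _
    exact (mem_roots (charpoly_monic _).ne_zero).2 (mem_spectrum_iff_isRoot_charpoly.1 hμ)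
  have : Nonempty {x : EuclideanSpace ℝ ι // ‖x‖ = 1} :=
    ⟨⟨EuclideanSpace.single (Classical.arbitrary ι) 1, by simp⟩⟩
  refine (Real.sqrt_le_left (Real.iInf_nonneg fun x => norm_nonneg _)).1 (le_ciInf fun x => ?_)
  simpa [x.2] using Real.sqrt_le_iff.2
    ⟨norm_nonneg _, mul_norm_sq_le_norm_toEuclideanLin_sq B hspec x⟩

section ExpectedPoly

variable {n m : ℕ} (A : Matrix (Fin n) (Fin m) ℝ) (w : Fin m → ℝ)

/-- The rank-one matrix `w_s² a_s a_sᵀ`, where `a_s` is column `s` of `A`. -/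
def columnStep (s : Fin m) : Matrix (Fin n) (Fin n) ℝ := w s ^ 2 • vecMulVec (A.col s) (A.col s)

/-- The sum of `w_s² a_s a_sᵀ` over the entries `s` of a list, repeated entries being counted. -/
def outerSum (l : List (Fin m)) : Matrix (Fin n) (Fin n) ℝ := (l.map (columnStep A w)).sum

/-- The mean characteristic polynomial after `q` further random columns have been added to `M`;
up to a positive factor, `partialPoly` is of this form with `M = outerSum A w l`. -/
def expectedPoly (q : ℕ) (M : Matrix (Fin n) (Fin n) ℝ) : ℝ[X] :=
  meanCharpoly (colProb w) (columnStep A w) q M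

theorem outerSum_append_singleton (l : List (Fin m)) (s : Fin m) :
    outerSum A w (l ++ [s]) = outerSum A w l + columnStep A w s := by
  simp [outerSum]

theorem expectedPoly_succ (q : ℕ) (M : Matrix (Fin n) (Fin n) ℝ) :
    expectedPoly A w (q + 1) M = ∑ s, colProb w s • expectedPoly A w q (M + columnStep A w s) :=
  rfl

theorem sum_fullPoly_append_ofFn (q : ℕ) (l : List (Fin m)) :
    ∑ t : Fin q → Fin m, fullPoly A w (l ++ List.ofFn t) =
      C (l.map (colProb w)).prod * expectedPoly A w q (outerSum A w l) := by
  induction q generalizing l with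
  | zero =>
    rw [Fintype.sum_unique, List.ofFn_zero, List.append_nil]
    rfl
  | succ q ih =>
    rw [expectedPoly_succ, Finset.mul_sum, ← (Fin.consEquiv fun _ => Fin m).sum_comp,
      Fintype.sum_prod_type]
    refine Finset.sum_congr rfl fun s _ => ?_
    have happend (t : Fin q → Fin m) : l ++ List.ofFn ((Fin.consEquiv fun _ => Fin m) (s, t)) =
        (l ++ [s]) ++ List.ofFn t := by
      simp [Fin.consEquiv, List.ofFn_succ]
    simp_rw [happend]
    rw [ih, outerSum_append_singleton, smul_eq_C_mul, ← mul_assoc, ← C_mul]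
    simp

theorem partialPoly_eq (k : ℕ) (l : List (Fin m)) :
    partialPoly A w k l =
      C (l.map (colProb w)).prod * expectedPoly A w (k - l.length) (outerSum A w l) :=
  sum_fullPoly_append_ofFn A w _ l

theorem posSemidef_columnStep (s : Fin m) : (columnStep A w s).PosSemidef := by
  have h : (vecMulVec (A.col s) (A.col s)).PosSemidef := by
    simpa using posSemidef_vecMulVec_self_star (A.col s)
  exact h.smul (sq_nonneg (w s))

theorem posSemidef_outerSum (l : List (Fin m)) : (outerSum A w l).PosSemidef := by
  induction l with
  | nil => exact .zero
  | cons s l ih =>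
    rw [outerSum, List.map_cons, List.sum_cons]
    exact (posSemidef_columnStep A w s).add ih

variable {w}

theorem sum_inv_sq_pos [Nonempty (Fin m)] (hw : ∀ i, w i ≠ 0) : 0 < ∑ j, (w j ^ 2)⁻¹ :=
  Finset.sum_pos (fun i _ => by have := hw i; positivity) Finset.univ_nonempty

theorem colProb_pos (hw : ∀ i, w i ≠ 0) (i : Fin m) : 0 < colProb w i := by
  have : Nonempty (Fin m) := ⟨i⟩
  have := hw i
  exact div_pos (by positivity) (sum_inv_sq_pos hw)

theorem sum_colProb [Nonempty (Fin m)] (hw : ∀ i, w i ≠ 0) : ∑ s, colProb w s = 1 := by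
  simp only [colProb]
  rw [← Finset.sum_div, div_self (sum_inv_sq_pos hw).ne']

theorem colProb_mul_sq (hw : ∀ i, w i ≠ 0) (i : Fin m) :
    colProb w i * w i ^ 2 = (∑ j, (w j ^ 2)⁻¹)⁻¹ := by
  have := hw i
  rw [colProb]; field_simp

theorem prod_colProb_ne_zero (hw : ∀ i, w i ≠ 0) (l : List (Fin m)) :
    (l.map (colProb w)).prod ≠ 0 := by
  refine List.prod_ne_zero ?_
  simp only [List.mem_map, not_exists, not_and]
  exact fun i _ => (colProb_pos hw i).ne'

theorem kthLargestRoot_partialPoly (hw : ∀ i, w i ≠ 0) (j k : ℕ) (l : List (Fin m)) :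
    kthLargestRoot j (partialPoly A w k l) =
      kthLargestRoot j (expectedPoly A w (k - l.length) (outerSum A w l)) := by
  rw [partialPoly_eq, kthLargestRoot_C_mul (prod_colProb_ne_zero hw l)]

section Nonempty

variable [Nonempty (Fin m)] {M : Matrix (Fin n) (Fin n) ℝ}

theorem monic_expectedPoly (hw : ∀ i, w i ≠ 0) (q : ℕ) (M : Matrix (Fin n) (Fin n) ℝ) :
    (expectedPoly A w q M).Monic :=
  monic_meanCharpoly (sum_colProb hw)

theorem natDegree_expectedPoly (hw : ∀ i, w i ≠ 0) (q : ℕ) (M : Matrix (Fin n) (Fin n) ℝ) :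
    (expectedPoly A w q M).natDegree = n :=
  (natDegree_meanCharpoly (sum_colProb hw)).trans (Fintype.card_fin n)

theorem splits_expectedPoly (hw : ∀ i, w i ≠ 0) (q : ℕ) (hM : M.IsHermitian) :
    (expectedPoly A w q M).Splits :=
  splits_meanCharpoly (sum_colProb hw) (colProb_mul_sq hw) hM

theorem card_roots_expectedPoly (hw : ∀ i, w i ≠ 0) (q : ℕ) (hM : M.IsHermitian) :
    (expectedPoly A w q M).roots.card = n := by
  rw [← (splits_expectedPoly A hw q hM).natDegree_eq_card_roots, natDegree_expectedPoly A hw]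

theorem splits_partialPoly (hw : ∀ i, w i ≠ 0) (k : ℕ) (l : List (Fin m)) :
    (partialPoly A w k l).Splits := by
  rw [partialPoly_eq]
  exact (splits_expectedPoly A hw _ (posSemidef_outerSum A w l).isHermitian).C_mul _

theorem natDegree_partialPoly (hw : ∀ i, w i ≠ 0) (k : ℕ) (l : List (Fin m)) :
    (partialPoly A w k l).natDegree = n := by
  rw [partialPoly_eq, natDegree_C_mul (prod_colProb_ne_zero hw l), natDegree_expectedPoly A hw]

theorem exists_kthLargestRoot_expectedPoly_le (hw : ∀ i, w i ≠ 0) {k : ℕ} (hk : 1 ≤ k)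
    (hkn : k ≤ n) (q : ℕ) (hM : M.IsHermitian) :
    ∃ s, kthLargestRoot k (expectedPoly A w (q + 1) M) ≤
      kthLargestRoot k (expectedPoly A w q (M + columnStep A w s)) := by
  have hMs (s) : (M + columnStep A w s).IsHermitian :=
    hM.add (posSemidef_columnStep A w s).isHermitian
  exact exists_kthLargestRoot_sum_le (fun s => (colProb_pos hw s).le)
    (fun s => splits_expectedPoly A hw q (hMs s)) (fun s => monic_expectedPoly A hw q _)
    (splits_expectedPoly A hw (q + 1) hM) (monic_expectedPoly A hw (q + 1) M)
    (splits_expectedPoly A hw q hM) (monic_expectedPoly A hw q M)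
    (fun s _ hx => im_aeval_meanCharpoly_div_nonneg (sum_colProb hw) (colProb_mul_sq hw) hM
      (sq_nonneg (w s)) (A.col s) hx) hk
    (fun s => hkn.trans (natDegree_expectedPoly A hw q _).ge)
    (hkn.trans (natDegree_expectedPoly A hw (q + 1) M).ge)

theorem neg_one_pow_mul_eval_charpoly_pos (hM : M.PosSemidef) {x : ℝ} (hx : x < 0) :
    0 < (-1) ^ n * M.charpoly.eval x := by
  have hdet := ((PosDef.one.smul (neg_pos.2 hx)).add_posSemidef hM).det_pos
  rwa [neg_smul, smul_one_eq_diagonal, ← scalar_apply, neg_add_eq_sub, ← neg_sub, det_neg,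
    Fintype.card_fin, ← eval_charpoly] at hdet

theorem neg_one_pow_mul_eval_expectedPoly_pos (hw : ∀ i, w i ≠ 0) (q : ℕ) (hM : M.PosSemidef)
    {x : ℝ} (hx : x < 0) : 0 < (-1) ^ n * (expectedPoly A w q M).eval x := by
  have hmean := map_walkMean (colProb w) (columnStep A w) q ((-1 : ℝ) ^ n • leval x) charpoly M
  change 0 < ((-1 : ℝ) ^ n • leval x) (expectedPoly A w q M)
  rw [expectedPoly, meanCharpoly, hmean]
  exact walkMean_pos (sum_colProb hw) (fun s => (colProb_pos hw s).le)
    (fun M hM s => hM.add (posSemidef_columnStep A w s))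
    (fun M hM => neg_one_pow_mul_eval_charpoly_pos hM hx) hM

theorem kthLargestRoot_expectedPoly_nonneg (hw : ∀ i, w i ≠ 0) {k : ℕ} (hk : 1 ≤ k) (hkn : k ≤ n)
    (q : ℕ) (hM : M.PosSemidef) : 0 ≤ kthLargestRoot k (expectedPoly A w q M) := by
  by_contra! hlt
  have hpos := neg_one_pow_mul_eval_expectedPoly_pos A hw q hM hlt
  rw [isRoot_of_mem_roots (kthLargestRoot_mem_roots hk
    (by rwa [card_roots_expectedPoly A hw q hM.isHermitian])), mul_zero] at hpos
  exact lt_irrefl _ hpos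

end Nonempty

theorem exists_outerSum_eq_mul (w : Fin m → ℝ) (l : List (Fin m)) :
    ∃ V : Matrix l.toFinset (Fin n) ℝ, outerSum A w l = colsOf A l.toFinset * V := by
  refine ⟨of fun s i => (l.count s.1 : ℝ) * w s ^ 2 * A i s, ?_⟩
  rw [outerSum, Finset.sum_list_map_count]
  ext i j
  rw [Matrix.sum_apply, mul_apply, ← Finset.sum_coe_sort]
  refine Finset.sum_congr rfl fun s _ => ?_
  simp [columnStep, vecMulVec_apply, colsOf]; ring

theorem X_pow_dvd_charpoly_outerSum (w : Fin m → ℝ) {k : ℕ} (hkn : k ≤ n) {l : List (Fin m)}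
    (hl : l.toFinset.card < k) : X ^ (n + 1 - k) ∣ (outerSum A w l).charpoly := by
  obtain ⟨V, hV⟩ := exists_outerSum_eq_mul A w l
  rw [hV, charpoly_mul_comm_of_le _ _ (by rw [Fintype.card_coe, Fintype.card_fin]; omega)]
  refine Dvd.dvd.mul_right (pow_dvd_pow _ ?_) _
  rw [Fintype.card_coe, Fintype.card_fin]; omega

theorem card_toFinset_append_lt_of_not_nodup {α : Type*} [DecidableEq α] {l : List α}
    (hl : ¬ l.Nodup) (l' : List α) : (l ++ l').toFinset.card < (l ++ l').length :=
  (List.toFinset_card_le _).lt_of_ne fun h =>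
    hl (List.nodup_append.1 (Multiset.toFinset_card_eq_card_iff_nodup.1 h)).1

/-- Every completion of a list with a repeated entry has rank less than `k`. -/
theorem kthLargestRoot_partialPoly_nonpos_of_not_nodup [Nonempty (Fin m)] (hw : ∀ i, w i ≠ 0)
    {k : ℕ} (hk : 1 ≤ k) (hkn : k ≤ n) {l : List (Fin m)} (hl : l.length ≤ k) (hnd : ¬ l.Nodup) :
    kthLargestRoot k (partialPoly A w k l) ≤ 0 := by
  have hcard : (partialPoly A w k l).roots.card = n := by
    rw [← (splits_partialPoly A hw k l).natDegree_eq_card_roots, natDegree_partialPoly A hw]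
  refine kthLargestRoot_nonpos_of_X_pow_dvd hk (by rwa [hcard]) ?_
  rw [hcard]
  refine Finset.dvd_sum fun t _ => Dvd.dvd.mul_left (X_pow_dvd_charpoly_outerSum A w hkn ?_) _
  have hlt := card_toFinset_append_lt_of_not_nodup hnd (List.ofFn t)
  rwa [List.length_append, List.length_ofFn, Nat.add_sub_cancel' hl] at hlt

theorem outerSum_eq_mul_transpose (w : Fin m → ℝ) {l : List (Fin m)} (hl : l.Nodup) :
    outerSum A w l = (colsOf A l.toFinset * weightsOf w l.toFinset) *
      (colsOf A l.toFinset * weightsOf w l.toFinset)ᵀ := by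
  have hdiag : weightsOf w l.toFinset = diagonal (w ∘ Subtype.val) :=
    submatrix_diagonal _ _ Subtype.val_injective
  have hentry (i) (s : l.toFinset) :
      (colsOf A l.toFinset * weightsOf w l.toFinset) i s = A i s * w s := by
    rw [hdiag, mul_diagonal]; rfl
  rw [outerSum, ← List.sum_toFinset _ hl]
  ext i j
  rw [Matrix.sum_apply, mul_apply, ← Finset.sum_coe_sort]
  refine Finset.sum_congr rfl fun s _ => ?_
  rw [transpose_apply, hentry, hentry, columnStep, Matrix.smul_apply, vecMulVec_apply, smul_eq_mul,
    col_apply, col_apply]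
  ring

end ExpectedPoly

namespace GreedyRun

variable {n m k : ℕ} {A : Matrix (Fin n) (Fin m) ℝ} {w : Fin m → ℝ} {l : List (Fin m)}

theorem nodup (h : GreedyRun A w k l) : l.Nodup := by
  induction h with
  | nil => exact List.nodup_nil
  | snoc l s _ hs _ ih => exact List.nodup_append.2 ⟨ih, List.nodup_singleton s, fun t ht u hu => by
      rw [List.mem_singleton.1 hu]; exact ne_of_mem_of_not_mem ht hs⟩

theorem kthLargestRoot_le (hw : ∀ i, w i ≠ 0) (hk : 1 ≤ k) (hkn : k ≤ n)
    (h : GreedyRun A w k l) (hl : l.length ≤ k) :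
    kthLargestRoot k (partialPoly A w k []) ≤ kthLargestRoot k (partialPoly A w k l) := by
  induction h with
  | nil => exact le_rfl
  | snoc l s _ _ hmax ih =>
    have : Nonempty (Fin m) := ⟨s⟩
    rw [List.length_append, List.length_singleton] at hl
    refine (ih (by omega)).trans ?_
    obtain ⟨t, ht⟩ := exists_kthLargestRoot_expectedPoly_le A hw hk hkn (k - l.length - 1)
      (posSemidef_outerSum A w l).isHermitian
    rw [← outerSum_append_singleton, show k - l.length - 1 = k - (l ++ [t]).length by simp; omega,
      show k - (l ++ [t]).length + 1 = k - l.length by simp; omega,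
      ← kthLargestRoot_partialPoly A hw, ← kthLargestRoot_partialPoly A hw] at ht
    by_cases htl : t ∈ l
    · have hnd : ¬ (l ++ [t]).Nodup := fun hnd =>
        (List.nodup_append.1 hnd).2.2 t htl t (List.mem_singleton_self t) rfl
      refine (ht.trans (kthLargestRoot_partialPoly_nonpos_of_not_nodup A hw hk hkn
        (by simpa using hl) hnd)).trans ?_
      rw [kthLargestRoot_partialPoly A hw]
      exact kthLargestRoot_expectedPoly_nonneg A hw hk hkn _ (posSemidef_outerSum A w _)
    · exact ht.trans (hmax t htl)

theorem le_sigmaMin_sq (hw : ∀ i, w i ≠ 0) (hk : 1 ≤ k) (hkn : k ≤ n) (h : GreedyRun A w k l)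
    (hl : l.length = k) : kthLargestRoot k (partialPoly A w k []) ≤
      sigmaMin (colsOf A l.toFinset * weightsOf w l.toFinset) ^ 2 := by
  have hcard : Fintype.card l.toFinset = k := by
    rw [Fintype.card_coe, List.toFinset_card_of_nodup h.nodup, hl]
  have : Nonempty l.toFinset := Fintype.card_pos_iff.1 (by omega)
  refine (h.kthLargestRoot_le hw hk hkn hl.le).trans ?_
  rw [kthLargestRoot_partialPoly A hw, hl, Nat.sub_self, outerSum_eq_mul_transpose A w h.nodup]
  have hsigma := kthLargestRoot_le_sigmaMin_sq (colsOf A l.toFinset * weightsOf w l.toFinset)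
    (hcard.le.trans hkn)
  rwa [hcard] at hsigma

end GreedyRun

/-! ### Rank-one updates of positive definite matrices -/

section RankOneUpdate

variable {n : Type*}

theorem posDef_one_add_smul [DecidableEq n] {M : Matrix n n ℝ} (hM : M.PosSemidef) {r : ℝ}
    (hr : 0 ≤ r) : (1 + r • M).PosDef :=
  PosDef.one.add_posSemidef (hM.smul hr)

variable {R : Matrix n n ℝ}

theorem posDef_add_smul_vecMulVec [Finite n] (hR : R.PosDef) (u : n → ℝ) {α : ℝ}
    (hα : 0 ≤ α) : (R + α • vecMulVec u u).PosDef :=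
  hR.add_posSemidef ((by simpa using posSemidef_vecMulVec_self_star u :
      (vecMulVec u u).PosSemidef).smul hα)

variable [Fintype n] [DecidableEq n]

theorem one_add_mul_dotProduct_inv_mulVec_pos (hR : R.PosDef) (u : n → ℝ) {α : ℝ} (hα : 0 ≤ α) :
    0 < 1 + α * (u ⬝ᵥ R⁻¹ *ᵥ u) := by
  have := hR.inv.posSemidef.dotProduct_mulVec_nonneg u
  rw [star_trivial] at this
  positivity

theorem det_add_smul_vecMulVec (hR : R.PosDef) (u : n → ℝ) (α : ℝ) :
    (R + α • vecMulVec u u).det = R.det * (1 + α * (u ⬝ᵥ R⁻¹ *ᵥ u)) := by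
  rw [← smul_vecMulVec, det_add_vecMulVec_of_det_ne_zero hR.det_pos.ne', mulVec_smul,
    dotProduct_smul, smul_eq_mul]

theorem inv_mulVec_dotProduct (hR : R.PosDef) (b u : n → ℝ) :
    R⁻¹ *ᵥ b ⬝ᵥ u = b ⬝ᵥ R⁻¹ *ᵥ u := by
  have hsymm : R⁻¹ᵀ = R⁻¹ := by simpa using hR.inv.isHermitian.eq
  rw [dotProduct_mulVec, ← mulVec_transpose, hsymm]

theorem inv_add_smul_vecMulVec_mulVec (hR : R.PosDef) (u : n → ℝ) {α : ℝ} (hα : 0 ≤ α)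
    (z : n → ℝ) :
    (R + α • vecMulVec u u)⁻¹ *ᵥ z = R⁻¹ *ᵥ z -
      (α * (u ⬝ᵥ R⁻¹ *ᵥ z) / (1 + α * (u ⬝ᵥ R⁻¹ *ᵥ u))) • R⁻¹ *ᵥ u := by
  have hden := (one_add_mul_dotProduct_inv_mulVec_pos hR u hα).ne'
  have hR' := (posDef_add_smul_vecMulVec hR u hα).det_pos.ne'.isUnit
  have hRi (y : n → ℝ) : R *ᵥ R⁻¹ *ᵥ y = y := by
    rw [mulVec_mulVec, mul_nonsing_inv _ hR.det_pos.ne'.isUnit, one_mulVec]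
  have hsolve : (R + α • vecMulVec u u) *ᵥ (R⁻¹ *ᵥ z -
      (α * (u ⬝ᵥ R⁻¹ *ᵥ z) / (1 + α * (u ⬝ᵥ R⁻¹ *ᵥ u))) • R⁻¹ *ᵥ u) = z := by
    rw [add_mulVec, mulVec_sub, mulVec_smul, hRi, hRi, smul_mulVec, vecMulVec_mulVec,
      dotProduct_sub, dotProduct_smul]
    ext i
    simp only [Pi.add_apply, Pi.sub_apply, Pi.smul_apply, smul_eq_mul, MulOpposite.smul_eq_mul_unop,
      MulOpposite.unop_op]
    field_simp
    ring
  rw [← hsolve, mulVec_mulVec _ (_ + _)⁻¹, nonsing_inv_mul _ hR', one_mulVec, hsolve]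

end RankOneUpdate

/-! ### Interpolation of mean characteristic polynomials -/

section Interpolation

/-- The Lagrange basis polynomial that is `1` at `-i` and `0` at the other nodes `-h`, `h < N`. -/
def nodeBasis (N i : ℕ) : ℝ[X] := Lagrange.basis (Finset.range N) (fun h : ℕ => -(h : ℝ)) i

theorem nodeBasis_zero (i : ℕ) : nodeBasis 0 i = 1 := rfl

theorem nodeBasis_succ_self (i : ℕ) : nodeBasis (i + 1) i = nodeBasis i i := by
  rw [nodeBasis, nodeBasis, Lagrange.basis, Lagrange.basis, Finset.range_add_one,
    Finset.erase_insert (by simp), Finset.erase_eq_of_notMem (by simp)]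

theorem coeff_nodeBasis_succ {h i : ℕ} (hi : h ≠ i) (d : ℕ) :
    (nodeBasis (h + 1) i).coeff d =
      ((X * nodeBasis h i).coeff d + h * (nodeBasis h i).coeff d) / (h - i) := by
  have hprod : nodeBasis (h + 1) i =
      Lagrange.basisDivisor (-(i : ℝ)) (-(h : ℝ)) * nodeBasis h i := by
    rw [nodeBasis, nodeBasis, Lagrange.basis, Lagrange.basis, Finset.range_add_one,
      Finset.erase_insert_of_ne hi, Finset.prod_insert (by simp)]
  have hdiv : Lagrange.basisDivisor (-(i : ℝ)) (-(h : ℝ)) =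
      C ((h : ℝ) - i)⁻¹ * (X + C (h : ℝ)) := by
    simp [Lagrange.basisDivisor, sub_eq_add_neg, add_comm]
  rw [hprod, hdiv, mul_assoc, coeff_C_mul, add_mul, coeff_add, coeff_C_mul, div_eq_inv_mul]

theorem coeff_eq_sum_nodeBasis {F : ℝ[X]} {N : ℕ} (hF : F.natDegree < N) (d : ℕ) :
    F.coeff d = ∑ i : Fin N, F.eval (-(i : ℝ)) * (nodeBasis N i).coeff d := by
  have h := Lagrange.eq_interpolate_of_eval_eq (s := Finset.range N) (v := fun i : ℕ => -(i : ℝ))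
    (fun i => F.eval (-(i : ℝ))) (fun i _ j _ h => by simpa using h)
    (by simpa using degree_le_natDegree.trans_lt (by exact_mod_cast hF)) (fun i _ => rfl)
  conv_lhs => rw [h, Lagrange.interpolate_apply, finsetSum_coeff, Finset.sum_range]
  simp_rw [coeff_C_mul, nodeBasis]

variable {n ι : Type*} [Fintype n] [DecidableEq n] {N : ℕ}

theorem coeff_charpoly_card_sub (M : Matrix n n ℝ) (hN : Fintype.card n < N) {t : ℕ}
    (ht : t ≤ Fintype.card n) :
    M.charpoly.coeff (Fintype.card n - t) =
      ∑ i : Fin N, (1 + (i : ℝ) • M).det * (nodeBasis N i).coeff t := by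
  have hrev : M.charpolyRev.coeff t = M.charpoly.coeff (Fintype.card n - t) := by
    rw [← reverse_charpoly, coeff_reverse, charpoly_natDegree_eq_dim, revAt_le ht]
  have heval (x : ℝ) : M.charpolyRev.eval (-x) = (1 + x • M).det := by
    rw [charpolyRev, ← coe_evalRingHom, RingHom.map_det]
    congr 1
    ext i j
    rcases eq_or_ne i j with rfl | hij <;> simp [*, mul_comm x]
  have hdeg : M.charpolyRev.natDegree < N := by
    rw [← reverse_charpoly]
    exact ((reverse_natDegree_le _).trans_eq M.charpoly_natDegree_eq_dim).trans_lt hN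
  rw [← hrev, coeff_eq_sum_nodeBasis hdeg]
  simp_rw [heval]

/-- The weight of the determinant at the grid point `(r, i)` in the interpolation of the mean of
`det (1 + i M)` over `q` random steps, where `c` is the value of `p_s w_s²` for all `s`. -/
def gridWeight (N q : ℕ) (c : ℝ) (i r : ℕ) : ℝ :=
  ∑ d : Fin N, q.descFactorial d * (-i * c) ^ (d : ℕ) * (nodeBasis N r).coeff d

theorem eval_zero_oneAddDeriv_pow_detPencil (hN : Fintype.card n < N) (q i : ℕ) (c : ℝ)
    (R B : Matrix n n ℝ) :
    ((oneAddDeriv (i * c) ^ q) (detPencil R B)).eval 0 =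
      ∑ r : Fin N, gridWeight N q c i r * (R + (r : ℝ) • B).det := by
  have hdeg : (detPencil R B).natDegree < N := (natDegree_detPencil_le R B).trans_lt hN
  have hcoeff (d : ℕ) : (detPencil R B).coeff d =
      (-1) ^ d * ∑ r : Fin N, (R + (r : ℝ) • B).det * (nodeBasis N r).coeff d := by
    have h := coeff_eq_sum_nodeBasis (F := (detPencil R B).comp (C (-1) * X)) (N := N)
      (natDegree_comp_le.trans_lt (by simpa using hdeg)) d
    simp only [comp_C_mul_X_coeff, eval_comp, eval_mul, eval_C, eval_X, neg_mul_neg, one_mul,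
      eval_detPencil] at h
    rw [← h, mul_comm, mul_assoc, ← mul_pow, neg_mul_neg, one_mul, one_pow, mul_one]
  rw [eval_zero_oneAddDeriv_pow _ _ hdeg, Finset.sum_range]
  simp_rw [hcoeff, gridWeight, Finset.mul_sum, Finset.sum_mul]
  rw [Finset.sum_comm]
  refine Finset.sum_congr rfl fun r _ => Finset.sum_congr rfl fun d _ => ?_
  rw [neg_mul, neg_pow ((i : ℝ) * c)]
  ring

theorem coeff_meanCharpoly_card_sub [Fintype ι] {p ω : ι → ℝ} (hp : ∑ s, p s = 1) {c : ℝ}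
    (hc : ∀ s, p s * ω s = c) (a : ι → n → ℝ) (q : ℕ) (M : Matrix n n ℝ)
    (hN : Fintype.card n < N) {t : ℕ} (ht : t ≤ Fintype.card n) :
    (meanCharpoly p (fun s => ω s • vecMulVec (a s) (a s)) q M).coeff (Fintype.card n - t) =
      ∑ i : Fin N, (∑ r : Fin N, gridWeight N q c i r *
        (1 + (i : ℝ) • M + (r : ℝ) • ∑ s, vecMulVec (a s) (a s)).det) *
          (nodeBasis N i).coeff t := by
  let U (s : ι) := ω s • vecMulVec (a s) (a s)
  have hmean (i : Fin N) : walkMean p U q (fun M => (1 + (i : ℝ) • M).det) M =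
      ∑ r : Fin N, gridWeight N q c i r *
        (1 + (i : ℝ) • M + (r : ℝ) • ∑ s, vecMulVec (a s) (a s)).det := by
    rw [← eval_zero_oneAddDeriv_pow_detPencil hN]
    refine walkMean_det (φ := fun M => 1 + (i : ℝ) • M) (τ := fun s => i * ω s) hp (fun s => ?_)
      (fun M s => ?_) q M
    · rw [smul_eq_mul, ← hc s]; ring
    · simp only [U, smul_add, smul_smul, add_assoc]
  let interp : (Fin N → ℝ) →ₗ[ℝ] ℝ := ∑ i : Fin N, (nodeBasis N i).coeff t • LinearMap.proj i
  have hinterp (v) : interp v = ∑ i : Fin N, v i * (nodeBasis N i).coeff t := by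
    simp [interp, LinearMap.sum_apply, mul_comm]
  simp_rw [coeff_meanCharpoly, coeff_charpoly_card_sub _ hN ht, ← hmean, ← hinterp]
  exact (map_walkMean p U q interp (fun M i => (1 + ((i : ℕ) : ℝ) • M).det) M).symm.trans <|
    congrArg interp <| funext fun i =>
      map_walkMean p U q (LinearMap.proj i : (Fin N → ℝ) →ₗ[ℝ] ℝ) _ M

end Interpolation

end WeightedRI

namespace RealRAM

/-! ### Program logic -/

namespace State

variable (σ : State)

@[simp] theorem nvar_setVar (x v y : ℕ) :
    (σ.setVar x v).nvar y = if y = x then v else σ.nvar y := by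
  simp only [setVar, Function.update_apply]

@[simp] theorem narr_setVar (x v : ℕ) : (σ.setVar x v).narr = σ.narr := rfl

@[simp] theorem rarr_setVar (x v : ℕ) : (σ.setVar x v).rarr = σ.rarr := rfl

@[simp] theorem nvar_setNat (a i v : ℕ) : (σ.setNat a i v).nvar = σ.nvar := rfl

@[simp] theorem narr_setNat (a i v a' i' : ℕ) :
    (σ.setNat a i v).narr a' i' = if a' = a ∧ i' = i then v else σ.narr a' i' := by
  simp only [setNat, Function.update_apply]
  grind

@[simp] theorem rarr_setNat (a i v : ℕ) : (σ.setNat a i v).rarr = σ.rarr := rfl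

@[simp] theorem nvar_setReal (a i j : ℕ) (v : ℝ) : (σ.setReal a i j v).nvar = σ.nvar := rfl

@[simp] theorem narr_setReal (a i j : ℕ) (v : ℝ) : (σ.setReal a i j v).narr = σ.narr := rfl

@[simp] theorem rarr_setReal (a i j : ℕ) (v : ℝ) (a' i' j' : ℕ) :
    (σ.setReal a i j v).rarr a' i' j' =
      if a' = a ∧ i' = i ∧ j' = j then v else σ.rarr a' i' j' := by
  rcases eq_or_ne a' a with rfl | ha
  · rcases eq_or_ne i' i with rfl | hi
    · simp [setReal, Function.update_apply]
    · simp [setReal, hi]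
  · simp [setReal, ha]

end State

attribute [simp] NExp.eval RExp.eval BExp.eval NExp.cost RExp.cost BExp.cost

namespace Cmd

/-- The natural-number variables to which a program may assign. -/
@[simp] def vars : Cmd → List ℕ
  | skip => []
  | setVar x _ => [x]
  | setNat _ _ _ => []
  | setReal _ _ _ _ => []
  | root _ _ _ _ _ _ _ => []
  | seq c c' => c.vars ++ c'.vars
  | ite _ c c' => c.vars ++ c'.vars
  | .while _ c => c.vars

/-- The natural-number arrays to which a program may assign. -/
@[simp] def natArrays : Cmd → List ℕ
  | skip => []
  | setVar _ _ => []
  | setNat a _ _ => [a]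
  | setReal _ _ _ _ => []
  | root _ _ _ _ _ _ _ => []
  | seq c c' => c.natArrays ++ c'.natArrays
  | ite _ c c' => c.natArrays ++ c'.natArrays
  | .while _ c => c.natArrays

/-- The real arrays to which a program may assign. -/
@[simp] def realArrays : Cmd → List ℕ
  | skip => []
  | setVar _ _ => []
  | setNat _ _ _ => []
  | setReal a _ _ _ => [a]
  | root a _ _ _ _ _ _ => [a]
  | seq c c' => c.realArrays ++ c'.realArrays
  | ite _ c c' => c.realArrays ++ c'.realArrays
  | .while _ c => c.realArrays

/-- The states `σ` and `τ` agree on the part of the memory to which `c` does not assign. -/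
structure Frame (c : Cmd) (σ τ : State) : Prop where
  nvar : ∀ x ∉ c.vars, τ.nvar x = σ.nvar x
  narr : ∀ a ∉ c.natArrays, τ.narr a = σ.narr a
  rarr : ∀ a ∉ c.realArrays, τ.rarr a = σ.rarr a

theorem Frame.refl (c : Cmd) (σ : State) : c.Frame σ σ :=
  ⟨fun _ _ => rfl, fun _ _ => rfl, fun _ _ => rfl⟩

theorem Frame.trans {c c' d : Cmd} {σ τ ρ : State} (h : c.Frame σ τ) (h' : c'.Frame τ ρ)
    (hv : c.vars ++ c'.vars ⊆ d.vars) (hn : c.natArrays ++ c'.natArrays ⊆ d.natArrays)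
    (hr : c.realArrays ++ c'.realArrays ⊆ d.realArrays) : d.Frame σ ρ := by
  simp only [List.append_subset] at hv hn hr
  exact ⟨fun x hx => (h'.nvar x fun k => hx (hv.2 k)).trans (h.nvar x fun k => hx (hv.1 k)),
    fun x hx => (h'.narr x fun k => hx (hn.2 k)).trans (h.narr x fun k => hx (hn.1 k)),
    fun x hx => (h'.rarr x fun k => hx (hr.2 k)).trans (h.rarr x fun k => hx (hr.1 k))⟩

end Cmd

theorem Exec.frame {c : Cmd} {σ τ : State} {t : ℕ} (h : Exec c σ τ t) : c.Frame σ τ := by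
  induction h with
  | skip σ => exact .refl _ σ
  | setVar σ x e => exact ⟨fun y hy => by simp_all, fun _ _ => rfl, fun _ _ => rfl⟩
  | setNat σ a i e =>
    exact ⟨fun _ _ => rfl, fun b hb => funext fun _ => by simp_all, fun _ _ => rfl⟩
  | setReal σ a i j e | root σ a i j b r d k =>
    exact ⟨fun _ _ => rfl, fun _ _ => rfl, fun b hb => funext₂ fun _ _ => by simp_all⟩
  | seq _ _ ih ih' => exact ih.trans ih' (by simp) (by simp) (by simp)
  | iteTrue _ _ ih | iteFalse _ _ ih =>
    exact ih.trans (.refl .skip _) (by simp) (by simp) (by simp)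
  | whileTrue _ _ _ ih ih' => exact ih.trans ih' (by simp) (by simp) (by simp)
  | whileFalse => exact .refl _ _

/-- Started in `σ`, the program halts after at most `T` steps in a state satisfying `Q`. -/
def Runs (c : Cmd) (σ : State) (T : ℕ) (Q : State → Prop) : Prop :=
  ∃ τ t, Exec c σ τ t ∧ t ≤ T ∧ Q τ

namespace Runs

variable {c c' : Cmd} {σ τ : State} {T T' : ℕ} {Q Q' : State → Prop}

theorem mono (h : Runs c σ T Q) (hT : T ≤ T') (hQ : ∀ τ, c.Frame σ τ → Q τ → Q' τ) :
    Runs c σ T' Q' := by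
  obtain ⟨τ, t, hexec, ht, hτ⟩ := h
  exact ⟨τ, t, hexec, ht.trans hT, hQ τ hexec.frame hτ⟩

theorem le (h : Runs c σ T Q) (hT : T ≤ T') : Runs c σ T' Q := h.mono hT fun _ _ hτ => hτ

theorem post (h : Runs c σ T Q) (hQ : ∀ τ, c.Frame σ τ → Q τ → Q' τ) : Runs c σ T Q' :=
  h.mono le_rfl hQ

theorem skip (h : Q σ) : Runs .skip σ 1 Q := ⟨σ, 1, .skip σ, le_rfl, h⟩

theorem setVar {x : ℕ} {e : NExp} (h : Q (σ.setVar x (e.eval σ))) :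
    Runs (.setVar x e) σ (e.cost + 1) Q := ⟨_, _, .setVar σ x e, le_rfl, h⟩

theorem setNat {a : ℕ} {i e : NExp} (h : Q (σ.setNat a (i.eval σ) (e.eval σ))) :
    Runs (.setNat a i e) σ (i.cost + e.cost + 1) Q := ⟨_, _, .setNat σ a i e, le_rfl, h⟩

theorem setReal {a : ℕ} {i j : NExp} {e : RExp}
    (h : Q (σ.setReal a (i.eval σ) (j.eval σ) (e.eval σ))) :
    Runs (.setReal a i j e) σ (i.cost + j.cost + e.cost + 1) Q :=
  ⟨_, _, .setReal σ a i j e, le_rfl, h⟩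

theorem seq (h : Runs c σ T Q) (h' : ∀ τ, c.Frame σ τ → Q τ → Runs c' τ T' Q') :
    Runs (.seq c c') σ (T + T') Q' := by
  obtain ⟨τ, t, hexec, ht, hτ⟩ := h
  obtain ⟨ρ, t', hexec', ht', hρ⟩ := h' τ hexec.frame hτ
  exact ⟨ρ, t + t', .seq hexec hexec', Nat.add_le_add ht ht', hρ⟩

theorem ite {b : BExp} (h : b.eval σ → Runs c σ T Q) (h' : ¬ b.eval σ → Runs c' σ T Q) :
    Runs (.ite b c c') σ (b.cost + T + 1) Q := by
  by_cases hb : b.eval σ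
  · obtain ⟨τ, t, hexec, ht, hτ⟩ := h hb
    exact ⟨τ, _, .iteTrue hb hexec, by lia, hτ⟩
  · obtain ⟨τ, t, hexec, ht, hτ⟩ := h' hb
    exact ⟨τ, _, .iteFalse hb hexec, by lia, hτ⟩

end Runs

/-- The loop `for x < r do c`, where `x` and `r` are variables. -/
@[simp] def forLoop (x r : ℕ) (c : Cmd) : Cmd :=
  .seq (.setVar x (.const 0))
    (.while (.natLt (.var x) (.var r)) (.seq c (.setVar x (.add (.var x) (.const 1)))))

/-- The loop `for x < r do a[i][j] := f`. -/
@[simp] def fillLoop (x r a : ℕ) (i j : NExp) (f : RExp) : Cmd := forLoop x r (.setReal a i j f)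

/-- Compute `∑ x < r, f` in cell `(0, 0)` of the real array `acc`. -/
@[simp] def sumLoop (x r acc : ℕ) (f : RExp) : Cmd :=
  .seq (.setReal acc (.const 0) (.const 0) (.ofNat (.const 0)))
    (fillLoop x r acc (.const 0) (.const 0) (.add (.get acc (.const 0) (.const 0)) f))

/-- The loop `for y < r' do a[i][j] := g`, where `g` may read the value of `∑ x < r, f` from cell
`(0, 0)` of the real array `acc`. -/
@[simp] def sumFillLoop (y r' a : ℕ) (i j : NExp) (x r acc : ℕ) (f g : RExp) : Cmd :=
  forLoop y r' (.seq (sumLoop x r acc f) (.setReal a i j g))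

/-- `g` arises from the two-dimensional array `f` by storing the values `v s` in the cells
`(i, J s)`, `s < t`. -/
structure CellsFilled {N : ℕ} (i : ℕ) (J : ℕ → ℕ) (v : Fin N → ℝ) (t : ℕ) (f g : ℕ → ℕ → ℝ) :
    Prop where
  eq : ∀ s : Fin N, s < t → g i (J s) = v s
  eq_of_ne : ∀ i' j, (i' = i → ∀ s < t, j ≠ J s) → g i' j = f i' j

/-- `g` arises from the two-dimensional array `f` by storing the vectors `v s` in the rows `ρ s`,
`s < t`; cells of these rows beyond the length of the vectors may have changed, too. -/
structure RowsFilled {n N : ℕ} (ρ : ℕ → ℕ) (v : Fin N → Fin n → ℝ) (t : ℕ) (f g : ℕ → ℕ → ℝ) :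
    Prop where
  eq : ∀ s : Fin N, s < t → ∀ x : Fin n, g (ρ s) x = v s x
  eq_of_ne : ∀ i, (∀ s < t, i ≠ ρ s) → g i = f i

namespace CellsFilled

variable {N i t : ℕ} {J : ℕ → ℕ} {v : Fin N → ℝ} {f g g' : ℕ → ℕ → ℝ}

theorem zero : CellsFilled i J v 0 f f := ⟨by simp, by simp⟩

theorem row_eq (h : CellsFilled i J v t f g) {i' : ℕ} (hi : i' ≠ i) : g i' = f i' :=
  funext fun j => h.eq_of_ne i' j fun hi' => absurd hi' hi

theorem succ {t : Fin N} (h : CellsFilled i J v t f g) (hJ : ∀ s < t.1, J s ≠ J t)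
    (hg' : ∀ i' j, g' i' j = if i' = i ∧ j = J t then v t else g i' j) :
    CellsFilled i J v (t + 1) f g' where
  eq s hs := by
    rcases Nat.lt_succ_iff_lt_or_eq.1 hs with h' | h'
    · rw [hg', if_neg fun e => hJ s h' e.2, h.eq s h']
    · obtain rfl := Fin.ext h'
      rw [hg', if_pos ⟨rfl, rfl⟩]
  eq_of_ne i' j hij := by
    rw [hg', if_neg fun e => hij e.1 t t.1.lt_succ_self e.2,
      h.eq_of_ne i' j fun hi s hs => hij hi s (hs.trans t.1.lt_succ_self)]

end CellsFilled

namespace RowsFilled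

variable {n N t : ℕ} {ρ : ℕ → ℕ} {v : Fin N → Fin n → ℝ} {f g g' : ℕ → ℕ → ℝ}

theorem zero : RowsFilled ρ v 0 f f := ⟨by simp, by simp⟩

theorem succ {t : Fin N} (h : RowsFilled ρ v t f g) (hρ : ∀ s < t.1, ρ s ≠ ρ t)
    (hg' : CellsFilled (ρ t) id (v t) n g g') : RowsFilled ρ v (t + 1) f g' where
  eq s hs x := by
    rcases Nat.lt_succ_iff_lt_or_eq.1 hs with h' | h'
    · rw [hg'.row_eq (hρ s h'), h.eq s h' x]
    · obtain rfl := Fin.ext h'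
      exact hg'.eq x x.2
  eq_of_ne i hi := by
    rw [hg'.row_eq (hi t t.1.lt_succ_self),
      h.eq_of_ne i fun s hs => hi s (hs.trans t.1.lt_succ_self)]

end RowsFilled

namespace Runs

variable {c : Cmd} {σ : State} {x r N T : ℕ}

theorem while_of_lt (I : ℕ → State → Prop) (hr : σ.nvar r = N)
    (hrc : r ∉ (RealRAM.forLoop x r c).vars) (hx : x ∉ c.vars)
    (hstep : ∀ i τ, i < N → (RealRAM.forLoop x r c).Frame σ τ → τ.nvar x = i → I i τ →
      Runs c τ T fun τ' => I (i + 1) (τ'.setVar x (i + 1))) (d i : ℕ) (hi : i + d = N) (τ : State)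
    (hf : (RealRAM.forLoop x r c).Frame σ τ) (hxi : τ.nvar x = i) (hI : I i τ) :
    Runs (.while (.natLt (.var x) (.var r)) (.seq c (.setVar x (.add (.var x) (.const 1))))) τ
      (d * (T + 8) + 4) (I N) := by
  have hr' : τ.nvar r = N := (hf.nvar r hrc).trans hr
  induction d generalizing i τ with
  | zero =>
    obtain rfl : i = N := hi
    exact ⟨τ, _, .whileFalse (by simp [hxi, hr']), by simp, hI⟩
  | succ d ih =>
    obtain ⟨τ', t', hexec, ht', hI'⟩ := hstep i τ (by lia) hf hxi hI
    have hxi' : τ'.nvar x = i := (hexec.frame.nvar x hx).trans hxi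
    have hinc := Exec.setVar τ' x (.add (.var x) (.const 1))
    simp only [NExp.eval, hxi'] at hinc
    have hbody := Exec.seq hexec hinc
    have hf' := hf.trans hbody.frame (d := RealRAM.forLoop x r c) (by simp) (by simp) (by simp)
    obtain ⟨ρ, t, hexec', ht, hρ⟩ :=
      ih (i + 1) (by lia) _ hf' (by simp) hI' ((hf'.nvar r hrc).trans hr)
    refine ⟨ρ, _, .whileTrue ?_ hbody hexec', ?_, hρ⟩
    · simp only [BExp.eval, NExp.eval, hxi, hr']; lia
    · simp only [BExp.cost, NExp.cost, add_mul, one_mul]; lia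

theorem forLoop (I : ℕ → State → Prop) (hr : σ.nvar r = N)
    (hrc : r ∉ (RealRAM.forLoop x r c).vars) (hx : x ∉ c.vars) (h0 : I 0 (σ.setVar x 0))
    (hstep : ∀ i τ, i < N → (RealRAM.forLoop x r c).Frame σ τ → τ.nvar x = i → I i τ →
      Runs c τ T fun τ' => I (i + 1) (τ'.setVar x (i + 1))) :
    Runs (forLoop x r c) σ (N * (T + 8) + 6) (I N) :=
  ((setVar (e := .const 0) (Q := (· = σ.setVar x 0)) rfl).seq fun τ hτ h => by
    subst h
    refine while_of_lt I hr hrc hx hstep N 0 (zero_add N) _ ?_ (by simp) h0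
    exact hτ.trans (.refl .skip _) (by simp) (by simp) (by simp)).le (by simp; lia)

/-- The loop rule for invariants that do not depend on the loop variable. -/
theorem forLoop' (I : ℕ → State → Prop) (hr : σ.nvar r = N)
    (hrc : r ∉ (RealRAM.forLoop x r c).vars) (hx : x ∉ c.vars) (h0 : I 0 σ)
    (hstep : ∀ i τ, i < N → (RealRAM.forLoop x r c).Frame σ τ → τ.nvar x = i → I i τ →
      Runs c τ T (I (i + 1)))
    (hI : ∀ i τ v, I i τ → I i (τ.setVar x v) := by exact fun _ _ _ h => h) :
    Runs (RealRAM.forLoop x r c) σ (N * (T + 8) + 6) (I N) :=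
  forLoop I hr hrc hx (hI _ _ _ h0) fun i τ hi hτ hxi hIi =>
    (hstep i τ hi hτ hxi hIi).post fun _ _ h => hI _ _ _ h

theorem forRows {a n : ℕ} (ρ : ℕ → ℕ) (v : Fin N → Fin n → ℝ)
    (hρ : ∀ s t, s < t → t < N → ρ s ≠ ρ t)
    (hr : σ.nvar r = N) (hrc : r ∉ (RealRAM.forLoop x r c).vars) (hx : x ∉ c.vars)
    (hstep : ∀ (t : Fin N) τ, (RealRAM.forLoop x r c).Frame σ τ → τ.nvar x = t →
      RowsFilled ρ v t (σ.rarr a) (τ.rarr a) →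
        Runs c τ T fun τ' => CellsFilled (ρ t) id (v t) n (τ.rarr a) (τ'.rarr a)) :
    Runs (RealRAM.forLoop x r c) σ (N * (T + 8) + 6)
      fun τ => RowsFilled ρ v N (σ.rarr a) (τ.rarr a) :=
  forLoop' (fun t τ => RowsFilled ρ v t (σ.rarr a) (τ.rarr a)) hr hrc hx .zero
    fun t τ ht hτ hxt h =>
      (hstep ⟨t, ht⟩ τ hτ hxt h).post fun _ _ h' => h.succ (fun s hs => hρ s t hs ht) h'

theorem fillLoop {a : ℕ} {i j : NExp} {f : RExp} {K : ℕ} (i₀ : ℕ) (J : ℕ → ℕ) (v : Fin N → ℝ)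
    (hJ : ∀ s t, s < t → t < N → J s ≠ J t) (hr : σ.nvar r = N) (hrx : r ≠ x)
    (hK : i.cost + j.cost + f.cost + 1 ≤ K)
    (hv : ∀ (t : Fin N) τ, (RealRAM.fillLoop x r a i j f).Frame σ τ → τ.nvar x = t →
      CellsFilled i₀ J v t (σ.rarr a) (τ.rarr a) →
        i.eval τ = i₀ ∧ j.eval τ = J t ∧ f.eval τ = v t) :
    Runs (fillLoop x r a i j f) σ (N * (K + 8) + 6)
      fun τ => CellsFilled i₀ J v N (σ.rarr a) (τ.rarr a) := by
  refine forLoop' (fun t τ => CellsFilled i₀ J v t (σ.rarr a) (τ.rarr a)) hr (by simpa using hrx)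
    (by simp) .zero fun t τ ht hτ hxt h => ?_
  obtain ⟨hi, hj, hf⟩ := hv ⟨t, ht⟩ τ hτ hxt h
  refine (setReal ?_).le hK
  exact h.succ (t := ⟨t, ht⟩) (fun s hs => hJ s t hs ht) (by simp [hi, hj, hf])

theorem fillRow {a : ℕ} {i : NExp} {f : RExp} {K : ℕ} (i₀ : ℕ) (v : Fin N → ℝ)
    (hr : σ.nvar r = N) (hrx : r ≠ x) (hK : i.cost + f.cost + 2 ≤ K)
    (hv : ∀ (t : Fin N) τ, (RealRAM.fillLoop x r a i (.var x) f).Frame σ τ → τ.nvar x = t →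
      CellsFilled i₀ id v t (σ.rarr a) (τ.rarr a) → i.eval τ = i₀ ∧ f.eval τ = v t) :
    Runs (RealRAM.fillLoop x r a i (.var x) f) σ (N * (K + 8) + 6)
      fun τ => CellsFilled i₀ id v N (σ.rarr a) (τ.rarr a) :=
  fillLoop i₀ id v (fun _ _ h _ => h.ne) hr hrx (by simp; lia) fun t τ hτ hxt h =>
    ⟨(hv t τ hτ hxt h).1, hxt, (hv t τ hτ hxt h).2⟩

theorem sumLoop {acc : ℕ} {f : RExp} {K : ℕ} (v : Fin N → ℝ) (hr : σ.nvar r = N) (hrx : r ≠ x)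
    (hK : f.cost ≤ K) (hv : ∀ (i : Fin N) τ, (RealRAM.sumLoop x r acc f).Frame σ τ →
      τ.nvar x = i → f.eval τ = v i) :
    Runs (sumLoop x r acc f) σ (N * (K + 15) + 11) fun τ => τ.rarr acc 0 0 = ∑ i, v i := by
  refine (seq (setReal (Q := fun τ => τ.rarr acc 0 0 = 0) (by simp)) fun τ₀ hτ₀ h₀ => ?_).le
    (T := 5 + (N * ((K + 7) + 8) + 6)) (by lia)
  let v' (i : ℕ) : ℝ := if h : i < N then v ⟨i, h⟩ else 0
  have hv' : ∑ i, v i = ∑ i ∈ Finset.range N, v' i := by simp [Finset.sum_range, v']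
  simp only [hv']
  refine forLoop' (fun i τ => τ.rarr acc 0 0 = ∑ i ∈ Finset.range i, v' i)
    ((hτ₀.nvar r (by simp)).trans hr) (by simpa using hrx) (by simp) (by simpa using h₀)
    fun i τ hi hτ hxi hsum => (setReal ?_).le (by simp; lia)
  simp [hsum, hv ⟨i, hi⟩ τ (hτ₀.trans hτ (by simp) (by simp) (by simp)) hxi,
    Finset.sum_range_succ, v', hi]

theorem sumFillLoop {y r' a : ℕ} {i j : NExp} {acc : ℕ} {f g : RExp} {N' K : ℕ} (i₀ : ℕ)
    (J : ℕ → ℕ) (u : Fin N' → Fin N → ℝ) (v : Fin N' → ℝ)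
    (hJ : ∀ s t, s < t → t < N' → J s ≠ J t)
    (hr' : σ.nvar r' = N') (hr : σ.nvar r = N) (hyx : y ≠ x) (hry : r' ≠ y) (hrx : r' ≠ x)
    (hry' : r ≠ y) (hrx' : r ≠ x) (haacc : a ≠ acc)
    (hf : f.cost ≤ K) (hK : i.cost + j.cost + g.cost + 1 ≤ K)
    (hfv : ∀ (t : Fin N') (s : Fin N) τ,
      (RealRAM.sumFillLoop y r' a i j x r acc f g).Frame σ τ → τ.nvar y = t → τ.nvar x = s →
        CellsFilled i₀ J v t (σ.rarr a) (τ.rarr a) → f.eval τ = u t s)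
    (hgv : ∀ (t : Fin N') τ, (RealRAM.sumFillLoop y r' a i j x r acc f g).Frame σ τ →
      τ.nvar y = t → CellsFilled i₀ J v t (σ.rarr a) (τ.rarr a) → τ.rarr acc 0 0 = ∑ s, u t s →
        i.eval τ = i₀ ∧ j.eval τ = J t ∧ g.eval τ = v t) :
    Runs (sumFillLoop y r' a i j x r acc f g) σ (N' * (N * (K + 15) + K + 19) + 6)
      fun τ => CellsFilled i₀ J v N' (σ.rarr a) (τ.rarr a) := by
  refine (forLoop' (T := (N * (K + 15) + 11) + K) (fun t τ => CellsFilled i₀ J v t _ (τ.rarr a)) hr'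
    (by simp [hry, hrx]) (by simp [hyx]) .zero fun t τ ht hτ hyt h => ?_).le (by lia)
  have hmid {τ' : State} (hτ' : (RealRAM.sumLoop x r acc f).Frame τ τ') :
      (RealRAM.sumFillLoop y r' a i j x r acc f g).Frame σ τ' ∧ τ'.nvar y = t ∧
        CellsFilled i₀ J v t (σ.rarr a) (τ'.rarr a) :=
    ⟨hτ.trans hτ' (by simp) (by simp) (by simp), (hτ'.nvar y (by simp [hyx])).trans hyt,
      hτ'.rarr a (by simp [haacc]) ▸ h⟩
  refine seq (sumLoop (u ⟨t, ht⟩) ((hτ.nvar r (by simp [hry', hrx'])).trans hr) hrx' hf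
    fun s τ' hτ' hxs => ?_) fun τ' hτ' hsum => ?_
  · obtain ⟨hfr, hy, h'⟩ := hmid hτ'
    exact hfv ⟨t, ht⟩ s τ' hfr hy hxs h'
  · obtain ⟨hfr, hy, h'⟩ := hmid hτ'
    obtain ⟨hi, hj, hg⟩ := hgv ⟨t, ht⟩ τ' hfr hy h' hsum
    refine (setReal ?_).le hK
    exact h'.succ (t := ⟨t, ht⟩) (fun s hs => hJ s t hs ht) (by simp [hi, hj, hg])

end Runs

/-! ### Memory layout

The numbers of `n`, `m`, `k`, `A` and `w` are those of the input. Row `(r N + i) m + s` of `vecs`,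
where `N` is the value of `size`, belongs to column `s` at the grid point `(r, i)`, and `base` holds
the current `(r N + i) m`. Single numbers are kept in cell `(0, 0)`. Of the natural-number arrays,
`0` is the output and `1` marks the selected columns. -/

namespace Var

abbrev n : ℕ := 0
abbrev m : ℕ := 1
abbrev k : ℕ := 2
abbrev size : ℕ := 3
abbrev round : ℕ := 4
abbrev col : ℕ := 5
abbrev i : ℕ := 6
abbrev r : ℕ := 7
abbrev x : ℕ := 8
abbrev y : ℕ := 9
abbrev base : ℕ := 10
abbrev h : ℕ := 11
abbrev d : ℕ := 12
abbrev step : ℕ := 13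
abbrev choice : ℕ := 14
abbrev found : ℕ := 15
abbrev left : ℕ := 16

end Var

namespace Arr

abbrev A : ℕ := 0
abbrev w : ℕ := 1
abbrev acc : ℕ := 2
abbrev scale : ℕ := 3
abbrev nodes : ℕ := 4
abbrev partialNodes : ℕ := 5
abbrev inv : ℕ := 6
abbrev vecs : ℕ := 7
abbrev det : ℕ := 8
abbrev block : ℕ := 9
abbrev u : ℕ := 10
abbrev v : ℕ := 11
abbrev growth : ℕ := 12
abbrev quot : ℕ := 13
abbrev powers : ℕ := 14
abbrev weights : ℕ := 15
abbrev weightedDets : ℕ := 16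
abbrev means : ℕ := 17
abbrev detR : ℕ := 18
abbrev coeffs : ℕ := 19
abbrev value : ℕ := 20
abbrev best : ℕ := 21

end Arr

open Matrix WeightedRI

/-! ### Rank-one updates of stored solutions -/

section RankOneUpdate

/-- The rows `p + s`, `s < M`, of the array `f` hold the vectors `R⁻¹ b_s`. -/
def RowsSolve {n M : ℕ} (R : Matrix (Fin n) (Fin n) ℝ) (b : Fin M → Fin n → ℝ) (p : ℕ)
    (f : ℕ → ℕ → ℝ) : Prop :=
  ∀ (s : Fin M) (x : Fin n), f (p + s) x = (R⁻¹ *ᵥ b s) x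

/-- The factor `1 + α uᵀ R⁻¹ u` by which the determinant grows in the update of `R` to
`R + α u uᵀ`, where `α` is the value of the variable `al`. -/
@[simp] def growthFactor (al : ℕ) : Cmd :=
  .seq (sumLoop Var.x Var.n Arr.acc
    (.mul (.get Arr.u (.const 0) (.var Var.x)) (.get Arr.v (.const 0) (.var Var.x))))
  (.setReal Arr.growth (.const 0) (.const 0)
    (.add (.ofNat (.const 1)) (.mul (.ofNat (.var al)) (.get Arr.acc (.const 0) (.const 0)))))

/-- Replace the solution `R⁻¹ b` in the row `base + col` of `arr` by `(R + α u uᵀ)⁻¹ b`; the arrays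
`v` and `growth` hold `R⁻¹ u` and `1 + α uᵀ R⁻¹ u`. -/
@[simp] def rankOneStep (arr al : ℕ) : Cmd :=
  .seq (sumLoop Var.x Var.n Arr.acc (.mul (.get Arr.u (.const 0) (.var Var.x))
    (.get arr (.add (.var Var.base) (.var Var.col)) (.var Var.x))))
  (.seq (.setReal Arr.quot (.const 0) (.const 0)
    (.div (.mul (.ofNat (.var al)) (.get Arr.acc (.const 0) (.const 0)))
      (.get Arr.growth (.const 0) (.const 0))))
  (fillLoop Var.x Var.n arr (.add (.var Var.base) (.var Var.col)) (.var Var.x)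
    (.sub (.get arr (.add (.var Var.base) (.var Var.col)) (.var Var.x))
      (.mul (.get Arr.quot (.const 0) (.const 0)) (.get Arr.v (.const 0) (.var Var.x))))))

/-- Replace the solutions `R⁻¹ b_s` in the rows `base + s`, `s < cnt`, of `arr` by
`(R + α u uᵀ)⁻¹ b_s`. -/
@[simp] def rankOneUpdate (arr cnt al : ℕ) : Cmd :=
  .seq (growthFactor al) (forLoop Var.col cnt (rankOneStep arr al))

variable {n : ℕ} {R : Matrix (Fin n) (Fin n) ℝ} {u : Fin n → ℝ} {σ : State}

theorem Runs.growthFactor {al α : ℕ} (hn : σ.nvar Var.n = n) (hal : al ≠ Var.x)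
    (hα : σ.nvar al = α) {u v : Fin n → ℝ} (hu : ∀ x : Fin n, σ.rarr Arr.u 0 x = u x)
    (hv : ∀ x : Fin n, σ.rarr Arr.v 0 x = v x) :
    Runs (growthFactor al) σ (n * 22 + 23) fun τ => τ.rarr Arr.growth 0 0 = 1 + α * (u ⬝ᵥ v) := by
  refine Runs.le (T := (n * (7 + 15) + 11) + 12) ?_ (by lia)
  refine (Runs.sumLoop (fun x => u x * v x) hn (by simp) (by simp) fun x τ hτ hx => ?_).seq
    fun τ hτ hsum => Runs.le (Runs.setReal ?_) (by simp)
  · simp [hτ.rarr, hx, hu, hv]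
  · simp [hτ.nvar, hal, hα, hsum, dotProduct]

theorem Runs.rankOneStep {arr al α p s : ℕ}
    (harr : arr ∉ [Arr.acc, Arr.u, Arr.v, Arr.growth, Arr.quot])
    (hal : al ≠ Var.x) (hn : σ.nvar Var.n = n) (hp : σ.nvar Var.base = p) (hs : σ.nvar Var.col = s)
    (hα : σ.nvar al = α) {u v z : Fin n → ℝ} {d : ℝ} (hu : ∀ x : Fin n, σ.rarr Arr.u 0 x = u x)
    (hv : ∀ x : Fin n, σ.rarr Arr.v 0 x = v x) (hd : σ.rarr Arr.growth 0 0 = d)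
    (hz : ∀ x : Fin n, σ.rarr arr (p + s) x = z x) :
    Runs (rankOneStep arr al) σ (n * 50 + 30) fun τ =>
      CellsFilled (p + s) id (z - (α * (u ⬝ᵥ z) / d) • v) n (σ.rarr arr) (τ.rarr arr) := by
  simp only [List.mem_cons, List.not_mem_nil, or_false, not_or] at harr
  obtain ⟨hacc, _, hav, _, haq⟩ := harr
  refine Runs.le (T := (n * (9 + 15) + 11) + (13 + (n * (18 + 8) + 6))) ?_ (by lia)
  refine (Runs.sumLoop (fun x => u x * z x) hn (by simp) (by simp) fun x τ hτ hx => ?_).seq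
    fun τ hτ hsum => (Runs.le (Runs.setReal
      (Q := fun τ' => τ'.rarr Arr.quot 0 0 = α * (u ⬝ᵥ z) / d ∧ τ'.rarr arr = σ.rarr arr)
      ⟨?_, ?_⟩) ?_).seq fun τ₁ hτ₁ ⟨hq, h⟩ => ?_
  · simp [hτ.rarr, hτ.nvar, hx, hu, hz, hacc, hp, hs]
  · simp [hτ.rarr, hτ.nvar, hsum, hal, hα, hd, dotProduct]
  · funext i j
    simp [hτ.rarr, haq, hacc]
  · simp
  rw [← h]
  refine Runs.fillRow (p + s) _ (by simp [hτ₁.nvar, hτ.nvar, hn]) (by simp) (by simp)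
    fun x τ₂ hτ₂ hx h₂ => ⟨by simp [hτ₂.nvar, hτ₁.nvar, hτ.nvar, hp, hs], ?_⟩
  have hold : τ₂.rarr arr (p + s) x = z x := by
    rw [h₂.eq_of_ne _ _ fun _ t ht => ht.ne', h, hz]
  simp [hτ₂.nvar, hτ₁.nvar, hτ.nvar, hp, hs, hx, hold, hτ₂.rarr, hτ₁.rarr, hτ.rarr, hq, hv,
    Ne.symm haq, Ne.symm hav]

theorem Runs.rankOneUpdate {arr cnt al M p α : ℕ}
    (harr : arr ∉ [Arr.acc, Arr.u, Arr.v, Arr.growth, Arr.quot])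
    (hal : al ∉ [Var.x, Var.col]) (hcnt : cnt ∉ [Var.x, Var.col])
    (hn : σ.nvar Var.n = n) (hM : σ.nvar cnt = M) (hp : σ.nvar Var.base = p)
    (hα : σ.nvar al = α) {b : Fin M → Fin n → ℝ} (hR : R.PosDef)
    (hu : ∀ x : Fin n, σ.rarr Arr.u 0 x = u x)
    (hv : ∀ x : Fin n, σ.rarr Arr.v 0 x = (R⁻¹ *ᵥ u) x) (h : RowsSolve R b p (σ.rarr arr)) :
    Runs (rankOneUpdate arr cnt al) σ (M * (n * 50 + 38) + n * 22 + 29) fun τ =>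
      τ.rarr Arr.growth 0 0 = 1 + α * (u ⬝ᵥ R⁻¹ *ᵥ u) ∧
      RowsSolve (R + (α : ℝ) • vecMulVec u u) b p (τ.rarr arr) ∧
      ∀ i, (∀ s < M, i ≠ p + s) → τ.rarr arr i = σ.rarr arr i := by
  have hacu : arr ≠ Arr.acc ∧ arr ≠ Arr.growth ∧ arr ≠ Arr.u ∧ arr ≠ Arr.v ∧ arr ≠ Arr.quot := by
    simp_all
  simp only [List.mem_cons, List.not_mem_nil, or_false, not_or] at hal hcnt
  refine Runs.le (T := (n * 22 + 23) + (M * ((n * 50 + 30) + 8) + 6)) ?_ (by lia)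
  refine (Runs.growthFactor hn hal.1 hα hu hv).seq fun τ hτ hd => ?_
  have hτarr : τ.rarr arr = σ.rarr arr := hτ.rarr arr (by simp [hacu])
  refine (Runs.forRows (a := arr) (p + ·) (fun s => (R + (α : ℝ) • vecMulVec u u)⁻¹ *ᵥ b s)
    (by lia) (by simp [hτ.nvar, hcnt, hM]) (by simp [hcnt]) (by simp)
    fun s ρ hρ hs hrows => ?_).post fun ρ hρ hrows =>
      ⟨by simp [hρ.rarr, hacu.2.1.symm, hd], fun s x => hrows.eq s s.2 x, fun i hi => ?_⟩
  · rw [inv_add_smul_vecMulVec_mulVec hR u α.cast_nonneg]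
    refine Runs.rankOneStep (by simp_all) hal.1 (by simp [hρ.nvar, hτ.nvar, hn])
      (by simp [hρ.nvar, hτ.nvar, hp]) hs (by simp [hρ.nvar, hτ.nvar, hal, hα])
      (by simp [hρ.rarr, hτ.rarr, hacu.2.2.1.symm, hu])
      (by simp [hρ.rarr, hτ.rarr, hacu.2.2.2.1.symm, hv])
      (by simp [hρ.rarr, hacu.2.1.symm, hd]) fun x => ?_
    rw [hrows.eq_of_ne _ (by lia), hτarr, h s x]
  · rw [hrows.eq_of_ne i hi, hτarr]

end RankOneUpdate

/-! ### Inversion -/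

section Inversion

variable {n m : ℕ} {σ : State}

/-- The rows `p + y`, `y < n`, of the array `inv` hold the columns of `R⁻¹`, and cell `(0, 0)` of
`detR` holds `det R`. -/
structure Inverted (R : Matrix (Fin n) (Fin n) ℝ) (p : ℕ) (τ : State) : Prop where
  inv : RowsSolve R (fun y => Pi.single y 1) p (τ.rarr Arr.inv)
  det : τ.rarr Arr.detR 0 0 = R.det

/-- Store the inverse and the determinant of the identity matrix. -/
@[simp] def loadIdentity : Cmd :=
  .seq (forLoop Var.y Var.n (.seq
    (fillLoop Var.x Var.n Arr.inv (.add (.var Var.base) (.var Var.y)) (.var Var.x)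
      (.ofNat (.const 0)))
    (.setReal Arr.inv (.add (.var Var.base) (.var Var.y)) (.var Var.y) (.ofNat (.const 1)))))
  (.setReal Arr.detR (.const 0) (.const 0) (.ofNat (.const 1)))

/-- Load the column `a` of `A` with index `step` into `u`, and `R⁻¹ a` into `v`. -/
@[simp] def loadColumn : Cmd :=
  .seq (fillLoop Var.x Var.n Arr.u (.const 0) (.var Var.x)
    (.get Arr.A (.var Var.x) (.var Var.step)))
  (sumFillLoop Var.y Var.n Arr.v (.const 0) (.var Var.y) Var.x Var.n Arr.acc
    (.mul (.get Arr.inv (.add (.var Var.base) (.var Var.y)) (.var Var.x))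
      (.get Arr.u (.const 0) (.var Var.x)))
    (.get Arr.acc (.const 0) (.const 0)))

/-- Pass from `R` to `R + r a aᵀ`, where `a` is the column of `A` with index `step`. -/
@[simp] def addColumn : Cmd :=
  .seq loadColumn
  (.seq (rankOneUpdate Arr.inv Var.n Var.r)
  (.setReal Arr.detR (.const 0) (.const 0)
    (.mul (.get Arr.detR (.const 0) (.const 0)) (.get Arr.growth (.const 0) (.const 0)))))

/-- Store the inverse and the determinant of `1 + r A Aᵀ`. -/
@[simp] def invert : Cmd := .seq loadIdentity (forLoop Var.step Var.m addColumn)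

theorem Runs.loadIdentity {p : ℕ} (hn : σ.nvar Var.n = n) (hp : σ.nvar Var.base = p) :
    Runs loadIdentity σ (n * (n * 15 + 21) + 11) (Inverted (1 : Matrix (Fin n) (Fin n) ℝ) p) := by
  refine Runs.le (T := (n * (((n * (7 + 8) + 6) + 7) + 8) + 6) + 5) ?_ (by lia)
  refine (Runs.forRows (a := Arr.inv) (T := (n * (7 + 8) + 6) + 7) (p + ·)
    (fun y : Fin n => Pi.single y 1) (by lia) hn (by simp) (by simp) fun y τ hτ hy _ => ?_).seq
      fun τ _ h => Runs.le (Runs.setReal ?_) (by simp)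
  · refine (Runs.fillRow (p + y) (0 : Fin n → ℝ) (by simp [hτ.nvar, hn]) (by simp) (by simp)
      fun x τ' hτ' _ _ => ?_).seq fun τ₁ hτ₁ h₁ => Runs.le (Runs.setReal ?_) (by simp)
    · simp [hτ'.nvar, hτ.nvar, hp, hy]
    have hbase : τ₁.nvar Var.base = p := by simp [hτ₁.nvar, hτ.nvar, hp]
    have hy₁ : τ₁.nvar Var.y = y := by simp [hτ₁.nvar, hy]
    refine ⟨fun x hx => ?_, fun i j hij => ?_⟩
    · have := h₁.eq x hx
      simp_all [Pi.single_apply, Fin.ext_iff]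
    · simpa [hbase, hy₁, if_neg fun h : i = p + y ∧ j = y => hij h.1 y y.2 h.2] using
        h₁.eq_of_ne i j hij
  · exact ⟨fun y x => by simpa [Matrix.one_apply, Pi.single_apply] using h.eq y y.2 x, by simp⟩

section

variable {R : Matrix (Fin n) (Fin n) ℝ} {p s : ℕ} {a : Fin n → ℝ}

theorem Runs.loadColumn (hn : σ.nvar Var.n = n) (hp : σ.nvar Var.base = p)
    (hs : σ.nvar Var.step = s) (ha : ∀ x : Fin n, σ.rarr Arr.A x s = a x) (hR : R.PosDef)
    (h : Inverted R p σ) :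
    Runs loadColumn σ (n * (n * 24 + 42) + 12) fun τ =>
      (∀ x : Fin n, τ.rarr Arr.u 0 x = a x) ∧ ∀ x : Fin n, τ.rarr Arr.v 0 x = (R⁻¹ *ᵥ a) x := by
  refine Runs.le (T := (n * (6 + 8) + 6) + (n * (n * (9 + 15) + 9 + 19) + 6)) ?_ (by lia)
  refine (Runs.fillRow 0 a hn (by simp) (by simp) fun x τ hτ hx _ => ?_).seq fun τ hτ hu =>
    (Runs.sumFillLoop 0 id (fun y x => (R⁻¹ *ᵥ Pi.single y 1) x * a x) (R⁻¹ *ᵥ a)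
      (fun _ _ h _ => h.ne) (by simp [hτ.nvar, hn]) (by simp [hτ.nvar, hn]) (by simp) (by simp)
      (by simp) (by simp) (by simp) (by simp) (by simp) (by simp)
      (fun y x ρ hρ hy hx _ => ?_) fun y ρ _ hy _ hsum => ?_).post fun τ₁ hτ₁ hv =>
    ⟨fun x => ?_, fun x => hv.eq x x.2⟩
  · simp [hτ.nvar, hτ.rarr, hs, hx, ha]
  · have hx' := hu.eq x x.2
    simp_all [hρ.nvar, hρ.rarr, hτ.nvar, hτ.rarr, h.inv y x]
  · have hya : ∑ x, (R⁻¹ *ᵥ Pi.single y 1) x * a x = (R⁻¹ *ᵥ a) y :=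
      (inv_mulVec_dotProduct hR _ a).trans (single_one_dotProduct y _)
    exact ⟨rfl, hy, hsum.trans hya⟩
  · simpa [hτ₁.rarr] using hu.eq x x.2

theorem Runs.addColumn {r : ℕ} (hn : σ.nvar Var.n = n) (hp : σ.nvar Var.base = p)
    (hr : σ.nvar Var.r = r) (hs : σ.nvar Var.step = s)
    (ha : ∀ x : Fin n, σ.rarr Arr.A x s = a x) (hR : R.PosDef) (h : Inverted R p σ) :
    Runs addColumn σ (n * (n * 74 + 102) + 51) (Inverted (R + (r : ℝ) • vecMulVec a a) p) := by
  refine Runs.le (T := (n * (n * 24 + 42) + 12) + ((n * (n * 50 + 38) + n * 22 + 29) + 10)) ?_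
    (by lia)
  refine (Runs.loadColumn hn hp hs ha hR h).seq fun τ hτ ⟨hu, hv⟩ =>
    (Runs.rankOneUpdate (by simp) (by simp) (by simp) (by simp [hτ.nvar, hn])
      (by simp [hτ.nvar, hn]) (by simp [hτ.nvar, hp]) (by simp [hτ.nvar, hr]) hR hu hv ?_).seq
    fun τ₁ hτ₁ ⟨hg, hinv, _⟩ => Runs.le (Runs.setReal ⟨hinv, ?_⟩) (by simp)
  · simpa [hτ.rarr] using h.inv
  · simp [hg, hτ₁.rarr, hτ.rarr, h.det, det_add_smul_vecMulVec hR]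

end

theorem Runs.invert {p r : ℕ} (hn : σ.nvar Var.n = n) (hm : σ.nvar Var.m = m)
    (hp : σ.nvar Var.base = p) (hr : σ.nvar Var.r = r) {A : Matrix (Fin n) (Fin m) ℝ}
    (hA : σ.rarr Arr.A = cell A) :
    Runs invert σ (n * (n * 15 + 21) + m * (n * (n * 74 + 102) + 59) + 17)
      (Inverted (1 + (r : ℝ) • ∑ s, vecMulVec (A.col s) (A.col s)) p) := by
  let G (t : ℕ) := ∑ s : Fin m with s.1 < t, vecMulVec (A.col s) (A.col s)
  have hG (t : ℕ) : (G t).PosSemidef := posSemidef_sum _ fun s _ => by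
    simpa using posSemidef_vecMulVec_self_star (A.col s)
  have hsucc (t : Fin m) : 1 + (r : ℝ) • G (t + 1) =
      1 + (r : ℝ) • G t + (r : ℝ) • vecMulVec (A.col t) (A.col t) := by
    have : (Finset.univ.filter fun s : Fin m => s.1 < t + 1) =
        insert t (Finset.univ.filter fun s : Fin m => s.1 < t) := by ext s; simp [Fin.ext_iff]; lia
    simp only [G, this]
    rw [Finset.sum_insert (by simp), add_comm (vecMulVec _ _), smul_add, add_assoc]
  refine Runs.le (T := (n * (n * 15 + 21) + 11) + (m * (n * (n * 74 + 102) + 51 + 8) + 6)) ?_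
    (by lia)
  refine (Runs.loadIdentity hn hp).seq fun τ hτ h =>
    (Runs.forLoop' (fun t => Inverted (1 + (r : ℝ) • G t) p) (by simp [hτ.nvar, hm]) (by simp)
      (by simp) (by simpa [G] using h) ?_ ?_).post fun ρ _ hρ => by simpa [G] using hρ
  · intro t ρ ht hρ hs hρt
    simp only [hsucc ⟨t, ht⟩]
    exact Runs.addColumn (by simp [hρ.nvar, hτ.nvar, hn]) (by simp [hρ.nvar, hτ.nvar, hp])
      (by simp [hρ.nvar, hτ.nvar, hr]) hs (by simp [hρ.rarr, hτ.rarr, hA, cell, ht])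
      (posDef_one_add_smul (hG t) r.cast_nonneg) hρt
  · exact fun _ _ _ h => ⟨h.1, h.2⟩

end Inversion

/-! ### Interpolation weights -/

section Weights

/-- Row `h` of `partialNodes` holds the coefficients of `X * nodeBasis h i`; the factor `X` makes
room for the coefficient with index `-1` in the recursion. -/
def NodeRow (N i h : ℕ) (τ : State) : Prop :=
  ∀ d ≤ N, τ.rarr Arr.partialNodes h d = (X * nodeBasis h i).coeff d

/-- Row `0` of `partialNodes` represents the constant polynomial `1`. -/
@[simp] def firstNodeRow : Cmd :=
  .seq (fillLoop Var.d Var.size Arr.partialNodes (.const 0) (.add (.var Var.d) (.const 1))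
    (.ofNat (.const 0)))
  (.seq (.setReal Arr.partialNodes (.const 0) (.const 0) (.ofNat (.const 0)))
  (.setReal Arr.partialNodes (.const 0) (.const 1) (.ofNat (.const 1))))

/-- Store `f` as the coefficient with index `d` in row `h + 1` of `partialNodes`, for all `d`. -/
@[simp] def extendNodeRow (f : RExp) : Cmd :=
  fillLoop Var.d Var.size Arr.partialNodes (.add (.var Var.h) (.const 1))
    (.add (.var Var.d) (.const 1)) f

/-- Multiply the polynomial in row `h` of `partialNodes` by `(X + h) / (h - i)`, or by `1`
if `h = i`. -/
@[simp] def nextNodeRow : Cmd :=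
  .seq (.ite
    (.and (.not (.natLt (.var Var.h) (.var Var.i))) (.not (.natLt (.var Var.i) (.var Var.h))))
    (extendNodeRow (.get Arr.partialNodes (.var Var.h) (.add (.var Var.d) (.const 1))))
    (extendNodeRow (.div (.add (.get Arr.partialNodes (.var Var.h) (.var Var.d))
      (.mul (.ofNat (.var Var.h))
        (.get Arr.partialNodes (.var Var.h) (.add (.var Var.d) (.const 1)))))
      (.sub (.ofNat (.var Var.h)) (.ofNat (.var Var.i))))))
  (.setReal Arr.partialNodes (.add (.var Var.h) (.const 1)) (.const 0) (.ofNat (.const 0)))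

/-- Store the coefficients of the Lagrange basis polynomials of all nodes `-i`. -/
@[simp] def nodeTable : Cmd :=
  forLoop Var.i Var.size (.seq (.seq firstNodeRow (forLoop Var.h Var.size nextNodeRow))
    (fillLoop Var.d Var.size Arr.nodes (.var Var.i) (.var Var.d)
      (.get Arr.partialNodes (.var Var.size) (.add (.var Var.d) (.const 1)))))

variable {N i h : ℕ} {σ : State}

theorem Runs.firstNodeRow (hN : σ.nvar Var.size = N) :
    Runs firstNodeRow σ (N * 16 + 16) (NodeRow N i 0) := by
  refine Runs.le (T := (N * (8 + 8) + 6) + (5 + 5)) ?_ (by lia)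
  refine (Runs.fillLoop 0 (· + 1) (fun _ => 0) (by lia) hN (by simp) (by simp)
    (by simp +contextual)).seq
    fun τ _ hfill => Runs.seq ((Runs.setReal (Q := (· = τ.setReal Arr.partialNodes 0 0 0))
      (by simp)).le (by simp)) fun _ _ hτ => (Runs.setReal fun d hd => ?_).le (by simp)
  rcases d with - | d
  · simp [hτ]
  · have := hfill.eq ⟨d, hd⟩ hd
    simp_all [nodeBasis_zero, coeff_X]

theorem Runs.extendNodeRow {f : RExp} (hf : f.cost ≤ 18) (hN : σ.nvar Var.size = N)
    (hh : σ.nvar Var.h = h) (hrow : NodeRow N i h σ)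
    (hnext : ∀ d τ, d < N → τ.nvar Var.d = d → (extendNodeRow f).Frame σ τ → NodeRow N i h τ →
      f.eval τ = (nodeBasis (h + 1) i).coeff d) :
    Runs (extendNodeRow f) σ (N * 33 + 6) fun τ =>
      ∀ d < N, τ.rarr Arr.partialNodes (h + 1) (d + 1) = (nodeBasis (h + 1) i).coeff d := by
  refine ((Runs.fillLoop (K := 25) (N := N) (h + 1) (· + 1)
    (fun d => (nodeBasis (h + 1) i).coeff d) (by lia) hN (by simp) (by simp; lia)
    fun d τ hτ hd hfill => ?_).post fun τ _ h d hd => h.eq ⟨d, hd⟩ hd).le (by lia)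
  refine ⟨by simp [hτ.nvar, hh], by simp [hd], hnext d τ d.2 hd hτ fun e he => ?_⟩
  rw [hfill.row_eq (by lia), hrow e he]

theorem Runs.nextNodeRow (hN : σ.nvar Var.size = N) (hi : σ.nvar Var.i = i)
    (hh : σ.nvar Var.h = h) (hrow : NodeRow N i h σ) :
    Runs nextNodeRow σ (N * 33 + 23) (NodeRow N i (h + 1)) := by
  refine Runs.le (T := (9 + (N * 33 + 6) + 1) + 7) ?_ (by lia)
  refine Runs.seq (Q := fun τ => ∀ d < N, τ.rarr Arr.partialNodes (h + 1) (d + 1) =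
    (nodeBasis (h + 1) i).coeff d) (Runs.ite (fun hb => ?_) fun hb => ?_)
    fun τ hτ hnext => (Runs.setReal fun d hd => ?_).le (by simp)
  · obtain rfl : h = i := by simp_all; lia
    refine Runs.extendNodeRow (by simp) hN hh hrow fun d τ hd hτd hτ hrow' => ?_
    have := hrow' (d + 1) hd
    simp_all [hτ.nvar, nodeBasis_succ_self]
  · have hne : h ≠ i := by rintro rfl; simp_all
    refine Runs.extendNodeRow (by simp) hN hh hrow fun d τ hd hτd hτ hrow' => ?_
    have := hrow' (d + 1) hd
    have := hrow' d hd.le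
    simp_all [hτ.nvar, coeff_nodeBasis_succ hne]
  · rcases d with - | d
    · simp [hτ.nvar, hh]
    · simp [hτ.nvar, hh, hnext d hd]

theorem Runs.nodeTable (hN : σ.nvar Var.size = N) :
    Runs nodeTable σ (N * (N * (N * 33 + 63) + 36) + 6) fun τ =>
      ∀ i < N, ∀ d < N, τ.rarr Arr.nodes i d = (nodeBasis N i).coeff d := by
  refine ((Runs.forRows (a := Arr.nodes)
    (T := ((N * 16 + 16) + (N * ((N * 33 + 23) + 8) + 6)) + (N * (8 + 8) + 6)) id
    (fun i d : Fin N => (nodeBasis N i).coeff d) (fun _ _ h _ => h.ne) hN (by simp) (by simp)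
    fun i τ hτ hi _ => ?_).post fun τ _ h i hi d hd => h.eq ⟨i, hi⟩ hi ⟨d, hd⟩).le (by lia)
  have hNτ : τ.nvar Var.size = N := by simp [hτ.nvar, hN]
  refine Runs.seq (Q := NodeRow N i N) ((Runs.firstNodeRow hNτ).seq fun τ₀ hτ₀ h₀ =>
    Runs.forLoop' (NodeRow N i) (by simp [hτ₀.nvar, hNτ]) (by simp) (by simp) h₀
      fun h ρ _ hρ hh hrow => Runs.nextNodeRow (by simp [hρ.nvar, hτ₀.nvar, hNτ])
        (by simp [hρ.nvar, hτ₀.nvar, hi]) hh hrow) fun ρ hρ hrow => ?_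
  rw [← hρ.rarr Arr.nodes (by simp)]
  refine Runs.fillRow i _ (by simp [hρ.nvar, hNτ]) (by simp) (by simp) fun d ρ' hρ' hd _ => ?_
  have := hrow (d + 1) d.2
  simp_all [hρ.nvar, hρ'.nvar, hρ'.rarr]

/-- Compute the side length `n + 1` of the grid and the common value `1 / ‖W⁻¹‖²` of `p_s w_s²`. -/
@[simp] def constants : Cmd :=
  .seq (.setVar Var.size (.add (.var Var.n) (.const 1)))
  (.seq (sumLoop Var.col Var.m Arr.acc (.div (.ofNat (.const 1))
    (.mul (.get Arr.w (.const 0) (.var Var.col)) (.get Arr.w (.const 0) (.var Var.col)))))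
  (.setReal Arr.scale (.const 0) (.const 0)
    (.div (.ofNat (.const 1)) (.get Arr.acc (.const 0) (.const 0)))))

theorem Runs.constants {n m : ℕ} {w : Fin m → ℝ} (hn : σ.nvar Var.n = n)
    (hm : σ.nvar Var.m = m) (hw : ∀ s : Fin m, σ.rarr Arr.w 0 s = w s) :
    Runs constants σ (m * 25 + 24) fun τ =>
      τ.nvar Var.size = n + 1 ∧ τ.rarr Arr.scale 0 0 = (∑ s, (w s ^ 2)⁻¹)⁻¹ := by
  refine Runs.le (T := 4 + ((m * (10 + 15) + 11) + 9)) ?_ (by lia)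
  refine Runs.seq (Q := fun τ => τ.nvar Var.size = n + 1) ((Runs.setVar (by simp [hn])).le
    (by simp)) fun τ hτ hsize => ?_
  refine (Runs.sumLoop (fun s => (w s ^ 2)⁻¹) (by simp [hτ.nvar, hm]) (by simp) (by simp)
    fun s ρ hρ hs => ?_).seq fun ρ hρ hsum => (Runs.setReal ⟨?_, ?_⟩).le (by simp)
  · simp [hρ.rarr, hτ.rarr, hs, hw, pow_two]
  · simp [hρ.nvar, hsize]
  · simp [hsum]

/-- Store `(q)_d (-i c)^d`, `d ≤ N`, where `(q)_d` is the falling factorial and `q` the value of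
the variable `left`. -/
@[simp] def powerRow : Cmd :=
  .seq (.setReal Arr.powers (.const 0) (.const 0) (.ofNat (.const 1)))
  (fillLoop Var.d Var.size Arr.powers (.const 0) (.add (.var Var.d) (.const 1))
    (.mul (.mul (.get Arr.powers (.const 0) (.var Var.d))
        (.ofNat (.sub (.var Var.left) (.var Var.d))))
      (.mul (.sub (.ofNat (.const 0)) (.ofNat (.var Var.i)))
        (.get Arr.scale (.const 0) (.const 0)))))

/-- Store the interpolation weights of all grid points. -/
@[simp] def weightTable : Cmd :=
  forLoop Var.i Var.size (.seq powerRow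
    (sumFillLoop Var.r Var.size Arr.weights (.var Var.i) (.var Var.r) Var.d Var.size Arr.acc
      (.mul (.get Arr.powers (.const 0) (.var Var.d)) (.get Arr.nodes (.var Var.r) (.var Var.d)))
      (.get Arr.acc (.const 0) (.const 0))))

section

variable {q : ℕ} {c : ℝ}

theorem Runs.powerRow (hN : σ.nvar Var.size = N) (hq : σ.nvar Var.left = q)
    (hi : σ.nvar Var.i = i) (hc : σ.rarr Arr.scale 0 0 = c) :
    Runs powerRow σ (N * 31 + 11) fun τ =>
      ∀ d ≤ N, τ.rarr Arr.powers 0 d = q.descFactorial d * (-i * c) ^ d := by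
  refine Runs.le (T := 5 + (N * (23 + 8) + 6)) ?_ (by lia)
  refine Runs.seq (Q := fun τ => τ.rarr Arr.powers 0 0 = 1) ((Runs.setReal (by simp)).le (by simp))
    fun τ hτ h₀ => (Runs.fillLoop 0 (· + 1)
      (fun d : Fin N => (q.descFactorial (d + 1) : ℝ) * (-i * c) ^ (d + 1 : ℕ)) (by lia)
      (by simp [hτ.nvar, hN]) (by simp) (by simp) fun d ρ hρ hd hfill => ?_).post
    fun ρ _ hfill d hd => ?_
  · have hprev : ρ.rarr Arr.powers 0 d = q.descFactorial d * (-i * c) ^ (d : ℕ) := by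
      obtain ⟨d, hd⟩ := d
      rcases d with - | d
      · simp [hfill.eq_of_ne, h₀]
      · exact hfill.eq ⟨d, by lia⟩ d.lt_succ_self
    refine ⟨rfl, by simp [hd], ?_⟩
    simp [hd, hprev, hρ.nvar, hτ.nvar, hρ.rarr, hτ.rarr, hq, hi, hc, Nat.descFactorial_succ,
      pow_succ]
    ring
  · rcases d with - | d
    · simp [hfill.eq_of_ne, h₀]
    · exact hfill.eq ⟨d, hd⟩ hd

theorem Runs.weightTable (hN : σ.nvar Var.size = N) (hq : σ.nvar Var.left = q)
    (hc : σ.rarr Arr.scale 0 0 = c)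
    (hnodes : ∀ i < N, ∀ d < N, σ.rarr Arr.nodes i d = (nodeBasis N i).coeff d) :
    Runs weightTable σ (N * (N * (N * 22 + 57) + 25) + 6) fun τ =>
      ∀ i < N, ∀ r < N, τ.rarr Arr.weights i r = gridWeight N q c i r := by
  refine ((Runs.forRows (a := Arr.weights)
    (T := (N * 31 + 11) + (N * (N * (7 + 15) + 7 + 19) + 6)) id
    (fun i r : Fin N => gridWeight N q c i r) (fun _ _ h _ => h.ne) hN (by simp) (by simp)
    fun i τ hτ hi _ => ?_).post fun τ _ h i hi r hr => h.eq ⟨i, hi⟩ hi ⟨r, hr⟩).le (by lia)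
  have hNτ : τ.nvar Var.size = N := by simp [hτ.nvar, hN]
  refine (Runs.powerRow (q := q) (c := c) hNτ (by simp [hτ.nvar, hq]) hi
    (by simp [hτ.rarr, hc])).seq fun ρ hρ hpow => ?_
  rw [← hρ.rarr Arr.weights (by simp)]
  refine Runs.sumFillLoop i id
    (fun r d => q.descFactorial d * (-i * c) ^ (d : ℕ) * (nodeBasis N r).coeff d) _
    (fun _ _ h _ => h.ne) (by simp [hρ.nvar, hNτ]) (by simp [hρ.nvar, hNτ]) (by simp) (by simp)
    (by simp) (by simp) (by simp) (by simp) (by simp) (by simp)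
    (fun r d τ' hτ' hr hd _ => ?_) fun r τ' hτ' hr _ hsum => ?_
  · have := hpow d d.2.le
    have := hnodes r r.2 d d.2
    simp_all [hτ'.rarr, hρ.rarr, hτ.rarr]
  · simp [hτ'.nvar, hρ.nvar, hi, hr, hsum, gridWeight]

end

end Weights

/-! ### The grid of determinants -/

section Grid

theorem mul_add_inj {N a b i j : ℕ} (hi : i < N) (hj : j < N) (h : a * N + i = b * N + j) :
    a = b ∧ i = j := by
  have hij : i = j := by simpa [Nat.mod_eq_of_lt, hi, hj] using congrArg (· % N) h
  subst hij
  exact ⟨Nat.eq_of_mul_eq_mul_right (by lia) (Nat.add_right_cancel h), rfl⟩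

/-- Run `c` at all points `(r, i)` of one row of the grid. -/
@[simp] def gridRow (c : Cmd) : Cmd :=
  forLoop Var.i Var.size (.seq c (.setVar Var.base (.add (.var Var.base) (.var Var.m))))

theorem mul_add_lt_mul_of_lt {N a b i : ℕ} (hi : i < N) (h : a < b) : a * N + i < b * N :=
  calc a * N + i < (a + 1) * N := by lia
    _ ≤ b * N := Nat.mul_le_mul_right _ h

/-- Run `c` at all points `(r, i)` of the square grid of side `size`, and `c₀` at the start of each
row; at the `e`-th point the variable `base` holds `e m`. -/
@[simp] def gridLoop (c₀ c : Cmd) : Cmd :=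
  .seq (.setVar Var.base (.const 0)) (forLoop Var.r Var.size (.seq c₀ (gridRow c)))

/-- The loop variables stand at `(r, i)`, and `base` is the first of the `m` rows of `vecs` that
belong to this point. -/
structure AtGridPoint (N m r i : ℕ) (τ : State) : Prop where
  r_eq : τ.nvar Var.r = r
  i_eq : τ.nvar Var.i = i
  base_eq : τ.nvar Var.base = (r * N + i) * m

/-- The first `e` points of the grid satisfy `G`, the others satisfy `D`. -/
def GridDone (N : ℕ) (D G : ℕ → ℕ → (ℕ → ℕ → ℕ → ℝ) → Prop) (e : ℕ) (f : ℕ → ℕ → ℕ → ℝ) : Prop :=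
  ∀ r < N, ∀ i < N, if r * N + i < e then G r i f else D r i f

/-- Passing from `f` to `g` preserves whether the point `(r, i)` is untreated (`D`) or
treated (`G`). -/
def KeepsPoint (D G : ℕ → ℕ → (ℕ → ℕ → ℕ → ℝ) → Prop) (f g : ℕ → ℕ → ℕ → ℝ) (r i : ℕ) : Prop :=
  (D r i f → D r i g) ∧ (G r i f → G r i g)

variable {N m T T₀ : ℕ} {σ : State}

namespace GridDone

variable {D G : ℕ → ℕ → (ℕ → ℕ → ℕ → ℝ) → Prop} {e : ℕ} {f g : ℕ → ℕ → ℕ → ℝ}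

theorem keep (h : GridDone N D G e f) (hfg : ∀ r i, i < N → KeepsPoint D G f g r i) :
    GridDone N D G e g := fun r hr i hi => by
  have := h r hr i hi
  split_ifs at this ⊢
  exacts [(hfg r i hi).2 this, (hfg r i hi).1 this]

theorem succ {r i : ℕ} (h : GridDone N D G (r * N + i) f) (hi : i < N) (hG : G r i g)
    (hfg : ∀ r' i', i' < N → ¬ (r' = r ∧ i' = i) → KeepsPoint D G f g r' i') :
    GridDone N D G (r * N + i + 1) g := fun r' hr' i' hi' => by
  by_cases heq : r' = r ∧ i' = i
  · simpa [heq.1, heq.2] using hG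
  have hne : r' * N + i' ≠ r * N + i := fun h => heq (mul_add_inj hi' hi h)
  have := h r' hr' i' hi'
  simp only [Nat.lt_succ_iff_lt_or_eq, hne, or_false]
  split_ifs at this ⊢
  exacts [(hfg r' i' hi' heq).2 this, (hfg r' i' hi' heq).1 this]

end GridDone

section

variable {c₀ c : Cmd} (B : ℕ → (ℕ → ℕ → ℕ → ℝ) → Prop) (D G : ℕ → ℕ → (ℕ → ℕ → ℕ → ℝ) → Prop)

theorem Runs.gridRow {r : ℕ} (hr : r < N) (hN : σ.nvar Var.size = N) (hm : σ.nvar Var.m = m)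
    (hrσ : σ.nvar Var.r = r) (hb : σ.nvar Var.base = r * N * m)
    (hc : ∀ x ∈ [Var.size, Var.m, Var.r, Var.i, Var.base], x ∉ c.vars)
    (hB : B r σ.rarr) (hD : GridDone N D G (r * N) σ.rarr)
    (hstep : ∀ i τ, i < N → (gridRow c).Frame σ τ → AtGridPoint N m r i τ →
      B r τ.rarr → D r i τ.rarr → Runs c τ T fun τ' => B r τ'.rarr ∧ G r i τ'.rarr ∧
        ∀ r' i', i' < N → ¬ (r' = r ∧ i' = i) → KeepsPoint D G τ.rarr τ'.rarr r' i') :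
    Runs (gridRow c) σ (N * (T + 12) + 6) fun τ =>
      GridDone N D G ((r + 1) * N) τ.rarr ∧ τ.nvar Var.base = (r + 1) * N * m := by
  refine Runs.le (T := N * ((T + 4) + 8) + 6) ?_ (by lia)
  simp only [List.forall_mem_cons] at hc
  refine (Runs.forLoop' (fun i τ => B r τ.rarr ∧ GridDone N D G (r * N + i) τ.rarr ∧
    τ.nvar Var.base = (r * N + i) * m) hN (by simp [hc]) (by simp [hc]) ⟨hB, hD, hb⟩
    fun i τ hi hτ hiτ ⟨hB, hdone, hbτ⟩ => ?_).post fun τ _ h => by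
      rw [add_mul, one_mul]; exact h.2
  have hDi : D r i τ.rarr := by simpa using hdone r hr i hi
  refine (hstep i τ hi hτ ⟨by simp [hτ.nvar, hc, hrσ], hiτ, hbτ⟩ hB hDi).seq
    fun τ' hτ' ⟨hB', hG, hkeep⟩ => (Runs.setVar ⟨hB', hdone.succ hi hG hkeep, ?_⟩).le (by simp)
  simp [hτ'.nvar, hτ.nvar, hc, hbτ, hm]
  ring

theorem Runs.gridLoop (hN : σ.nvar Var.size = N) (hm : σ.nvar Var.m = m)
    (hc₀ : ∀ x ∈ [Var.size, Var.m, Var.r, Var.base], x ∉ c₀.vars)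
    (hc : ∀ x ∈ [Var.size, Var.m, Var.r, Var.i, Var.base], x ∉ c.vars)
    (hD : ∀ r < N, ∀ i < N, D r i σ.rarr)
    (hrow : ∀ r τ, r < N → (gridLoop c₀ c).Frame σ τ → τ.nvar Var.r = r →
      τ.nvar Var.base = r * N * m → Runs c₀ τ T₀ fun τ' => B r τ'.rarr ∧
        ∀ r' i', i' < N → KeepsPoint D G τ.rarr τ'.rarr r' i')
    (hstep : ∀ r i τ, r < N → i < N → (gridLoop c₀ c).Frame σ τ → AtGridPoint N m r i τ →
      B r τ.rarr → D r i τ.rarr → Runs c τ T fun τ' => B r τ'.rarr ∧ G r i τ'.rarr ∧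
        ∀ r' i', i' < N → ¬ (r' = r ∧ i' = i) → KeepsPoint D G τ.rarr τ'.rarr r' i') :
    Runs (gridLoop c₀ c) σ (N * (T₀ + N * (T + 12) + 14) + 8)
      fun τ => ∀ r < N, ∀ i < N, G r i τ.rarr := by
  refine Runs.le (T := 2 + (N * ((T₀ + (N * (T + 12) + 6)) + 8) + 6)) ?_ (by lia)
  simp only [List.forall_mem_cons] at hc hc₀
  refine Runs.seq (Q := fun τ => τ.nvar Var.base = 0 ∧ τ.rarr = σ.rarr) ((Runs.setVar (by simp)).le
    (by simp)) fun τ hτ ⟨hb, hσ⟩ => ?_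
  refine (Runs.forLoop' (fun r τ => GridDone N D G (r * N) τ.rarr ∧ τ.nvar Var.base = r * N * m)
    (by simp [hτ.nvar, hN]) (by simp [hc, hc₀]) (by simp [hc, hc₀])
    ⟨fun r hr i hi => by simpa [hσ] using hD r hr i hi, by simp [hb]⟩
    fun r ρ hr hρ hrρ ⟨hdone, hbρ⟩ => ?_).post
    fun ρ _ h r hr i hi => by simpa [mul_add_lt_mul_of_lt hi hr] using h.1 r hr i hi
  have hσρ : (RealRAM.gridLoop c₀ c).Frame σ ρ := hτ.trans hρ (by simp) (by simp) (by simp)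
  refine (hrow r ρ hr hσρ hrρ hbρ).seq fun ρ₁ hρ₁ ⟨hB, hkeep⟩ => ?_
  have hσρ₁ : (RealRAM.gridLoop c₀ c).Frame σ ρ₁ :=
    hσρ.trans hρ₁ (by simp [List.subset_def]; tauto) (by simp) (by simp)
  refine Runs.gridRow B D G hr (by simp [hσρ₁.nvar, hN, hc, hc₀])
    (by simp [hσρ₁.nvar, hm, hc, hc₀]) (by simp [hρ₁.nvar, hrρ, hc₀])
    (by simp [hρ₁.nvar, hbρ, hc₀]) (by simpa using hc) hB
    (hdone.keep hkeep) fun i ρ₂ hi hρ₂ => hstep r i ρ₂ hr hi ?_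
  exact hσρ₁.trans hρ₂ (by simp [List.subset_def]; tauto) (by simp) (by simp)

end

variable {n : ℕ}

/-- The matrix `1 + i M + r A Aᵀ` of the grid point `(r, i)`, where `M` is the sum of the weighted
rank-one matrices of the columns in `l`. -/
def gridMatrix (A : Matrix (Fin n) (Fin m) ℝ) (w : Fin m → ℝ) (l : List (Fin m)) (r i : ℕ) :
    Matrix (Fin n) (Fin n) ℝ :=
  1 + (i : ℝ) • outerSum A w l + (r : ℝ) • ∑ s, vecMulVec (A.col s) (A.col s)

/-- What the arrays `vecs` and `det` hold for the matrix `R` of the grid point `(r, i)`. -/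
structure GridAt (A : Matrix (Fin n) (Fin m) ℝ) (N r i : ℕ) (R : Matrix (Fin n) (Fin n) ℝ)
    (f : ℕ → ℕ → ℕ → ℝ) : Prop where
  vecs : RowsSolve R A.col ((r * N + i) * m) (f Arr.vecs)
  det : f Arr.det r i = R.det

theorem posDef_gridMatrix (A : Matrix (Fin n) (Fin m) ℝ) (w : Fin m → ℝ) (l : List (Fin m))
    (r i : ℕ) : (gridMatrix A w l r i).PosDef :=
  (posDef_one_add_smul (posSemidef_outerSum A w l) i.cast_nonneg).add_posSemidef
    ((posSemidef_sum _ fun s _ => by simpa using posSemidef_vecMulVec_self_star (A.col s)).smul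
      r.cast_nonneg)

/-- Changes in the rows of `vecs` and the cell of `det` that belong to the grid point `(r, i)` do
not affect the other grid points. -/
theorem GridAt.congr {A : Matrix (Fin n) (Fin m) ℝ} {R : Matrix (Fin n) (Fin n) ℝ}
    {r i r' i' : ℕ} {f g : ℕ → ℕ → ℕ → ℝ} (hi : i < N) (hi' : i' < N) (h : ¬ (r' = r ∧ i' = i))
    (hvecs : ∀ j, (∀ s < m, j ≠ (r * N + i) * m + s) → g Arr.vecs j = f Arr.vecs j)
    (hdet : ∀ a b, ¬ (a = r ∧ b = i) → g Arr.det a b = f Arr.det a b)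
    (hR : GridAt A N r' i' R f) : GridAt A N r' i' R g where
  vecs s x := by
    rw [hvecs _ fun t ht heq => h (mul_add_inj hi' hi (mul_add_inj s.2 ht heq).1), hR.vecs]
  det := by rw [hdet _ _ h, hR.det]

/-- Store the solutions `R⁻¹ a_s` for all columns `a_s` of `A` in `block`. -/
@[simp] def solveColumns : Cmd :=
  forLoop Var.col Var.m (sumFillLoop Var.y Var.n Arr.block (.var Var.col) (.var Var.y)
    Var.x Var.n Arr.acc
    (.mul (.get Arr.inv (.add (.var Var.base) (.var Var.y)) (.var Var.x))
      (.get Arr.A (.var Var.x) (.var Var.col)))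
    (.get Arr.acc (.const 0) (.const 0)))

/-- Copy `block` to the rows of `vecs` that belong to the current grid point. -/
@[simp] def copyBlock : Cmd :=
  forLoop Var.col Var.m (fillLoop Var.x Var.n Arr.vecs (.add (.var Var.base) (.var Var.col))
    (.var Var.x) (.get Arr.block (.var Var.col) (.var Var.x)))

/-- Copy the determinant and the solutions to the cells of the current grid point. -/
@[simp] def copyPoint : Cmd :=
  .seq (.setReal Arr.det (.var Var.r) (.var Var.i) (.get Arr.detR (.const 0) (.const 0))) copyBlock

/-- Fill the grid for the empty selection. The matrix then depends on `r` only, so it is inverted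
once per row. -/
@[simp] def initGrid : Cmd :=
  gridLoop (.seq invert solveColumns) copyPoint

section

variable {A : Matrix (Fin n) (Fin m) ℝ} {R : Matrix (Fin n) (Fin n) ℝ} {p : ℕ}

theorem Runs.solveColumns (hn : σ.nvar Var.n = n) (hm : σ.nvar Var.m = m)
    (hp : σ.nvar Var.base = p) (hA : σ.rarr Arr.A = cell A) (hR : R.PosDef) (h : Inverted R p σ) :
    Runs solveColumns σ (m * (n * (n * 24 + 28) + 14) + 6) fun τ =>
      RowsSolve R A.col 0 (τ.rarr Arr.block) := by
  refine ((Runs.forRows (a := Arr.block) (T := n * (n * (9 + 15) + 9 + 19) + 6) id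
    (fun s => R⁻¹ *ᵥ A.col s) (fun _ _ h _ => h.ne) hm (by simp) (by simp)
    fun s τ hτ hs _ => ?_).post fun τ _ hrows s x => by simpa using hrows.eq s s.2 x).le (by lia)
  refine Runs.sumFillLoop s id (fun y x => (R⁻¹ *ᵥ Pi.single y 1) x * A x s) _
    (fun _ _ h _ => h.ne) (by simp [hτ.nvar, hn]) (by simp [hτ.nvar, hn]) (by simp) (by simp)
    (by simp) (by simp) (by simp) (by simp) (by simp) (by simp)
    (fun y x ρ hρ hy hx _ => ?_) fun y ρ hρ hy _ hsum => ?_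
  · simp [hρ.nvar, hρ.rarr, hτ.nvar, hτ.rarr, hp, hy, hx, hs, hA, cell, h.inv y x]
  · have hya : ∑ x, (R⁻¹ *ᵥ Pi.single y 1) x * A x s = (R⁻¹ *ᵥ A.col s) y :=
      (inv_mulVec_dotProduct hR _ (A.col s)).trans (single_one_dotProduct y _)
    exact ⟨by simp [hρ.nvar, hs], hy, hsum.trans hya⟩

theorem Runs.copyBlock (hn : σ.nvar Var.n = n) (hm : σ.nvar Var.m = m) (hp : σ.nvar Var.base = p)
    (h : RowsSolve R A.col 0 (σ.rarr Arr.block)) :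
    Runs copyBlock σ (m * (n * 16 + 14) + 6) fun τ =>
      RowsSolve R A.col p (τ.rarr Arr.vecs) ∧
      ∀ j, (∀ s < m, j ≠ p + s) → τ.rarr Arr.vecs j = σ.rarr Arr.vecs j := by
  refine ((Runs.forRows (a := Arr.vecs) (T := n * (8 + 8) + 6) (p + ·)
    (fun s => R⁻¹ *ᵥ A.col s) (by lia) hm (by simp) (by simp)
    fun s τ hτ hs _ => Runs.fillRow (p + s) _ (by simp [hτ.nvar, hn]) (by simp) (by simp)
      fun x ρ hρ hx _ => ?_).post fun τ _ hrows =>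
        ⟨fun s x => hrows.eq s s.2 x, hrows.eq_of_ne⟩).le (by lia)
  have := h s x
  simp_all [hρ.nvar, hρ.rarr, hτ.nvar, hτ.rarr]

theorem Runs.copyPoint {r i : ℕ} (hn : σ.nvar Var.n = n) (hm : σ.nvar Var.m = m)
    (hpt : AtGridPoint N m r i σ) (hdet : σ.rarr Arr.detR 0 0 = R.det)
    (h : RowsSolve R A.col 0 (σ.rarr Arr.block)) :
    Runs copyPoint σ (m * (n * 16 + 14) + 12) fun τ => GridAt A N r i R τ.rarr ∧
      (∀ j, (∀ s < m, j ≠ (r * N + i) * m + s) → τ.rarr Arr.vecs j = σ.rarr Arr.vecs j) ∧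
      ∀ a b, ¬ (a = r ∧ b = i) → τ.rarr Arr.det a b = σ.rarr Arr.det a b := by
  refine Runs.le (T := 6 + (m * (n * 16 + 14) + 6)) ?_ (by lia)
  refine Runs.seq (Q := fun τ => τ.rarr = (σ.setReal Arr.det r i R.det).rarr)
    ((Runs.setReal (by simp [hpt.r_eq, hpt.i_eq, hdet])).le (by simp)) fun τ hτ hτσ => ?_
  refine (Runs.copyBlock (R := R) (A := A) (p := (r * N + i) * m) (by simp [hτ.nvar, hn])
    (by simp [hτ.nvar, hm]) (by simp [hτ.nvar, hpt.base_eq])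
    (by simpa [hτ.rarr] using h)).post fun ρ hρ ⟨hvecs, hrest⟩ => ?_
  have hdetρ : ρ.rarr Arr.det = (σ.setReal Arr.det r i R.det).rarr Arr.det := by
    simp [hρ.rarr, hτσ]
  refine ⟨⟨hvecs, by simp [hdetρ]⟩, fun j hj => ?_, fun a b hab => by simp [hdetρ, hab]⟩
  rw [hrest j hj, hτ.rarr Arr.vecs (by simp)]

end

theorem Runs.initGrid (hn : σ.nvar Var.n = n) (hm : σ.nvar Var.m = m) (hN : σ.nvar Var.size = N)
    (A : Matrix (Fin n) (Fin m) ℝ) (w : Fin m → ℝ) (hA : σ.rarr Arr.A = cell A) :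
    Runs initGrid σ (N * ((n * (n * 15 + 21) + m * (n * (n * 98 + 130) + 73) + 23) +
      N * (m * (n * 16 + 14) + 24) + 14) + 8) fun τ =>
      ∀ r < N, ∀ i < N, GridAt A N r i (gridMatrix A w [] r i) τ.rarr := by
  let R (r : ℕ) : Matrix (Fin n) (Fin n) ℝ := gridMatrix A w [] r 0
  have hR (r i) : gridMatrix A w [] r i = R r := by simp [R, gridMatrix, outerSum]
  refine Runs.le (T := N * ((n * (n * 15 + 21) + m * (n * (n * 74 + 102) + 59) + 17 +
    (m * (n * (n * 24 + 28) + 14) + 6)) + N * ((m * (n * 16 + 14) + 12) + 12) + 14) + 8) ?_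
    (by lia)
  refine Runs.gridLoop (m := m)
    (fun r f => RowsSolve (R r) A.col 0 (f Arr.block) ∧ f Arr.detR 0 0 = (R r).det)
    (fun _ _ _ => True) (fun r i => GridAt A N r i (gridMatrix A w [] r i)) hN hm
    (by simp) (by simp) (by simp) (fun r τ _ hτ hrτ hb => ?_)
    fun r i τ _ hi hτ hpt ⟨hblock, hdet⟩ _ => ?_
  · refine (Runs.invert (A := A) (by simp [hτ.nvar, hn]) (by simp [hτ.nvar, hm]) hb hrτ
      (by simp [hτ.rarr, hA])).seq fun τ' hτ' h => ?_
    have hRr : 1 + (r : ℝ) • ∑ s, vecMulVec (A.col s) (A.col s) = R r := by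
      simp [R, gridMatrix]
    rw [hRr] at h
    refine (Runs.solveColumns (by simp [hτ'.nvar, hτ.nvar, hn]) (by simp [hτ'.nvar, hτ.nvar, hm])
      (by simp [hτ'.nvar, hb]) (by simp [hτ'.rarr, hτ.rarr, hA]) (posDef_gridMatrix A w [] r 0)
      h).post fun ρ hρ hblock => ⟨⟨hblock, by simp [hρ.rarr, h.det]⟩, fun r' i' _ =>
        ⟨fun _ => trivial, fun h => ⟨?_, ?_⟩⟩⟩
    · simpa [hρ.rarr, hτ'.rarr] using h.vecs
    · simpa [hρ.rarr, hτ'.rarr] using h.det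
  · refine (Runs.copyPoint (by simp [hτ.nvar, hn]) (by simp [hτ.nvar, hm]) hpt hdet hblock).post
      fun ρ hρ ⟨hG, hvecs, hdets⟩ => ?_
    exact ⟨⟨by simpa [hρ.rarr] using hblock, by simpa [hρ.rarr] using hdet⟩, hR r i ▸ hG,
      fun r' i' hi' hne => ⟨fun _ => trivial, fun h => h.congr hi hi' hne hvecs hdets⟩⟩

end Grid

/-! ### The greedy program -/

section Greedy

variable {n m k : ℕ} {σ : State} {A : Matrix (Fin n) (Fin m) ℝ} {w : Fin m → ℝ} {l : List (Fin m)}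

theorem rowPoly_eq {b r : ℕ} {F : ℝ[X]} (hF : F.natDegree ≤ n)
    (h : ∀ t ≤ n, σ.rarr b r t = F.coeff t) : σ.rowPoly b r n = F := by
  conv_rhs => rw [F.as_sum_range_C_mul_X_pow' (Nat.lt_succ_of_le hF)]
  exact Finset.sum_congr rfl fun t ht => by rw [h t (Finset.mem_range_succ_iff.1 ht)]

theorem Runs.root {a b : ℕ} {i j r d e : NExp} {F : ℝ[X]} {Q : State → Prop}
    (hF : F.Monic) (hsplits : F.Splits) (hd : d.eval σ = F.natDegree)
    (hcoeff : ∀ t ≤ F.natDegree, σ.rarr b (r.eval σ) t = F.coeff t)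
    (hk : 1 ≤ e.eval σ) (hkd : e.eval σ ≤ F.natDegree)
    (h : Q (σ.setReal a (i.eval σ) (j.eval σ) (kthLargestRoot (e.eval σ) F))) :
    Runs (.root a i j b r d e) σ
      (i.cost + j.cost + r.cost + d.cost + e.cost + F.natDegree ^ 3 + 1) Q := by
  have hpoly : σ.rowPoly b (r.eval σ) (d.eval σ) = F := hd ▸ rowPoly_eq le_rfl hcoeff
  refine ⟨_, _, .root σ a i j b r d e ?_ (hpoly ▸ hsplits) hk (hd ▸ hkd), by rw [hd],
    by rwa [hpoly]⟩
  rw [hd, hcoeff _ le_rfl, hF.coeff_natDegree]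
  exact one_ne_zero

/-- The input of the column selection problem is in place, together with the tables that depend on
it only. -/
structure Ready (A : Matrix (Fin n) (Fin m) ℝ) (w : Fin m → ℝ) (k : ℕ) (σ : State) : Prop where
  rows : σ.nvar Var.n = n
  cols : σ.nvar Var.m = m
  picks : σ.nvar Var.k = k
  size : σ.nvar Var.size = n + 1
  matrix : σ.rarr Arr.A = cell A
  weight : ∀ s : Fin m, σ.rarr Arr.w 0 s = w s
  scale : σ.rarr Arr.scale 0 0 = (∑ j, (w j ^ 2)⁻¹)⁻¹
  nodes : ∀ i < n + 1, ∀ d < n + 1, σ.rarr Arr.nodes i d = (nodeBasis (n + 1) i).coeff d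

theorem Ready.frame {c : Cmd} {τ : State} (h : Ready A w k σ) (hc : c.Frame σ τ)
    (hv : ∀ x ∈ [Var.n, Var.m, Var.k, Var.size], x ∉ c.vars)
    (hr : ∀ a ∈ [Arr.A, Arr.w, Arr.scale, Arr.nodes], a ∉ c.realArrays) : Ready A w k τ := by
  simp only [List.forall_mem_cons] at hv hr
  exact ⟨by simp [hc.nvar, hv, h.rows], by simp [hc.nvar, hv, h.cols],
    by simp [hc.nvar, hv, h.picks], by simp [hc.nvar, hv, h.size],
    by simp [hc.rarr, hr, h.matrix], by simp [hc.rarr, hr, h.weight],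
    by simp [hc.rarr, hr, h.scale], by simpa [hc.rarr, hr] using h.nodes⟩

/-- The grid and the marks describe the selected columns `l`. -/
structure Selected (A : Matrix (Fin n) (Fin m) ℝ) (w : Fin m → ℝ) (k : ℕ) (l : List (Fin m))
    (σ : State) : Prop extends Ready A w k σ where
  grid : ∀ r < n + 1, ∀ i < n + 1, GridAt A (n + 1) r i (gridMatrix A w l r i) σ.rarr
  mark : ∀ s : Fin m, σ.narr 1 s = if s ∈ l then 1 else 0

theorem Selected.frame {c : Cmd} {τ : State} (h : Selected A w k l σ) (hc : c.Frame σ τ)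
    (hv : ∀ x ∈ [Var.n, Var.m, Var.k, Var.size], x ∉ c.vars) (hn : 1 ∉ c.natArrays)
    (hr : ∀ a ∈ [Arr.A, Arr.w, Arr.scale, Arr.nodes, Arr.vecs, Arr.det], a ∉ c.realArrays) :
    Selected A w k l τ where
  toReady := h.toReady.frame hc hv (by simp only [List.forall_mem_cons] at hr ⊢; tauto)
  grid r hr' i hi := by
    obtain ⟨hvecs, hdet⟩ := h.grid r hr' i hi
    exact ⟨by rwa [hc.rarr _ (hr _ (by simp))], by rwa [hc.rarr _ (hr _ (by simp))]⟩
  mark s := by rw [hc.narr _ hn, h.mark]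

theorem gridMatrix_append_singleton (A : Matrix (Fin n) (Fin m) ℝ) (w : Fin m → ℝ)
    (l : List (Fin m)) (s : Fin m) (r i : ℕ) : gridMatrix A w (l ++ [s]) r i =
      gridMatrix A w l r i + (i * (w s * w s)) • vecMulVec (A.col s) (A.col s) := by
  rw [gridMatrix, gridMatrix, outerSum_append_singleton, columnStep, pow_two, smul_add, smul_smul]
  abel

/-- The weights of the grid determinants for the columns that remain after the next one. -/
def Weighted (w : Fin m → ℝ) (N q : ℕ) (σ : State) : Prop :=
  ∀ i < N, ∀ r < N, σ.rarr Arr.weights i r = gridWeight N q (∑ j, (w j ^ 2)⁻¹)⁻¹ i r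

/-- Store the weighted determinant that the current grid point would have if `col` were selected. -/
@[simp] def weightPoint : Cmd :=
  .seq (sumLoop Var.x Var.n Arr.acc (.mul (.get Arr.A (.var Var.x) (.var Var.col))
    (.get Arr.vecs (.add (.var Var.base) (.var Var.col)) (.var Var.x))))
  (.setReal Arr.weightedDets (.var Var.i) (.var Var.r)
    (.mul (.mul (.get Arr.weights (.var Var.i) (.var Var.r))
        (.get Arr.det (.var Var.r) (.var Var.i)))
      (.add (.ofNat (.const 1)) (.mul (.mul (.ofNat (.var Var.i))
        (.mul (.get Arr.w (.const 0) (.var Var.col)) (.get Arr.w (.const 0) (.var Var.col))))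
        (.get Arr.acc (.const 0) (.const 0))))))

/-- Store the weighted determinants of all grid points as if `col` were selected. -/
@[simp] def weightGrid : Cmd := gridLoop .skip weightPoint

theorem Runs.weightPoint {q r i : ℕ} (hr : r < n + 1) (hi : i < n + 1) (hσ : Selected A w k l σ)
    (hW : Weighted w (n + 1) q σ) (s : Fin m) (hs : σ.nvar Var.col = s)
    (hpt : AtGridPoint (n + 1) m r i σ) :
    Runs weightPoint σ (n * 24 + 39) fun τ => ∀ i' r', τ.rarr Arr.weightedDets i' r' =
      if i' = i ∧ r' = r then gridWeight (n + 1) q (∑ j, (w j ^ 2)⁻¹)⁻¹ i r *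
        (gridMatrix A w (l ++ [s]) r i).det else σ.rarr Arr.weightedDets i' r' := by
  obtain ⟨hvecs, hdet⟩ := hσ.grid r hr i hi
  refine Runs.le (T := (n * (9 + 15) + 11) + 28) ?_ (by lia)
  refine (Runs.sumLoop (fun x => A x s * ((gridMatrix A w l r i)⁻¹ *ᵥ A.col s) x) hσ.rows (by simp)
    (by simp) fun x τ hτ hx => ?_).seq fun τ hτ hsum => (Runs.setReal fun i' r' => ?_).le (by simp)
  · simp [hτ.nvar, hτ.rarr, hx, hs, hpt.base_eq, hσ.matrix, cell, hvecs s x]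
  · have hacc : τ.rarr Arr.acc 0 0 = A.col s ⬝ᵥ (gridMatrix A w l r i)⁻¹ *ᵥ A.col s := hsum
    simp [hτ.nvar, hτ.rarr, hs, hpt.r_eq, hpt.i_eq, hσ.weight, hW i hi r hr, hdet, hacc,
      gridMatrix_append_singleton, det_add_smul_vecMulVec (posDef_gridMatrix A w l r i), mul_assoc]

theorem Runs.weightGrid {q : ℕ} (hσ : Selected A w k l σ) (hW : Weighted w (n + 1) q σ) (s : Fin m)
    (hs : σ.nvar Var.col = s) :
    Runs weightGrid σ ((n + 1) * ((n + 1) * (n * 24 + 51) + 15) + 8) fun τ =>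
      ∀ r < n + 1, ∀ i < n + 1, τ.rarr Arr.weightedDets i r =
        gridWeight (n + 1) q (∑ j, (w j ^ 2)⁻¹)⁻¹ i r * (gridMatrix A w (l ++ [s]) r i).det := by
  refine Runs.le (T := (n + 1) * (1 + (n + 1) * ((n * 24 + 39) + 12) + 14) + 8) ?_ (by lia)
  refine Runs.gridLoop (m := m) (fun _ _ => True) (fun _ _ _ => True)
    (fun r i f => f Arr.weightedDets i r = gridWeight (n + 1) q (∑ j, (w j ^ 2)⁻¹)⁻¹ i r *
      (gridMatrix A w (l ++ [s]) r i).det) hσ.size hσ.cols (by simp) (by simp) (by simp)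
    (fun r τ _ _ _ _ => Runs.skip ⟨trivial, fun r' i' _ => ⟨id, id⟩⟩)
    fun r i τ hr hi hτ hpt _ _ => ?_
  refine (Runs.weightPoint (q := q) hr hi (hσ.frame hτ (by simp) (by simp) (by simp))
    (fun i hi r hr => by rw [← hW i hi r hr, hτ.rarr _ (by simp)]) s (by simp [hτ.nvar, hs])
    hpt).post fun ρ _ h =>
      ⟨trivial, by simp [h], fun r' i' _ hne => ⟨fun _ => trivial, fun h' => ?_⟩⟩
  exact (h i' r').trans (by rwa [if_neg (by tauto)])

/-- Sum the weighted determinants over `r`, which yields the mean of `det (1 + i M)`. -/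
@[simp] def meanRow : Cmd :=
  sumFillLoop Var.i Var.size Arr.means (.const 0) (.var Var.i) Var.r Var.size Arr.acc
    (.get Arr.weightedDets (.var Var.i) (.var Var.r)) (.get Arr.acc (.const 0) (.const 0))

/-- Interpolate the means in `i`. The coefficients are stored in reverse order, as `det (1 - y M)`
is the reverse of the characteristic polynomial of `M`. -/
@[simp] def coeffRow : Cmd :=
  sumFillLoop Var.d Var.size Arr.coeffs (.const 0) (.sub (.var Var.n) (.var Var.d))
    Var.i Var.size Arr.acc
    (.mul (.get Arr.means (.const 0) (.var Var.i)) (.get Arr.nodes (.var Var.i) (.var Var.d)))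
    (.get Arr.acc (.const 0) (.const 0))

theorem Runs.meanRow {V : ℕ → ℕ → ℝ} {N : ℕ} (hN : σ.nvar Var.size = N)
    (hV : ∀ r < N, ∀ i < N, σ.rarr Arr.weightedDets i r = V i r) :
    Runs meanRow σ (N * (N * 21 + 25) + 6) fun τ =>
      ∀ i < N, τ.rarr Arr.means 0 i = ∑ r : Fin N, V i r := by
  refine Runs.le (T := N * (N * (6 + 15) + 6 + 19) + 6) (Runs.post (Runs.sumFillLoop 0 id
    (fun i r : Fin N => V i r) _ (fun _ _ h _ => h.ne) hN hN (by simp) (by simp) (by simp)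
    (by simp) (by simp) (by simp) (by simp) (by simp) (fun i r τ hτ hi hr _ => ?_)
    fun _ _ _ hi _ hsum => ⟨rfl, hi, hsum⟩) fun τ _ h i hi => h.eq ⟨i, hi⟩ hi) (by lia)
  simp [hi, hr, hτ.rarr, hV r r.2 i i.2]

theorem Runs.coeffRow (hσ : Ready A w k σ) {v : ℕ → ℝ}
    (hv : ∀ i < n + 1, σ.rarr Arr.means 0 i = v i) :
    Runs coeffRow σ ((n + 1) * ((n + 1) * 23 + 27) + 6) fun τ => ∀ t ≤ n,
      τ.rarr Arr.coeffs 0 (n - t) = ∑ i : Fin (n + 1), v i * (nodeBasis (n + 1) i).coeff t := by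
  refine Runs.le (T := (n + 1) * ((n + 1) * (8 + 15) + 8 + 19) + 6) (Runs.post
    (Runs.sumFillLoop 0 (n - ·)
      (fun t i : Fin (n + 1) => v i * (nodeBasis (n + 1) i).coeff t) _ (by lia) hσ.size hσ.size
      (by simp) (by simp) (by simp) (by simp) (by simp) (by simp) (by simp) (by simp)
      (fun t i τ hτ ht hi _ => ?_)
      fun t τ hτ ht _ hsum => ⟨rfl, by simp [hτ.nvar, hσ.rows, ht], hsum⟩)
    fun τ _ h t ht => h.eq ⟨t, Nat.lt_succ_of_le ht⟩ (Nat.lt_succ_of_le ht)) (by lia)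
  simp [ht, hi, hτ.rarr, hv i i.2, hσ.nodes i i.2 t t.2]

/-- Compute the value of the column `col` for the greedy rule. -/
@[simp] def candidate : Cmd :=
  .seq weightGrid (.seq meanRow (.seq coeffRow
    (.root Arr.value (.const 0) (.const 0) Arr.coeffs (.const 0) (.var Var.n) (.var Var.k))))

theorem coeff_expectedPoly_sub (hw : ∀ i, w i ≠ 0) [Nonempty (Fin m)] (q : ℕ) (l : List (Fin m))
    {t : ℕ} (ht : t ≤ n) : (expectedPoly A w q (outerSum A w l)).coeff (n - t) =
      ∑ i : Fin (n + 1), (∑ r : Fin (n + 1), gridWeight (n + 1) q (∑ j, (w j ^ 2)⁻¹)⁻¹ i r *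
        (gridMatrix A w l r i).det) * (nodeBasis (n + 1) i).coeff t := by
  have h := coeff_meanCharpoly_card_sub (sum_colProb hw) (colProb_mul_sq hw) A.col q
    (outerSum A w l) (N := n + 1) (t := t) (by simp) (by simpa using ht)
  rwa [Fintype.card_fin] at h

theorem Runs.candidate (hw : ∀ i, w i ≠ 0) (hk : 1 ≤ k) (hkn : k ≤ n) (hσ : Selected A w k l σ)
    (hW : Weighted w (n + 1) (k - (l.length + 1)) σ) (s : Fin m) (hs : σ.nvar Var.col = s) :
    Runs candidate σ ((n + 1) * ((n + 1) * (n * 24 + 95) + 67) + n ^ 3 + 26) fun τ =>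
      τ.rarr Arr.value 0 0 = kthLargestRoot k (partialPoly A w k (l ++ [s])) := by
  have : Nonempty (Fin m) := ⟨s⟩
  set F := expectedPoly A w (k - (l.length + 1)) (outerSum A w (l ++ [s])) with hF
  have hdeg : F.natDegree = n := natDegree_expectedPoly A hw _ _
  refine Runs.le (T := ((n + 1) * ((n + 1) * (n * 24 + 51) + 15) + 8) +
    (((n + 1) * ((n + 1) * 21 + 25) + 6) + (((n + 1) * ((n + 1) * 23 + 27) + 6) +
      (6 + n ^ 3)))) ?_ (by lia)
  refine (Runs.weightGrid hσ hW s hs).seq fun τ₁ hτ₁ hdets => ?_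
  have hτ₁' := hσ.frame hτ₁ (by simp) (by simp) (by simp)
  refine (Runs.meanRow (V := fun i r => gridWeight (n + 1) (k - (l.length + 1))
    (∑ j, (w j ^ 2)⁻¹)⁻¹ i r * (gridMatrix A w (l ++ [s]) r i).det) hτ₁'.size hdets).seq
    fun τ₂ hτ₂ hmeans => ?_
  have hτ₂' := hτ₁'.frame hτ₂ (by simp) (by simp) (by simp)
  refine (Runs.coeffRow hτ₂'.toReady hmeans).seq fun τ₃ hτ₃ hcoeff => ?_
  have hτ₃' := hτ₂'.frame hτ₃ (by simp) (by simp) (by simp)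
  refine (Runs.root (F := F) (monic_expectedPoly A hw _ _)
    (splits_expectedPoly A hw _ (posSemidef_outerSum A w _).isHermitian)
    (by simp [hτ₃'.rows, hdeg]) (fun t ht => ?_) (by simp [hτ₃'.picks, hk])
    (by simp [hτ₃'.picks, hdeg, hkn]) ?_).le (by simp [hdeg])
  · have h := coeff_expectedPoly_sub (A := A) hw (k - (l.length + 1)) (l ++ [s]) (n.sub_le t)
    rw [← hcoeff _ (n.sub_le t), Nat.sub_sub_self (hdeg ▸ ht)] at h
    exact h.symm
  · simp [hτ₃'.picks, kthLargestRoot_partialPoly A hw, hF]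

/-- The registers `choice` and `best` hold a maximizer outside `l` of `f` over the first `x` columns
and the maximum, and `found` tells whether there is such a column at all. -/
def BestSoFar (f : Fin m → ℝ) (l : List (Fin m)) (x : ℕ) (τ : State) : Prop :=
  (τ.nvar Var.found = 0 ∧ ∀ t : Fin m, t < x → t ∈ l) ∨
  (τ.nvar Var.found = 1 ∧ ∃ s : Fin m, τ.nvar Var.choice = s ∧ s ∉ l ∧ τ.rarr Arr.best 0 0 = f s ∧
    ∀ t : Fin m, t < x → t ∉ l → f t ≤ f s)

namespace BestSoFar

variable {f : Fin m → ℝ} {x : ℕ} {s : Fin m}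

theorem frame {c : Cmd} {τ : State} (h : BestSoFar f l x σ) (hc : c.Frame σ τ)
    (hv : ∀ x ∈ [Var.found, Var.choice], x ∉ c.vars) (hr : Arr.best ∉ c.realArrays) :
    BestSoFar f l x τ := by
  simp only [List.forall_mem_cons] at hv
  simpa [BestSoFar, hc.nvar, hc.rarr, hv, hr] using h

theorem succ_of_mem (h : BestSoFar f l s σ) (hs : s ∈ l) : BestSoFar f l (s + 1) σ := by
  have hcases {t : Fin m} (ht : t.1 < s + 1) : t.1 < s ∨ t = s := by
    rwa [← Fin.val_inj, ← Nat.lt_succ_iff_lt_or_eq]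
  refine h.imp (fun h => ⟨h.1, fun t ht => ?_⟩) fun ⟨hfound, s', hchoice, hs', hbest, hmax⟩ =>
    ⟨hfound, s', hchoice, hs', hbest, fun t ht htl => ?_⟩
  · exact (hcases ht).elim (h.2 t) (· ▸ hs)
  · exact (hcases ht).elim (hmax t · htl) fun heq => absurd (heq ▸ hs) htl

end BestSoFar

/-- Replace the best column so far by `col` if there is none or if the value of `col` is greater. -/
@[simp] def keepBetter : Cmd :=
  .ite (.and (.natLt (.const 0) (.var Var.found))
    (.realLe (.get Arr.value (.const 0) (.const 0)) (.get Arr.best (.const 0) (.const 0)))) .skip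
  (.seq (.setReal Arr.best (.const 0) (.const 0) (.get Arr.value (.const 0) (.const 0)))
    (.seq (.setVar Var.choice (.var Var.col)) (.setVar Var.found (.const 1))))

/-- Find a column that is optimal for the greedy rule. -/
@[simp] def select : Cmd :=
  .seq (.setVar Var.found (.const 0)) (forLoop Var.col Var.m
    (.ite (.natLt (.const 0) (.get 1 (.var Var.col))) .skip (.seq candidate keepBetter)))

theorem Runs.keepBetter {f : Fin m → ℝ} {s : Fin m} (h : BestSoFar f l s σ) (hs : s ∉ l)
    (hcol : σ.nvar Var.col = s) (hval : σ.rarr Arr.value 0 0 = f s) :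
    Runs keepBetter σ 22 fun τ => BestSoFar f l (s + 1) τ := by
  have hcases {t : Fin m} (ht : t.1 < s + 1) : t.1 < s ∨ t = s := by
    rwa [← Fin.val_inj, ← Nat.lt_succ_iff_lt_or_eq]
  refine (Runs.ite (T := 10) (fun hb => (Runs.skip ?_).le (by simp)) fun hb => ?_).le (by simp)
  · obtain h | ⟨hfound, s', hchoice, hs', hbest, hmax⟩ := h
    · simp [h.1] at hb
    have hle : f s ≤ f s' := by simpa [hfound, hval, hbest] using hb
    exact .inr ⟨hfound, s', hchoice, hs', hbest, fun t ht htl =>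
      (hcases ht).elim (hmax t · htl) (· ▸ hle)⟩
  · refine Runs.seq (T := 6) (T' := 4) ((Runs.setReal (Q := fun τ => τ.rarr Arr.best 0 0 = f s)
      (by simp [hval])).le (by simp)) fun τ₁ hτ₁ hbest₁ => ?_
    refine Runs.seq (T := 2) (T' := 2) ((Runs.setVar (Q := fun τ => τ.nvar Var.choice = s)
      (by simp [hτ₁.nvar, hcol])).le (by simp)) fun τ₂ hτ₂ hchoice₂ => (Runs.setVar ?_).le (by simp)
    refine .inr ⟨by simp, s, by simp [hchoice₂], hs, by simp [hτ₂.rarr, hbest₁], fun t ht htl =>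
      (hcases ht).elim (fun ht => ?_) (· ▸ le_rfl)⟩
    obtain h | ⟨hfound, s', _, _, hbest, hmax⟩ := h
    · exact absurd (h.2 t ht) htl
    · have hlt : f s' < f s := by simpa [hfound, hval, hbest] using hb
      exact (hmax t ht htl).trans hlt.le

theorem Runs.select (hw : ∀ i, w i ≠ 0) (hk : 1 ≤ k) (hkn : k ≤ n) (hσ : Selected A w k l σ)
    (hW : Weighted w (n + 1) (k - (l.length + 1)) σ) (hl : ∃ t, t ∉ l) :
    Runs select σ (m * ((n + 1) * ((n + 1) * (n * 24 + 95) + 67) + n ^ 3 + 61) + 8) fun τ =>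
      ∃ s : Fin m, τ.nvar Var.choice = s ∧ s ∉ l ∧ ∀ t ∉ l,
        kthLargestRoot k (partialPoly A w k (l ++ [t])) ≤
          kthLargestRoot k (partialPoly A w k (l ++ [s])) := by
  let f (t : Fin m) : ℝ := kthLargestRoot k (partialPoly A w k (l ++ [t]))
  let K : ℕ := (n + 1) * ((n + 1) * (n * 24 + 95) + 67) + n ^ 3 + 26
  refine Runs.le (T := 2 + (m * ((4 + (K + 22) + 1) + 8) + 6)) ?_ (by lia)
  refine Runs.seq (Q := fun τ => τ.nvar Var.found = 0) ((Runs.setVar (by simp)).le (by simp))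
    fun τ hτ hfound => ?_
  refine (Runs.forLoop' (fun x ρ => BestSoFar f l x ρ) (by simp [hτ.nvar, hσ.cols]) (by simp)
    (by simp) (.inl ⟨hfound, by simp⟩) fun x ρ hx hρ hcol h => ?_).post fun ρ _ h => ?_
  · let s : Fin m := ⟨x, hx⟩
    have hmark : ρ.narr 1 x = if s ∈ l then 1 else 0 := by
      rw [hρ.narr 1 (by simp), hτ.narr 1 (by simp)]; exact hσ.mark s
    have hσρ : (RealRAM.select).Frame σ ρ := hτ.trans hρ (by simp) (by simp) (by simp)
    refine (Runs.ite (T := K + 22) (fun hb => (Runs.skip ?_).le (by lia)) fun hb => ?_).le (by simp)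
    · have hs : s ∈ l := by_contra fun hs => by simp [hcol, hmark, hs] at hb
      exact h.succ_of_mem (s := s) hs
    · have hs : s ∉ l := fun hs => by simp [hcol, hmark, hs] at hb
      refine (Runs.candidate hw hk hkn (hσ.frame hσρ (by simp) (by simp) (by simp))
        (fun i hi r hr => by rw [← hW i hi r hr, hσρ.rarr _ (by simp)]) s hcol).seq
        fun ρ' hρ' hval => ?_
      exact Runs.keepBetter (s := s) (h.frame hρ' (by simp) (by simp)) hs
        (by simp [hρ'.nvar, hcol, s]) hval
  · obtain ⟨t, ht⟩ := hl
    obtain h | ⟨-, s, hchoice, hs, -, hmax⟩ := h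
    exacts [absurd (h.2 t t.2) ht, ⟨s, hchoice, hs, fun t => hmax t t.2⟩]

/-- Add the column `choice` to the matrix of the current grid point. -/
@[simp] def updatePoint : Cmd :=
  .seq (fillLoop Var.x Var.n Arr.v (.const 0) (.var Var.x)
    (.mul (.get Arr.w (.const 0) (.var Var.choice))
      (.get Arr.vecs (.add (.var Var.base) (.var Var.choice)) (.var Var.x))))
  (.seq (rankOneUpdate Arr.vecs Var.m Var.i)
  (.setReal Arr.det (.var Var.r) (.var Var.i)
    (.mul (.get Arr.det (.var Var.r) (.var Var.i)) (.get Arr.growth (.const 0) (.const 0)))))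

/-- Add the column `choice` to the selected ones. -/
@[simp] def update : Cmd :=
  .seq (fillLoop Var.x Var.n Arr.u (.const 0) (.var Var.x)
    (.mul (.get Arr.w (.const 0) (.var Var.choice)) (.get Arr.A (.var Var.x) (.var Var.choice))))
  (gridLoop .skip updatePoint)

theorem gridMatrix_append_singleton_eq_vecMulVec_smul (A : Matrix (Fin n) (Fin m) ℝ)
    (w : Fin m → ℝ) (l : List (Fin m)) (s : Fin m) (r i : ℕ) : gridMatrix A w (l ++ [s]) r i =
      gridMatrix A w l r i + (i : ℝ) • vecMulVec (w s • A.col s) (w s • A.col s) := by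
  rw [gridMatrix_append_singleton, smul_vecMulVec, vecMulVec_smul, smul_smul, smul_smul, mul_assoc]

theorem Runs.updatePoint {r i : ℕ} (hσ : Ready A w k σ) (s : Fin m) (hs : σ.nvar Var.choice = s)
    (hu : ∀ x : Fin n, σ.rarr Arr.u 0 x = (w s • A.col s) x)
    (hpt : AtGridPoint (n + 1) m r i σ)
    (hG : GridAt A (n + 1) r i (gridMatrix A w l r i) σ.rarr) :
    Runs updatePoint σ (m * (n * 50 + 38) + n * 42 + 45) fun τ =>
      GridAt A (n + 1) r i (gridMatrix A w (l ++ [s]) r i) τ.rarr ∧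
      (∀ j, (∀ t < m, j ≠ (r * (n + 1) + i) * m + t) → τ.rarr Arr.vecs j = σ.rarr Arr.vecs j) ∧
      ∀ a b, ¬ (a = r ∧ b = i) → τ.rarr Arr.det a b = σ.rarr Arr.det a b := by
  have hR := posDef_gridMatrix A w l r i
  refine Runs.le (T := (n * (12 + 8) + 6) + ((m * (n * 50 + 38) + n * 22 + 29) + 10)) ?_ (by lia)
  refine (Runs.fillRow 0 ((gridMatrix A w l r i)⁻¹ *ᵥ (w s • A.col s)) hσ.rows (by simp) (by simp)
    fun x τ hτ hx _ => ?_).seq fun τ₁ hτ₁ hv => ?_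
  · simp [hτ.nvar, hτ.rarr, hs, hx, hpt.base_eq, hσ.weight, hG.vecs s x, mulVec_smul]
  refine (Runs.rankOneUpdate (b := A.col) (p := (r * (n + 1) + i) * m) (α := i)
    (by simp) (by simp) (by simp) (by simp [hτ₁.nvar, hσ.rows])
    (by simp [hτ₁.nvar, hσ.cols]) (by simp [hτ₁.nvar, hpt.base_eq])
    (by simp [hτ₁.nvar, hpt.i_eq]) hR (by simpa [hτ₁.rarr] using hu) (fun x => hv.eq x x.2)
    (by simpa [hτ₁.rarr] using hG.vecs)).seq fun τ₂ hτ₂ ⟨hgrowth, hvecs, hrest⟩ => ?_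
  refine (Runs.setReal ⟨⟨fun t x => ?_, ?_⟩, fun j hj => funext fun x => ?_,
    fun a b hab => ?_⟩).le (by simp)
  · simpa [gridMatrix_append_singleton_eq_vecMulVec_smul] using hvecs t x
  · rw [gridMatrix_append_singleton_eq_vecMulVec_smul, det_add_smul_vecMulVec hR]
    simp [hτ₂.nvar, hτ₁.nvar, hτ₂.rarr, hτ₁.rarr, hpt.r_eq, hpt.i_eq, hG.det, hgrowth]
  · simpa [hτ₁.rarr] using congrFun (hrest j hj) x
  · simp [hτ₂.nvar, hτ₁.nvar, hτ₂.rarr, hτ₁.rarr, hpt.r_eq, hpt.i_eq, hab]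

theorem Runs.update (hσ : Ready A w k σ)
    (hG : ∀ r < n + 1, ∀ i < n + 1, GridAt A (n + 1) r i (gridMatrix A w l r i) σ.rarr)
    (s : Fin m) (hs : σ.nvar Var.choice = s) :
    Runs update σ (n * 18 + (n + 1) * ((n + 1) * (m * (n * 50 + 38) + n * 42 + 57) + 15) + 14)
      fun τ => ∀ r < n + 1, ∀ i < n + 1,
        GridAt A (n + 1) r i (gridMatrix A w (l ++ [s]) r i) τ.rarr := by
  refine Runs.le (T := (n * (10 + 8) + 6) + ((n + 1) * (1 + (n + 1) *
    ((m * (n * 50 + 38) + n * 42 + 45) + 12) + 14) + 8)) ?_ (by lia)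
  refine (Runs.fillRow 0 (w s • A.col s) hσ.rows (by simp) (by simp) fun x τ hτ hx _ => ?_).seq
    fun τ hτ hu => ?_
  · simp [hτ.nvar, hτ.rarr, hs, hx, hσ.weight, hσ.matrix, cell]
  have hτ' := hσ.frame hτ (by simp) (by simp)
  refine Runs.gridLoop (m := m) (fun _ _ => True)
    (fun r i => GridAt A (n + 1) r i (gridMatrix A w l r i))
    (fun r i => GridAt A (n + 1) r i (gridMatrix A w (l ++ [s]) r i)) hτ'.size hτ'.cols
    (by simp) (by simp)
    (fun r hr i hi => ⟨by simpa [hτ.rarr] using (hG r hr i hi).vecs,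
      by simpa [hτ.rarr] using (hG r hr i hi).det⟩)
    (fun r ρ _ _ _ _ => Runs.skip ⟨trivial, fun r' i' _ => ⟨id, id⟩⟩)
    fun r i ρ _ hi hρ hpt _ hGρ => ?_
  refine (Runs.updatePoint (hτ'.frame hρ (by simp) (by simp)) s (by simp [hρ.nvar, hτ.nvar, hs])
    (fun x => by rw [hρ.rarr _ (by simp)]; exact hu.eq x x.2) hpt hGρ).post
    fun ρ' _ ⟨hG', hvecs, hdets⟩ => ⟨trivial, hG', fun r' i' hi' hne =>
      ⟨fun h => h.congr hi hi' hne hvecs hdets, fun h => h.congr hi hi' hne hvecs hdets⟩⟩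

/-- The columns `l` have been selected by the greedy rule and written to the output. -/
structure GreedyState (A : Matrix (Fin n) (Fin m) ℝ) (w : Fin m → ℝ) (k : ℕ) (l : List (Fin m))
    (σ : State) : Prop extends Selected A w k l σ where
  greedy : GreedyRun A w k l
  output : σ.output l.length = l.map Fin.val

theorem GreedyState.setVar_round (h : GreedyState A w k l σ) (v : ℕ) :
    GreedyState A w k l (σ.setVar Var.round v) where
  toSelected := h.frame (Exec.setVar σ Var.round (.const v)).frame (by simp) (by simp) (by simp)
  greedy := h.greedy
  output := h.output

/-- Compute the tables that depend on the input only, and the grid for the empty selection. -/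
@[simp] def prepare : Cmd := .seq constants (.seq nodeTable initGrid)

theorem prepare_cost_le (n : ℕ) (hm : 1 ≤ m) :
    (m * 25 + 24) + (((n + 1) * ((n + 1) * ((n + 1) * 33 + 63) + 36) + 6) +
      ((n + 1) * ((n * (n * 15 + 21) + m * (n * (n * 98 + 130) + 73) + 23) +
        (n + 1) * (m * (n * 16 + 14) + 24) + 14) + 8)) ≤ 700 * (m * (n + 1) ^ 3) := by
  obtain ⟨m, rfl⟩ := Nat.exists_eq_add_of_le hm
  grind

theorem Runs.prepare (A : Matrix (Fin n) (Fin m) ℝ) (w : Fin m → ℝ) (k : ℕ) (hm : 1 ≤ m) :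
    Runs prepare (selectInput A w k) (700 * (m * (n + 1) ^ 3)) (GreedyState A w k []) := by
  have hw (s : Fin m) : (selectInput A w k).rarr Arr.w 0 s = w s := by simp [selectInput, cell]
  refine Runs.le ?_ (prepare_cost_le n hm)
  refine (Runs.constants (n := n) (m := m) rfl rfl hw).seq fun τ₁ hτ₁ ⟨hsize, hscale⟩ => ?_
  refine (Runs.nodeTable hsize).seq fun τ₂ hτ₂ hnodes => ?_
  have hτ : Ready A w k τ₂ := {
    rows := by simp [hτ₂.nvar, hτ₁.nvar, selectInput]
    cols := by simp [hτ₂.nvar, hτ₁.nvar, selectInput]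
    picks := by simp [hτ₂.nvar, hτ₁.nvar, selectInput]
    size := by simp [hτ₂.nvar, hsize]
    matrix := by simp [hτ₂.rarr, hτ₁.rarr, selectInput]
    weight := fun s => by simp [hτ₂.rarr, hτ₁.rarr, hw]
    scale := by simp [hτ₂.rarr, hscale]
    nodes := hnodes }
  refine (Runs.initGrid hτ.rows hτ.cols hτ.size A w hτ.matrix).post fun τ₃ hτ₃ hgrid => ?_
  exact {
    toReady := hτ.frame hτ₃ (by simp) (by simp)
    grid := hgrid
    mark := fun s => by simp [hτ₃.narr, hτ₂.narr, hτ₁.narr, selectInput]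
    greedy := .nil
    output := rfl }

theorem exists_notMem_of_length_lt (hl : l.length < m) : ∃ t, t ∉ l := by
  obtain ⟨t, -, ht⟩ := Finset.exists_mem_notMem_of_card_lt_card (s := l.toFinset)
    (t := Finset.univ) (l.toFinset_card_le.trans_lt (by simpa using hl))
  exact ⟨t, by simpa using ht⟩

theorem GreedyState.snoc {τ : State} {s : Fin m} (h : GreedyState A w k l σ)
    (hτ : Ready A w k τ) (hs : s ∉ l)
    (hmax : ∀ t ∉ l, kthLargestRoot k (partialPoly A w k (l ++ [t])) ≤
      kthLargestRoot k (partialPoly A w k (l ++ [s])))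
    (hout : ∀ i, τ.narr 0 i = if i = l.length then ↑s else σ.narr 0 i)
    (hmark : ∀ i, τ.narr 1 i = if i = s then 1 else σ.narr 1 i)
    (hgrid : ∀ r < n + 1, ∀ i < n + 1,
      GridAt A (n + 1) r i (gridMatrix A w (l ++ [s]) r i) τ.rarr) :
    GreedyState A w k (l ++ [s]) τ where
  toReady := hτ
  grid := hgrid
  mark t := by simp [hmark, h.mark, Fin.val_inj, or_comm, ite_or]
  greedy := .snoc l s h.greedy hs hmax
  output := by
    have hrest : (List.range l.length).map (τ.narr 0) = σ.output l.length :=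
      List.map_congr_left fun i hi => by rw [hout, if_neg (List.mem_range.1 hi).ne]
    rw [List.length_append, List.length_singleton, State.output, List.range_succ, List.map_append,
      List.map_append, hrest, h.output]
    simp [hout]

/-- Select one more column. -/
@[simp] def round : Cmd :=
  .seq (.setVar Var.left (.sub (.var Var.k) (.add (.var Var.round) (.const 1))))
  (.seq weightTable
  (.seq select
  (.seq (.setNat 0 (.var Var.round) (.var Var.choice))
  (.seq (.setNat 1 (.var Var.choice) (.const 1)) update))))

theorem round_cost_le (n : ℕ) (hm : 1 ≤ m) :
    6 + (((n + 1) * ((n + 1) * ((n + 1) * 22 + 57) + 25) + 6) +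
      ((m * ((n + 1) * ((n + 1) * (n * 24 + 95) + 67) + n ^ 3 + 61) + 8) + (3 + (3 +
        (n * 18 + (n + 1) * ((n + 1) * (m * (n * 50 + 38) + n * 42 + 57) + 15) + 14))))) ≤
      700 * (m * (n + 1) ^ 3) := by
  obtain ⟨m, rfl⟩ := Nat.exists_eq_add_of_le hm
  grind

theorem Runs.round (hw : ∀ i, w i ≠ 0) (hk : 1 ≤ k) (hkn : k ≤ n) (hl : l.length < m)
    (hσ : GreedyState A w k l σ) (hround : σ.nvar Var.round = l.length) :
    Runs round σ (700 * (m * (n + 1) ^ 3)) fun τ => ∃ s, GreedyState A w k (l ++ [s]) τ := by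
  refine Runs.le ?_ (round_cost_le n hl.pos)
  refine Runs.seq (Q := fun τ => τ.nvar Var.left = k - (l.length + 1))
    ((Runs.setVar (by simp [hσ.picks, hround])).le (by simp)) fun τ₁ hτ₁ hleft => ?_
  have h₁ := hσ.frame hτ₁ (by simp) (by simp) (by simp)
  refine (Runs.weightTable h₁.size hleft h₁.scale h₁.nodes).seq fun τ₂ hτ₂ hweights => ?_
  have h₂ := h₁.frame hτ₂ (by simp) (by simp) (by simp)
  refine (Runs.select hw hk hkn h₂ hweights (exists_notMem_of_length_lt hl)).seq
    fun τ₃ hτ₃ ⟨s, hchoice, hs, hmax⟩ => ?_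
  have h₃ := h₂.frame hτ₃ (by simp) (by simp) (by simp)
  refine Runs.seq (Q := (· = τ₃.setNat 0 l.length s)) ((Runs.setNat
    (by simp [hτ₃.nvar, hτ₂.nvar, hτ₁.nvar, hround, hchoice])).le (by simp)) fun τ₄ hτ₄ hout => ?_
  refine Runs.seq (Q := (· = τ₄.setNat 1 s 1)) ((Runs.setNat
    (by simp [hτ₄.nvar, hchoice])).le (by simp)) fun τ₅ hτ₅ hmark => ?_
  have h₅ := (h₃.toReady.frame hτ₄ (by simp) (by simp)).frame hτ₅ (by simp) (by simp)
  refine (Runs.update h₅ (l := l) (by simpa [hmark, hout] using h₃.grid) s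
    (by simp [hτ₅.nvar, hτ₄.nvar, hchoice])).post fun τ₆ hτ₆ hgrid =>
      ⟨s, hσ.snoc (h₅.frame hτ₆ (by simp) (by simp)) hs hmax (fun i => ?_) (fun i => ?_) hgrid⟩
  all_goals simp [hτ₆.narr, hmark, hout, hτ₃.narr, hτ₂.narr, hτ₁.narr]

/-- The greedy algorithm. -/
@[simp] def greedy : Cmd := .seq prepare (forLoop Var.round Var.k round)

theorem Runs.greedy (A : Matrix (Fin n) (Fin m) ℝ) (hw : ∀ i, w i ≠ 0) (hk : 1 ≤ k) (hkn : k ≤ n)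
    (hkm : k ≤ m) : Runs greedy (selectInput A w k) (1500 * (k * (m * (n + 1) ^ 3))) fun τ =>
      ∃ l, l.length = k ∧ GreedyState A w k l τ := by
  have hm : 1 ≤ m := hk.trans hkm
  have hpos : 1 ≤ m * (n + 1) ^ 3 := Nat.mul_pos hm (by positivity)
  refine Runs.le (T := 700 * (m * (n + 1) ^ 3) + (k * (700 * (m * (n + 1) ^ 3) + 8) + 6)) ?_
    (by nlinarith [Nat.mul_le_mul_left k hpos, Nat.mul_le_mul_right (m * (n + 1) ^ 3) hk])
  refine (Runs.prepare A w k hm).seq fun τ _ h => Runs.forLoop'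
    (fun j ρ => ∃ l, l.length = j ∧ GreedyState A w k l ρ) h.picks (by simp) (by simp)
    ⟨[], rfl, h⟩ (fun j ρ hj _ hround ⟨l, hl, hρ⟩ => ?_)
    fun j ρ v ⟨l, hl, hρ⟩ => ⟨l, hl, hρ.setVar_round v⟩
  subst hl
  exact (Runs.round hw hk hkn (hj.trans_le hkm) hρ hround).post
    fun _ _ ⟨s, hs⟩ => ⟨l ++ [s], by simp, hs⟩

theorem cost_le {t : ℕ} (hn : 1 ≤ n) (hkm : k ≤ m) (ht : t ≤ 1500 * (k * (m * (n + 1) ^ 3))) :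
    (t : ℝ) ≤ 24000 * ((k : ℝ) * ((m : ℝ) - (k : ℝ) / 2) * (n : ℝ) ^ 3) := by
  have hn' : (n : ℝ) + 1 ≤ 2 * n := by norm_cast; lia
  have hm' : (m : ℝ) ≤ 2 * (m - k / 2) := by linarith [(Nat.cast_le (α := ℝ)).2 hkm]
  have hpos : 0 ≤ 2 * ((m : ℝ) - k / 2) := m.cast_nonneg.trans hm'
  calc (t : ℝ) ≤ 1500 * (k * (m * (n + 1) ^ 3)) := by exact_mod_cast ht
    _ ≤ 1500 * (k * (2 * (m - k / 2) * (2 * n) ^ 3)) := by gcongr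
    _ = _ := by ring

theorem mul_cube_le_mul_rpow (c n : ℕ) (hkm : k ≤ m) {θ : ℝ} (hθ : 2 < θ) :
    c * ((k : ℝ) * ((m : ℝ) - (k : ℝ) / 2) * (n : ℝ) ^ 3) ≤
      c * ((k : ℝ) * ((m : ℝ) - (k : ℝ) / 2) * (n : ℝ) ^ (θ + 1)) := by
  have hpow : (n : ℝ) ^ 3 ≤ (n : ℝ) ^ (θ + 1) := by
    rcases n.eq_zero_or_pos with rfl | hn
    · simp [Real.zero_rpow (by linarith : θ + 1 ≠ 0)]
    · rw [← Real.rpow_natCast]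
      exact Real.rpow_le_rpow_of_exponent_le (by exact_mod_cast hn) (by push_cast; linarith)
  have hm : 0 ≤ (m : ℝ) - k / 2 := by
    linarith [(Nat.cast_le (α := ℝ)).2 hkm, (k.cast_nonneg : (0 : ℝ) ≤ k)]
  gcongr

end Greedy

end RealRAM

end

theorem theorem4p1_general :
    (∀ (n m k : ℕ) (A : Matrix (Fin n) (Fin m) ℝ) (w : Fin m → ℝ),
      (∀ i, w i ≠ 0) → 1 ≤ k → k ≤ n → k ≤ m →
      (∀ l : List (Fin m), (WeightedRI.partialPoly A w k l).Splits ∧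
        (WeightedRI.partialPoly A w k l).natDegree = n) ∧
      (∀ l : List (Fin m), WeightedRI.GreedyRun A w k l → l.length = k →
        l.toFinset.card = k ∧
        WeightedRI.kthLargestRoot k (WeightedRI.partialPoly A w k []) ≤
          WeightedRI.sigmaMin
            (WeightedRI.colsOf A l.toFinset * WeightedRI.weightsOf w l.toFinset) ^ 2)) ∧
    (∃ (P : RealRAM.Cmd) (c : ℕ),
      ∀ (n m k : ℕ) (A : Matrix (Fin n) (Fin m) ℝ) (w : Fin m → ℝ),
        (∀ i, w i ≠ 0) → 1 ≤ k → k ≤ n → k ≤ m →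
        ∃ (l : List (Fin m)) (τ : RealRAM.State) (t : ℕ),
          WeightedRI.GreedyRun A w k l ∧ l.length = k ∧
          RealRAM.Exec P (RealRAM.selectInput A w k) τ t ∧
          τ.output k = l.map Fin.val ∧
          (t : ℝ) ≤ c * ((k : ℝ) * ((m : ℝ) - (k : ℝ) / 2) * (n : ℝ) ^ 3)) := by
  refine ⟨fun n m k A w hw hk hkn hkm => ?_, RealRAM.greedy, 24000,
    fun n m k A w hw hk hkn hkm => ?_⟩
  · have : Nonempty (Fin m) := ⟨⟨0, hk.trans hkm⟩⟩
    exact ⟨fun l => ⟨WeightedRI.splits_partialPoly A hw k l,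
      WeightedRI.natDegree_partialPoly A hw k l⟩, fun l h hl =>
      ⟨by rw [List.toFinset_card_of_nodup h.nodup, hl], h.le_sigmaMin_sq hw hk hkn hl⟩⟩
  · obtain ⟨τ, t, hexec, ht, l, rfl, h⟩ := RealRAM.Runs.greedy (A := A) hw hk hkn hkm
    exact ⟨l, τ, t, h.greedy, rfl, hexec, h.output, RealRAM.cost_le (hk.trans hkn) hkm ht⟩

/-- Columns are numbered `0, …, m - 1` in the output of the program. -/
theorem theorem4p1 :
    -- the partial assignment polynomials are real-rooted of degree `n`, and each possible output
    -- of the greedy algorithm satisfies the bound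
    (∀ (n m k : ℕ) (A : Matrix (Fin n) (Fin m) ℝ) (w : Fin m → ℝ),
      (∀ i, w i ≠ 0) → 1 ≤ k → k ≤ A.rank →
      (∀ l : List (Fin m), l.length ≤ k →
        (WeightedRI.partialPoly A w k l).Splits ∧
          (WeightedRI.partialPoly A w k l).natDegree = n) ∧
      (∀ l : List (Fin m), WeightedRI.GreedyRun A w k l → l.length = k →
        l.toFinset.card = k ∧
        WeightedRI.kthLargestRoot k (WeightedRI.partialPoly A w k []) ≤
          WeightedRI.sigmaMin
            (WeightedRI.colsOf A l.toFinset * WeightedRI.weightsOf w l.toFinset) ^ 2)) ∧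
    -- the greedy algorithm can be carried out in time `O(k (m - k/2) n ^ (θ + 1))`
    (∀ θ : ℝ, 2 < θ → RealRAM.IsMatMulExponent θ →
      ∃ (P : RealRAM.Cmd) (c : ℝ),
        ∀ (n m k : ℕ) (A : Matrix (Fin n) (Fin m) ℝ) (w : Fin m → ℝ),
          (∀ i, w i ≠ 0) → 1 ≤ k → k ≤ A.rank →
          ∃ (l : List (Fin m)) (τ : RealRAM.State) (t : ℕ),
            WeightedRI.GreedyRun A w k l ∧ l.length = k ∧
            RealRAM.Exec P (RealRAM.selectInput A w k) τ t ∧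
            τ.output k = l.map Fin.val ∧
            (t : ℝ) ≤ c * ((k : ℝ) * ((m : ℝ) - (k : ℝ) / 2) * (n : ℝ) ^ (θ + 1))) := by
  refine ⟨fun n m k A w hw hk hkr => (theorem4p1_general.1 n m k A w hw hk
    (hkr.trans A.rank_le_height) (hkr.trans A.rank_le_width)).imp_left fun h l _ => h l,
    fun θ hθ _ => ?_⟩
  obtain ⟨P, c, hP⟩ := theorem4p1_general.2
  refine ⟨P, c, fun n m k A w hw hk hkr => ?_⟩
  have hkm : k ≤ m := hkr.trans A.rank_le_width
  obtain ⟨l, τ, t, hl, hlk, hexec, hout, ht⟩ :=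
    hP n m k A w hw hk (hkr.trans A.rank_le_height) hkm
  exact ⟨l, τ, t, hl, hlk, hexec, hout, ht.trans (RealRAM.mul_cube_le_mul_rpow c n hkm hθ)⟩
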